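/- Let $w_\delta(x)=(1+|x|)^{-\delta}$ for $x\in\mathbb{R}^3$, and let $L^p_{w_\delta}=L^p(\mathbb{R}^3,w_\delta\,dx)$. Let $R_i=\partial_i/\sqrt{-\Delta}$ $(i=1,2,3)$ be the Riesz transforms, i.e. the Fourier multipliers with symbols $\mathrm{i}\,\xi_i/|\xi|$, extended by continuity from Schwartz functions to $L^p_{w_\delta}$. Let $1<\gamma<\frac52$, $0<T<+\infty$ and $\lambda>1$. Let $u=(u_j)_{1\le j\le 3}$ and $\mathbb{F}=(F_{i,j})_{1\le i,j\le 3}$ be a real vector field and a real tensor field on $(0,+\infty)\times\mathbb{R}^3$ such that, almost everywhere, $$\lambda\,u(\lambda^2t,\lambda x)=u(t,x),\qquad \lambda^2\,\mathbb{F}(\lambda^2t,\lambda x)=\mathbb{F}(t,x).$$ Assume that $\mathbb{F}\in L^2((0,T),L^2_{w_\gamma})$ and that, for all finite $\tau,R>0$, $u\in L^\infty((0,\tau),L^2(B(0,R)))$ and $\nabla u\in L^2((0,\tau),L^2(B(0,R)))$, where $\nabla u$ is the distributional spatial gradient of $u$ on $(0,+\infty)\times\mathbb{R}^3$. Let $q\in\mathcal{D}'((0,T)\times\mathbb{R}^3)$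 be a distribution such that, in the sense of distributions on $(0,T)\times\mathbb{R}^3$, $$\partial_tu=\Delta u-(u\cdot\nabla)u-\nabla q+\nabla\cdot\mathbb{F},\qquad \nabla\cdot u=0,$$ where $(u\cdot\nabla)u=\sum_{i}\partial_i(u_iu)$ and $(\nabla\cdot\mathbb{F})_j=\sum_{i}\partial_iF_{i,j}$. Then, for almost every $t\in(0,T)$, all the functions $R_iR_j(u_iu_j)(t,\cdot)\in L^{6/5}_{w_{6\gamma/5}}$ and $R_iR_jF_{i,j}(t,\cdot)\in L^2_{w_\gamma}$ are well defined; moreover $$\sum_{i=1}^3\sum_{j=1}^3R_iR_j(u_iu_j)\in L^4\big((0,T),L^{6/5}_{w_{6\gamma/5}}\big),\qquad \sum_{i=1}^3\sum_{j=1}^3R_iR_jF_{i,j}\in L^2\big((0,T),L^2_{w_\gamma}\big),$$ and, in $\mathcal{D}'((0,T)\times\mathbb{R}^3)$, $$\nabla q=\nabla\Big(\sum_{i=1}^3\sum_{j=1}^3R_iR_j(u_iu_j)-\sum_{i=1}^3\sum_{j=1}^3R_iR_jF_{i,j}\Big).$$ -/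

import Mathlib

open MeasureTheory Set Filter Topology TopologicalSpace
open scoped ENNReal Distributions LineDeriv FourierTransform SchwartzMap

noncomputable section

namespace NSPressure

/-- The physical space `ℝ³`. -/
abbrev E3 : Type := EuclideanSpace ℝ (Fin 3)

/-- The `i`-th vector of the canonical basis of `ℝ³`. -/
def e (i : Fin 3) : E3 := EuclideanSpace.single i 1

/-- The measure `w_δ(x) dx` on `ℝ³`, with `w_δ(x) = (1 + |x|)^(-δ)`; so `L^p_{w_δ}` is the
Lebesgue space `L^p` of this measure. -/
def weighted (δ : ℝ) : Measure E3 :=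
  volume.withDensity fun x => ENNReal.ofReal ((1 + ‖x‖) ^ (-δ))

/-- Membership in `L^r(I, L^p(μ))` for a function of time and space: joint measurability and
finiteness of the mixed norm `‖ t ↦ ‖f(t,·)‖_{L^p(μ)} ‖_{L^r(I)}`. -/
def MemMixed {V : Type*} [NormedAddCommGroup V] (r p : ℝ≥0∞) (I : Set ℝ) (μ : Measure E3)
    (f : ℝ → E3 → V) : Prop :=
  AEStronglyMeasurable (Function.uncurry f) ((volume.restrict I).prod μ) ∧
    eLpNorm (fun t => eLpNorm (f t) p μ) r (volume.restrict I) < ∞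

/-- Membership in `(L^r([0,∞), L^p))_loc`: the function is in `L^r((0,τ), L^p(B(0,R)))` for all
finite `τ` and `R` (so there is uniform control down to time `0`). -/
def MemMixedLoc {V : Type*} [NormedAddCommGroup V] (r p : ℝ≥0∞) (f : ℝ → E3 → V) : Prop :=
  ∀ τ R : ℝ, 0 < τ → 0 < R →
    MemMixed r p (Ioo 0 τ) (volume.restrict (Metric.ball 0 R)) f

/-- The open set `(0,T) × ℝ³` of space-time. -/
def slab (T : ℝ) : Opens (ℝ × E3) :=
  ⟨Ioo 0 T ×ˢ univ, isOpen_Ioo.prod isOpen_univ⟩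

/-- The open set `(0,∞) × ℝ³` of space-time. -/
def halfSpace : Opens (ℝ × E3) :=
  ⟨Ioi 0 ×ˢ univ, isOpen_Ioi.prod isOpen_univ⟩

/-- The distribution `φ ↦ ∫∫ f(t,x) φ(t,x) dt dx` on `Ω` given by a function `f` that is locally
integrable on `Ω`. -/
def toDistr (Ω : Opens (ℝ × E3)) (f : ℝ → E3 → ℝ) : 𝓓'(Ω, ℝ) :=
  (TestFunction.integralAgainstBilinCLM (ContinuousLinearMap.mul ℝ ℝ) volume
    (Function.uncurry f) : 𝓓(Ω, ℝ) →L[ℝ] ℝ)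

theorem toDistr_apply {Ω : Opens (ℝ × E3)} {f : ℝ → E3 → ℝ}
    (hf : LocallyIntegrableOn (Function.uncurry f) (Ω : Set (ℝ × E3))) (φ : 𝓓(Ω, ℝ)) :
    toDistr Ω f φ = ∫ z : ℝ × E3, φ z * f z.1 z.2 :=
  TestFunction.integralAgainstBilinCLM_eq_integral hf

/-- The time derivative of a distribution on an open subset of space-time. -/
def dt {Ω : Opens (ℝ × E3)} (S : 𝓓'(Ω, ℝ)) : 𝓓'(Ω, ℝ) := ∂_{((1 : ℝ), (0 : E3))} S

/-- The spatial derivative `∂_i` of a distribution on an open subset of space-time. -/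
def dx {Ω : Opens (ℝ × E3)} (i : Fin 3) (S : 𝓓'(Ω, ℝ)) : 𝓓'(Ω, ℝ) := ∂_{((0 : ℝ), e i)} S

/-- `∇u ∈ (L²([0,∞), L²))_loc`: every distributional derivative `∂_k u_i` on `(0,∞) × ℝ³` is a
function `G i k` with this integrability. -/
def HasLocL2Gradient (u : ℝ → E3 → E3) : Prop :=
  ∃ G : Fin 3 → Fin 3 → ℝ → E3 → ℝ,
    (∀ i k, MemMixedLoc 2 2 (G i k)) ∧
    ∀ i k, dx k (toDistr halfSpace fun t x => u t x i) = toDistr halfSpace (G i k)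

/-- `(u, q)` solves, in the sense of distributions on `(0,T) × ℝ³`, the Navier--Stokes equations
`∂_t u = Δ u - (u · ∇) u - ∇ q + ∇ · F`, `∇ · u = 0`. Here, `u` being divergence free,
`(u · ∇) u = ∑ i, ∂_i (u_i u)`; and `(∇ · F)_j = ∑ i, ∂_i F_{i,j}`. -/
structure IsNSSolution (T : ℝ) (u : ℝ → E3 → E3) (q : 𝓓'(slab T, ℝ))
    (F : Fin 3 → Fin 3 → ℝ → E3 → ℝ) : Prop where
  momentum : ∀ j, dt (toDistr (slab T) fun t x => u t x j) =
    (∑ i, dx i (dx i (toDistr (slab T) fun t x => u t x j)))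
      - (∑ i, dx i (toDistr (slab T) fun t x => u t x i * u t x j))
      - dx j q
      + ∑ i, dx i (toDistr (slab T) (F i j))
  divFree : ∑ i, dx i (toDistr (slab T) fun t x => u t x i) = 0

/-- `λ u(λ² t, λ x) = u(t,x)` almost everywhere on `(0,∞) × ℝ³`. -/
def IsDSSVelocity (lam : ℝ) (u : ℝ → E3 → E3) : Prop :=
  ∀ᵐ z : ℝ × E3 ∂(volume.restrict (halfSpace : Set (ℝ × E3))),
    lam • u (lam ^ 2 * z.1) (lam • z.2) = u z.1 z.2

/-- `λ² F(λ² t, λ x) = F(t,x)` almost everywhere on `(0,∞) × ℝ³`. -/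
def IsDSSForcing (lam : ℝ) (F : Fin 3 → Fin 3 → ℝ → E3 → ℝ) : Prop :=
  ∀ i j, ∀ᵐ z : ℝ × E3 ∂(volume.restrict (halfSpace : Set (ℝ × E3))),
    lam ^ 2 * F i j (lam ^ 2 * z.1) (lam • z.2) = F i j z.1 z.2

/-- The Riesz transform `R_j = ∂_j / √(-Δ)` on Schwartz functions: the Fourier multiplier with
symbol `i ξ_j / |ξ|`. The symbol takes conjugate values at `ξ` and `-ξ`, so that `R_j` maps real
functions to real functions; `re` only changes the type. -/
def rieszSchwartz (j : Fin 3) (φ : 𝓢(E3, ℝ)) (x : E3) : ℝ :=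
  (𝓕⁻ (fun ξ : E3 => Complex.I * ((ξ j / ‖ξ‖ : ℝ) : ℂ) *
    𝓕 (fun y : E3 => ((φ y : ℝ) : ℂ)) ξ) x).re

/-- `R_j f = g` in `L^p(μ)`, where `R_j` is the extension by continuity of the Riesz transform
from Schwartz functions to `L^p(μ)`: whenever Schwartz functions converge to `f` in `L^p(μ)`,
their Riesz transforms converge to `g` in `L^p(μ)`. -/
def IsRieszTransform (p : ℝ≥0∞) (μ : Measure E3) (j : Fin 3) (f g : E3 → ℝ) : Prop :=
  MemLp f p μ ∧ MemLp g p μ ∧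
    ∀ φ : ℕ → 𝓢(E3, ℝ),
      Tendsto (fun n => eLpNorm (fun x => φ n x - f x) p μ) atTop (𝓝 0) →
      Tendsto (fun n => eLpNorm (fun x => rieszSchwartz j (φ n) x - g x) p μ) atTop (𝓝 0)

/-- `R_i R_j f = g` in `L^p(μ)`. -/
def IsRieszRiesz (p : ℝ≥0∞) (μ : Measure E3) (i j : Fin 3) (f g : E3 → ℝ) : Prop :=
  ∃ h : E3 → ℝ, IsRieszTransform p μ j f h ∧ IsRieszTransform p μ i h g

end NSPressure

end

/-!
The proof has three parts: the Riesz transforms on weighted Lebesgue spaces, the integrability of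
`u_i u_j`, and the identification of the pressure by a Liouville theorem.

**Riesz transforms.** The definition of `IsRieszTransform` asks for bounds on Schwartz functions
in the norms of `L²_{w_γ}` and of `L^{6/5}_{w_{6γ/5}}`. Without weights, the bound on `L²` is
Plancherel's formula. For `L⁶`, the Riesz transform is a mean of directional Hilbert transforms
(`ballConst_mul_rieszSchwartz`), and these are bounded on `L⁶` by the argument of M. Riesz: the
analytic signal `A` of a real function has its spectrum in a half-space, and so has `A ^ 6`, hence
`∫ A ^ 6 = 0`; taking the real part gives a bound of `∫ (Im A) ^ 6` by `∫ (Re A) ^ 6`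
(`integral_analyticSignal_im_pow_le`). The bound on `L^{6/5}` follows by skew-adjointness
(`exists_lintegral_rieszSchwartz_six_fifths_le`).

The weight is of the order of `⟨x⟩ ^ (-δ)`, where `⟨x⟩ = √(1 + |x|²)`. Conjugating `R_j` by
`⟨x⟩ ^ (-s)`, for `s = δ / p`, costs the commutator of `R_j` with this power, and the kernel of the
commutator is less singular than that of `R_j`: only the bound `7 / |x - y| ^ 3` for the kernel of
`R_j` matters, and it follows from the formula for `1 / |ξ|` as an integral of Gaussians
(`rieszSchwartz_eq_integral_heat`, `enorm_commutator_le`). The commutator is then controlled by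
Schur's test with a power of `⟨x⟩` as the weight (`lintegral_rpow_lintegral_mul_le`,
`exists_lintegral_commKernel_le`). This gives `rieszBounded_two`, for `γ < 3`, and
`rieszBounded_six_fifths`, for `γ < 5 / 2`. The extension by continuity can be made on all the
time slices of a function at once, with a measurable result
(`RieszBounded.exists_isRieszRiesz_slice`).

**Velocity.** The local energy bounds, Sobolev's inequality on a ball and interpolation give
`u_i u_j ∈ L⁴((0,T), L^{6/5}(B_1))` (`lintegral_mul_ball_lt_top`). Scaling by `λ ^ k` reduces the
shell of radius `λ ^ k` to the unit ball, and its contribution to the norm in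
`L⁴((0,T), L^{6/5}_{w_{6γ/5}})` is `O(λ ^ ((1 - γ) k))`, which is summable since `γ > 1`
(`IsScaleInvariant.memMixed`).

**Pressure.** The divergence of the momentum equation is
`Δ q = -∑ ∂_i ∂_j (u_i u_j) + ∑ ∂_i ∂_j F_{i,j}`
(`IsNSSolution.sum_dx_dx_pressure`). As `-Δ R_i R_j f = ∂_i ∂_j f` holds in the weighted
spaces (`IsRieszRiesz.integral_mul_lap`), the distribution
`D = ∑ R_i R_j (u_i u_j) - ∑ R_i R_j F_{i,j}` has the same Laplacian as `q`, and the
derivatives `∂_k (q - D)` are harmonic in the space variable. They vanish: by the momentum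
equation, `∂_k (q - D)` is a sum of derivatives of
functions whose integrals over `(0,T) × B_ρ` are `o(ρ³)`, because they are in Lebesgue spaces with
weights `w_δ`, `δ < 3`; so the regularizations of `∂_k (q - D)` by test functions are harmonic
functions with mean values tending to zero over large balls, and these are zero
(`IsNullAtInfinity.eq_zero`).
-/

namespace NSPressure

/-! ### Plancherel's formula -/

section Plancherel

variable {V : Type*} [NormedAddCommGroup V] [InnerProductSpace ℝ V] [FiniteDimensional ℝ V]
  [MeasurableSpace V] [BorelSpace V]

theorem integral_fourierInv_mul {f g : V → ℂ} (hf : Integrable f) (hg : Integrable g) :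
    ∫ x, 𝓕⁻ f x * g x = ∫ x, f x * 𝓕⁻ g x := by
  have key := VectorFourier.integral_bilin_fourierIntegral_eq_flip (e := Real.fourierChar)
    (μ := (volume : Measure V)) (ν := (volume : Measure V)) (L := -innerₗ V)
    (ContinuousLinearMap.mul ℂ ℂ) Real.continuous_fourierChar
    (by simpa using (continuous_inner (𝕜 := ℝ) (E := V)).fun_neg) hf hg
  simp only [ContinuousLinearMap.mul_apply'] at key
  have h1 : ∀ h : V → ℂ, VectorFourier.fourierIntegral Real.fourierChar volume (-innerₗ V) h
      = 𝓕⁻ h := fun h => rfl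
  have h2 : (-innerₗ V).flip = -innerₗ V := by
    ext x y; simp [real_inner_comm]
  rw [h2, h1, h1] at key
  exact key

theorem continuous_fourierInv_of_integrable {f : V → ℂ} (hf : Integrable f) :
    Continuous (𝓕⁻ f) :=
  VectorFourier.fourierIntegral_continuous Real.continuous_fourierChar
    (L := -innerₗ V) (by simpa using (continuous_inner (𝕜 := ℝ) (E := V)).fun_neg) hf

theorem norm_fourierInv_le {f : V → ℂ} (x : V) : ‖𝓕⁻ f x‖ ≤ ∫ y, ‖f y‖ :=
  VectorFourier.norm_fourierIntegral_le_integral_norm _ _ _ _ _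

/-- For an integrable and square integrable function, the pointwise inverse Fourier transform
represents the inverse Fourier transform defined on `L²` by density. -/
theorem fourierInv_toLp_ae_eq {f : V → ℂ} (hf : Integrable f) (hf2 : MemLp f 2) :
    (𝓕⁻ (hf2.toLp f) : Lp ℂ 2 (volume : Measure V)) =ᵐ[volume] 𝓕⁻ f := by
  refine ae_eq_of_integral_contDiff_smul_eq ?_ ?_ ?_
  · exact (Lp.memLp _).locallyIntegrable (by norm_num)
  · exact (continuous_fourierInv_of_integrable hf).locallyIntegrable
  · intro g hg hgc
    let gc : 𝓢(V, ℂ) := HasCompactSupport.toSchwartzMap (f := fun x => (g x : ℂ))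
      (hgc.comp_left Complex.ofReal_zero) (Complex.ofRealCLM.contDiff.comp hg)
    have e1 : ∀ F : V → ℂ, ∫ x, g x • F x = ∫ x, gc x • F x := by
      intro F; congr
    rw [e1, e1, ← Lp.toTemperedDistribution_apply, ← Lp.fourierInv_toTemperedDistribution_eq,
      TemperedDistribution.fourierInv_apply, Lp.toTemperedDistribution_apply]
    have e2 := integral_fourierInv_mul gc.integrable hf
    simp only [smul_eq_mul]
    rw [← e2, ← SchwartzMap.fourierInv_coe]
    refine integral_congr_ae ?_
    filter_upwards [hf2.coeFn_toLp] with x hx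
    rw [hx]

theorem memLp_two_fourierInv {f : V → ℂ} (hf : Integrable f) (hf2 : MemLp f 2) :
    MemLp (𝓕⁻ f) 2 :=
  (memLp_congr_ae (fourierInv_toLp_ae_eq hf hf2)).1 (Lp.memLp _)

/-- Plancherel's formula for functions that are integrable and square integrable. -/
theorem eLpNorm_fourierInv {f : V → ℂ} (hf : Integrable f) (hf2 : MemLp f 2) :
    eLpNorm (𝓕⁻ f) 2 volume = eLpNorm f 2 volume := by
  rw [← eLpNorm_congr_ae (fourierInv_toLp_ae_eq hf hf2), ← eLpNorm_congr_ae hf2.coeFn_toLp,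
    ← Lp.enorm_def, ← Lp.enorm_def, enorm_eq_iff_norm_eq]
  have := Lp.norm_fourier_eq (𝓕⁻ (hf2.toLp f) : Lp ℂ 2 (volume : Measure V))
  rw [← this, FourierTransform.fourier_fourierInv_eq]

open ComplexConjugate in
/-- Parseval's formula for functions that are integrable and square integrable. -/
theorem integral_conj_fourierInv_mul {f g : V → ℂ} (hf : Integrable f) (hf2 : MemLp f 2)
    (hg : Integrable g) (hg2 : MemLp g 2) :
    ∫ x, conj (𝓕⁻ f x) * 𝓕⁻ g x = ∫ x, conj (f x) * g x := by
  have h := Lp.inner_fourier_eq (𝓕⁻ (hf2.toLp f) : Lp ℂ 2 (volume : Measure V)) (𝓕⁻ (hg2.toLp g))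
  rw [FourierTransform.fourier_fourierInv_eq, FourierTransform.fourier_fourierInv_eq,
    L2.inner_def, L2.inner_def] at h
  have e1 : ∫ x, conj (𝓕⁻ f x) * 𝓕⁻ g x = ∫ x, inner ℂ
      ((𝓕⁻ (hf2.toLp f) : Lp ℂ 2 (volume : Measure V)) x)
      ((𝓕⁻ (hg2.toLp g) : Lp ℂ 2 (volume : Measure V)) x) := by
    refine integral_congr_ae ?_
    filter_upwards [fourierInv_toLp_ae_eq hf hf2, fourierInv_toLp_ae_eq hg hg2] with x h1 h2
    rw [h1, h2, RCLike.inner_apply, mul_comm]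
  rw [e1, ← h]
  refine integral_congr_ae ?_
  filter_upwards [hf2.coeFn_toLp, hg2.coeFn_toLp] with x h1 h2
  rw [h1, h2, RCLike.inner_apply, mul_comm]

end Plancherel

/-! ### Riesz transforms of Schwartz functions -/

section Riesz

open ComplexConjugate

/-- A real Schwartz function, seen as a complex valued one. -/
noncomputable def complexify (φ : 𝓢(E3, ℝ)) : 𝓢(E3, ℂ) :=
  SchwartzMap.postcompCLM Complex.ofRealCLM φ

@[simp] theorem complexify_apply (φ : 𝓢(E3, ℝ)) (x : E3) : complexify φ x = φ x := rfl

/-- The Fourier transform of a real Schwartz function. -/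
noncomputable def hat (φ : 𝓢(E3, ℝ)) : 𝓢(E3, ℂ) := 𝓕 (complexify φ)

theorem fourierInv_hat (φ : 𝓢(E3, ℝ)) : 𝓕⁻ (hat φ : E3 → ℂ) = fun x => (φ x : ℂ) := by
  rw [← SchwartzMap.fourierInv_coe, hat, FourierTransform.fourierInv_fourier_eq]
  rfl

/-- The symbol `i ξ_j / |ξ|` of the Riesz transform `R_j`. -/
noncomputable def rieszSymbol (j : Fin 3) (ξ : E3) : ℂ := Complex.I * ((ξ j / ‖ξ‖ : ℝ) : ℂ)

theorem norm_rieszSymbol_le (j : Fin 3) (ξ : E3) : ‖rieszSymbol j ξ‖ ≤ 1 := by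
  rw [rieszSymbol, norm_mul, Complex.norm_I, one_mul, Complex.norm_real, norm_div, norm_norm]
  exact div_le_one_of_le₀ (PiLp.norm_apply_le ξ j) (norm_nonneg _)

theorem rieszSymbol_neg (j : Fin 3) (ξ : E3) : rieszSymbol j (-ξ) = -rieszSymbol j ξ := by
  simp [rieszSymbol, neg_div]

theorem conj_rieszSymbol (j : Fin 3) (ξ : E3) : conj (rieszSymbol j ξ) = -rieszSymbol j ξ := by
  simp only [rieszSymbol, map_mul, Complex.conj_I, Complex.conj_ofReal, neg_mul]

@[fun_prop]
theorem measurable_rieszSymbol (j : Fin 3) : Measurable (rieszSymbol j) := by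
  unfold rieszSymbol
  have : Measurable fun ξ : E3 => ξ j := (EuclideanSpace.proj (𝕜 := ℝ) j).continuous.measurable
  fun_prop

/-- The Fourier transform of the Riesz transform of a Schwartz function. -/
noncomputable def rieszFourier (j : Fin 3) (φ : 𝓢(E3, ℝ)) (ξ : E3) : ℂ :=
  rieszSymbol j ξ * hat φ ξ

theorem norm_rieszFourier_le (j : Fin 3) (φ : 𝓢(E3, ℝ)) (ξ : E3) :
    ‖rieszFourier j φ ξ‖ ≤ ‖hat φ ξ‖ := by
  rw [rieszFourier, norm_mul]
  exact mul_le_of_le_one_left (norm_nonneg _) (norm_rieszSymbol_le j ξ)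

@[fun_prop]
theorem measurable_rieszFourier (j : Fin 3) (φ : 𝓢(E3, ℝ)) : Measurable (rieszFourier j φ) :=
  (measurable_rieszSymbol j).mul (hat φ).continuous.measurable

theorem memLp_rieszFourier (j : Fin 3) (φ : 𝓢(E3, ℝ)) (p : ℝ≥0∞) : MemLp (rieszFourier j φ) p :=
  ((hat φ).memLp p).mono (measurable_rieszFourier j φ).aestronglyMeasurable
    (ae_of_all _ (norm_rieszFourier_le j φ))

theorem integrable_rieszFourier (j : Fin 3) (φ : 𝓢(E3, ℝ)) : Integrable (rieszFourier j φ) :=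
  memLp_one_iff_integrable.1 (memLp_rieszFourier j φ 1)

theorem conj_fourierInv {f : E3 → ℂ} (x : E3) :
    conj (𝓕⁻ f x) = 𝓕⁻ (fun ξ => conj (f (-ξ))) x := by
  rw [Real.fourierInv_eq', Real.fourierInv_eq', ← integral_conj, ← integral_neg_eq_self]
  refine integral_congr_ae (ae_of_all _ fun ξ => ?_)
  simp only [smul_eq_mul, map_mul, ← Complex.exp_conj, Complex.conj_ofReal, Complex.conj_I,
    inner_neg_left, Complex.ofReal_neg, Complex.ofReal_mul, mul_neg, neg_mul, neg_neg, map_neg]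

theorem conj_fourier_complexify (φ : 𝓢(E3, ℝ)) (ξ : E3) :
    conj (hat φ (-ξ)) = hat φ ξ := by
  rw [hat, SchwartzMap.fourier_coe, Real.fourier_eq', Real.fourier_eq', ← integral_conj]
  refine integral_congr_ae (ae_of_all _ fun x => ?_)
  simp only [smul_eq_mul, map_mul, ← Complex.exp_conj, Complex.conj_ofReal, Complex.conj_I,
    inner_neg_right, Complex.ofReal_neg, Complex.ofReal_mul, mul_neg, neg_mul, neg_neg,
    complexify_apply]

/-- The multiplier `rieszSymbol j` maps real functions to real functions, so taking the real part in
the definition of `rieszSchwartz` loses nothing. -/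
theorem ofReal_rieszSchwartz (j : Fin 3) (φ : 𝓢(E3, ℝ)) (x : E3) :
    (rieszSchwartz j φ x : ℂ) = 𝓕⁻ (rieszFourier j φ) x := by
  have h : conj (𝓕⁻ (rieszFourier j φ) x) = 𝓕⁻ (rieszFourier j φ) x := by
    rw [conj_fourierInv]
    refine congrArg (fun f : E3 → ℂ => 𝓕⁻ f x) (funext fun ξ => ?_)
    rw [rieszFourier, map_mul, conj_fourier_complexify, conj_rieszSymbol, rieszSymbol_neg, neg_neg,
      rieszFourier]
  exact Complex.conj_eq_iff_re.1 h

theorem contDiff_rieszSchwartz (j : Fin 3) (φ : 𝓢(E3, ℝ)) :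
    ContDiff ℝ (⊤ : ℕ∞) (rieszSchwartz j φ) := by
  have h : ContDiff ℝ (⊤ : ℕ∞) (𝓕⁻ (rieszFourier j φ)) := by
    have h1 : 𝓕⁻ (rieszFourier j φ) = 𝓕 (fun ξ => rieszFourier j φ (-ξ)) :=
      Real.fourierInv_eq_fourier_comp_neg _
    rw [h1]
    refine Real.contDiff_fourier (N := ⊤) fun n _ => ?_
    have := ((hat φ).integrable_pow_mul volume n).comp_neg
    refine this.mono' ?_ (ae_of_all _ fun ξ => ?_)
    · have := (measurable_rieszFourier j φ).comp measurable_neg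
      exact (by fun_prop : Measurable _).aestronglyMeasurable
    · simp only [norm_neg, norm_mul, norm_pow, norm_norm]
      gcongr
      exact norm_rieszFourier_le j φ _
  exact (Complex.reCLM.contDiff).comp h

@[fun_prop]
theorem continuous_rieszSchwartz (j : Fin 3) (φ : 𝓢(E3, ℝ)) : Continuous (rieszSchwartz j φ) :=
  (contDiff_rieszSchwartz j φ).continuous

theorem eLpNorm_ofReal {μ : Measure E3} (p : ℝ≥0∞) (f : E3 → ℝ) :
    eLpNorm (fun x => (f x : ℂ)) p μ = eLpNorm f p μ :=
  eLpNorm_congr_norm_ae (ae_of_all _ fun x => by simp)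

theorem eLpNorm_rieszSchwartz_two_le (j : Fin 3) (φ : 𝓢(E3, ℝ)) :
    eLpNorm (rieszSchwartz j φ) 2 volume ≤ eLpNorm φ 2 volume := by
  rw [← eLpNorm_ofReal, ← eLpNorm_ofReal]
  simp only [ofReal_rieszSchwartz]
  calc eLpNorm (𝓕⁻ (rieszFourier j φ)) 2 volume
      = eLpNorm (rieszFourier j φ) 2 volume :=
        eLpNorm_fourierInv (integrable_rieszFourier j φ) (memLp_rieszFourier j φ 2)
    _ ≤ eLpNorm (hat φ) 2 volume := eLpNorm_mono (norm_rieszFourier_le j φ)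
    _ = eLpNorm (𝓕⁻ (hat φ : E3 → ℂ)) 2 volume :=
        (eLpNorm_fourierInv (hat φ).integrable ((hat φ).memLp 2)).symm
    _ = eLpNorm (fun x => (φ x : ℂ)) 2 volume := by rw [fourierInv_hat]

theorem memLp_rieszSchwartz_two (j : Fin 3) (φ : 𝓢(E3, ℝ)) :
    MemLp (rieszSchwartz j φ) 2 volume := by
  refine ⟨(continuous_rieszSchwartz j φ).aestronglyMeasurable, ?_⟩
  exact lt_of_le_of_lt (eLpNorm_rieszSchwartz_two_le j φ) (φ.memLp 2 volume).eLpNorm_lt_top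

/-- The Riesz transforms are skew-adjoint. -/
theorem integral_rieszSchwartz_mul (j : Fin 3) (φ ψ : 𝓢(E3, ℝ)) :
    ∫ x, rieszSchwartz j φ x * ψ x = -∫ x, φ x * rieszSchwartz j ψ x := by
  have h1 := integral_conj_fourierInv_mul (integrable_rieszFourier j φ) (memLp_rieszFourier j φ 2)
    (hat ψ).integrable ((hat ψ).memLp 2)
  have h2 := integral_conj_fourierInv_mul (hat φ).integrable
    ((hat φ).memLp 2) (integrable_rieszFourier j ψ) (memLp_rieszFourier j ψ 2)
  simp only [fourierInv_hat, ← ofReal_rieszSchwartz, Complex.conj_ofReal] at h1 h2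
  have h3 : ∀ x, conj (rieszFourier j φ x) * hat ψ x
      = -(conj (hat φ x) * rieszFourier j ψ x) := by
    intro x; simp only [rieszFourier, map_mul, conj_rieszSymbol]; ring
  rw [integral_congr_ae (ae_of_all _ h3), integral_neg, ← h2] at h1
  simp only [← Complex.ofReal_mul] at h1
  rw [integral_complex_ofReal, integral_complex_ofReal, ← Complex.ofReal_neg] at h1
  exact Complex.ofReal_injective h1

end Riesz

/-! ### Functions with spectrum in a half-space -/

section HalfSpaceSupport

variable {V : Type*} [NormedAddCommGroup V] [InnerProductSpace ℝ V] [FiniteDimensional ℝ V]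
  [MeasurableSpace V] [BorelSpace V]

/-- `g` is integrable and vanishes outside of the open half-space `{ξ | 0 < ⟪θ, ξ⟫}`. -/
structure HalfSupported (θ : V) (g : V → ℂ) : Prop where
  integrable : Integrable g
  eq_zero : ∀ ξ, inner ℝ θ ξ ≤ 0 → g ξ = 0

/-- The spectrum of a product is contained in the sum of the spectra, and a half-space is stable
under addition. -/
theorem HalfSupported.fourierInv_mul {θ : V} {g₁ g₂ : V → ℂ} (h₁ : HalfSupported θ g₁)
    (h₂ : HalfSupported θ g₂) :
    ∃ g, HalfSupported θ g ∧ ∀ x, 𝓕⁻ g x = 𝓕⁻ g₁ x * 𝓕⁻ g₂ x := by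
  refine ⟨convolution g₁ g₂ (ContinuousLinearMap.mul ℂ ℂ) volume, ⟨?_, fun ξ hξ => ?_⟩,
    fun x => ?_⟩
  · exact h₁.integrable.integrable_convolution _ h₂.integrable
  · rw [convolution_def]
    refine integral_eq_zero_of_ae (ae_of_all _ fun t => ?_)
    simp only [ContinuousLinearMap.mul_apply', Pi.zero_apply, mul_eq_zero]
    by_cases ht : inner ℝ θ t ≤ 0
    · exact Or.inl (h₁.eq_zero t ht)
    · refine Or.inr (h₂.eq_zero _ ?_)
      rw [inner_sub_right]; linarith
  · simp only [Real.fourierInv_eq_fourier_neg]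
    exact Real.fourier_mul_convolution_eq h₁.integrable h₂.integrable _

theorem HalfSupported.fourierInv_pow_succ {θ : V} {g : V → ℂ} (h : HalfSupported θ g) (n : ℕ) :
    ∃ g', HalfSupported θ g' ∧ ∀ x, 𝓕⁻ g' x = 𝓕⁻ g x ^ (n + 1) := by
  induction n with
  | zero => exact ⟨g, h, fun x => by simp⟩
  | succ n ih =>
    obtain ⟨g', hg', h'⟩ := ih
    obtain ⟨g'', hg'', h''⟩ := hg'.fourierInv_mul h
    exact ⟨g'', hg'', fun x => by rw [h'', h', pow_succ _ (n + 1)]⟩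

/-- The Fourier transform of `𝓕⁻ g` is continuous and vanishes on the half-space where `g` does,
hence at the origin, where it is the integral of `𝓕⁻ g`. -/
theorem HalfSupported.integral_fourierInv_eq_zero {θ : V} (hθ : θ ≠ 0) {g : V → ℂ}
    (h : HalfSupported θ g) (hi : Integrable (𝓕⁻ g)) : ∫ x, 𝓕⁻ g x = 0 := by
  have hi' : Integrable (𝓕 g) := by
    have := hi.comp_neg
    refine this.congr (ae_of_all _ fun x => ?_)
    simp [Real.fourierInv_eq_fourier_neg]
  have hneg : ∀ ξ, inner ℝ θ ξ < 0 → 𝓕 (𝓕⁻ g) ξ = 0 := by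
    intro ξ hξ
    have hopen : IsOpen {η : V | inner ℝ θ η < 0} :=
      isOpen_lt (by fun_prop) continuous_const
    have hev : ∀ᶠ η in 𝓝 ξ, g η = 0 :=
      mem_of_superset (hopen.mem_nhds hξ) fun η (hη : inner ℝ θ η < 0) => h.eq_zero η hη.le
    rw [h.integrable.fourier_fourierInv_eq hi' ?_, h.eq_zero ξ hξ.le]
    exact (continuousAt_const (y := (0 : ℂ))).congr (hev.mono fun _ h => h.symm)
  have hcont : Continuous (𝓕 (𝓕⁻ g)) := by
    have h1 : 𝓕 (𝓕⁻ g) = fun x => 𝓕⁻ (𝓕⁻ g) (-x) := by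
      funext x; simp [Real.fourierInv_eq_fourier_neg]
    rw [h1]
    exact (continuous_fourierInv_of_integrable hi).comp continuous_neg
  have ht : Tendsto (fun s : ℝ => 𝓕 (𝓕⁻ g) (-(s • θ))) (𝓝[>] 0) (𝓝 (𝓕 (𝓕⁻ g) 0)) := by
    have : Continuous fun s : ℝ => 𝓕 (𝓕⁻ g) (-(s • θ)) := hcont.comp (by fun_prop)
    simpa using (this.tendsto 0).mono_left nhdsWithin_le_nhds
  have h0 : Tendsto (fun s : ℝ => 𝓕 (𝓕⁻ g) (-(s • θ))) (𝓝[>] 0) (𝓝 0) := by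
    refine tendsto_const_nhds.congr' ?_
    filter_upwards [self_mem_nhdsWithin] with s (hs : 0 < s)
    refine (hneg _ ?_).symm
    rw [inner_neg_right, inner_smul_right, neg_lt_zero]
    exact mul_pos hs (real_inner_self_pos.2 hθ)
  have := tendsto_nhds_unique ht h0
  rw [Real.fourier_eq'] at this
  simpa using this

theorem ae_inner_ne_zero {θ : V} (hθ : θ ≠ 0) : ∀ᵐ ξ : V, inner ℝ θ ξ ≠ 0 := by
  have h : volume (((ℝ ∙ θ)ᗮ : Submodule ℝ V) : Set V) = 0 := by
    refine Measure.addHaar_submodule _ _ fun h => hθ ?_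
    have : θ ∈ (ℝ ∙ θ)ᗮ := h ▸ Submodule.mem_top
    exact inner_self_eq_zero.1 (Submodule.mem_orthogonal_singleton_iff_inner_right.1 this)
  refine (measure_eq_zero_iff_ae_notMem.1 h).mono fun ξ hξ h0 => hξ ?_
  exact Submodule.mem_orthogonal_singleton_iff_inner_right.2 h0

end HalfSpaceSupport

/-! ### Directional Hilbert transforms on `L⁶` -/

section Directional

open ComplexConjugate

/-- The restriction of the Fourier transform of `φ` to the half-space `{ξ | 0 < ⟪θ, ξ⟫}`. -/
noncomputable def halfHat (θ : E3) (φ : 𝓢(E3, ℝ)) (ξ : E3) : ℂ :=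
  {ξ : E3 | 0 < inner ℝ θ ξ}.indicator (hat φ) ξ

/-- Half of the analytic signal of `φ` in the direction `θ`: its real part is `φ / 2`, and its
imaginary part is half of the directional Hilbert transform of `φ`. -/
noncomputable def analyticSignal (θ : E3) (φ : 𝓢(E3, ℝ)) : E3 → ℂ := 𝓕⁻ (halfHat θ φ)

theorem memLp_halfHat (θ : E3) (φ : 𝓢(E3, ℝ)) (p : ℝ≥0∞) : MemLp (halfHat θ φ) p :=
  ((hat φ).memLp p).indicator (measurableSet_lt measurable_const (by fun_prop))

theorem halfSupported_halfHat (θ : E3) (φ : 𝓢(E3, ℝ)) : HalfSupported θ (halfHat θ φ) :=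
  ⟨memLp_one_iff_integrable.1 (memLp_halfHat θ φ 1), fun ξ hξ =>
    indicator_of_notMem (by simpa using hξ) _⟩

theorem hat_eq_halfHat_add {θ : E3} (φ : 𝓢(E3, ℝ)) {ξ : E3} (hξ : inner ℝ θ ξ ≠ 0) :
    hat φ ξ = halfHat θ φ ξ + conj (halfHat θ φ (-ξ)) := by
  rcases lt_or_gt_of_ne hξ with h | h
  · have h1 : halfHat θ φ ξ = 0 := indicator_of_notMem (by simpa using h.le) _
    have h2 : halfHat θ φ (-ξ) = hat φ (-ξ) := indicator_of_mem (by simpa using h) _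
    rw [h1, h2, conj_fourier_complexify, zero_add]
  · have h1 : halfHat θ φ ξ = hat φ ξ := indicator_of_mem (by simpa using h) _
    have h2 : halfHat θ φ (-ξ) = 0 := indicator_of_notMem (by simpa using h.le) _
    rw [h1, h2, map_zero, add_zero]

theorem fourierInv_add_of_integrable {f g : E3 → ℂ} (hf : Integrable f) (hg : Integrable g)
    (x : E3) : 𝓕⁻ (fun ξ => f ξ + g ξ) x = 𝓕⁻ f x + 𝓕⁻ g x := by
  have := VectorFourier.fourierIntegral_add (e := Real.fourierChar) (μ := (volume : Measure E3))
    (L := -innerₗ E3) Real.continuous_fourierChar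
    (by simpa using (continuous_inner (𝕜 := ℝ) (E := E3)).fun_neg) hf hg
  exact congrFun this x

theorem analyticSignal_re {θ : E3} (hθ : θ ≠ 0) (φ : 𝓢(E3, ℝ)) (x : E3) :
    (analyticSignal θ φ x).re = φ x / 2 := by
  have hi := (halfSupported_halfHat θ φ).integrable
  have hi' : Integrable fun ξ => conj (halfHat θ φ (-ξ)) :=
    (RCLike.conjCLE.integrable_comp_iff.2 hi.comp_neg)
  have h : ((φ x : ℝ) : ℂ) = analyticSignal θ φ x + conj (analyticSignal θ φ x) := by
    rw [analyticSignal, conj_fourierInv, ← fourierInv_add_of_integrable hi hi',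
      ← congrFun (fourierInv_hat φ) x]
    refine Real.fourierInv_congr_ae ?_ x
    filter_upwards [ae_inner_ne_zero hθ] with ξ hξ using hat_eq_halfHat_add φ hξ
  have := congrArg Complex.re h
  simp only [Complex.ofReal_re, Complex.add_re, Complex.conj_re] at this
  linarith

theorem continuous_analyticSignal (θ : E3) (φ : 𝓢(E3, ℝ)) : Continuous (analyticSignal θ φ) :=
  continuous_fourierInv_of_integrable (halfSupported_halfHat θ φ).integrable

theorem integrable_norm_analyticSignal_pow (θ : E3) (φ : 𝓢(E3, ℝ)) :
    Integrable fun x => ‖analyticSignal θ φ x‖ ^ 6 := by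
  have h2 : MemLp (analyticSignal θ φ) 2 :=
    memLp_two_fourierInv (halfSupported_halfHat θ φ).integrable (memLp_halfHat θ φ 2)
  have h3 : Integrable fun x => ‖analyticSignal θ φ x‖ ^ 2 := h2.integrable_norm_pow (by norm_num)
  set M := ∫ y, ‖halfHat θ φ y‖
  refine (h3.const_mul (M ^ 4)).mono' ?_ (ae_of_all _ fun x => ?_)
  · exact ((continuous_analyticSignal θ φ).norm.pow 6).aestronglyMeasurable
  · have h : ‖analyticSignal θ φ x‖ ≤ M := norm_fourierInv_le x
    rw [norm_pow, norm_norm, show 6 = 4 + 2 from rfl, pow_add]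
    gcongr

/-- Analyticity makes `∫ A ^ 6` vanish; taking real parts bounds `∫ (Im A) ^ 6` by
`∫ (Re A) ^ 6`. -/
theorem integral_analyticSignal_im_pow_le {θ : E3} (hθ : θ ≠ 0) (φ : 𝓢(E3, ℝ)) :
    ∫ x, (analyticSignal θ φ x).im ^ 6 ≤ 63 * ∫ x, φ x ^ 6 := by
  have hint := integrable_norm_analyticSignal_pow θ φ
  have hA6 : Integrable fun x => analyticSignal θ φ x ^ 6 := by
    refine (integrable_norm_iff ?_).1 (by simpa using hint)
    exact ((continuous_analyticSignal θ φ).pow 6).aestronglyMeasurable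
  have hre6 : Integrable fun x => (analyticSignal θ φ x ^ 6).re := hA6.re
  have hzero : ∫ x, (analyticSignal θ φ x ^ 6).re = 0 := by
    obtain ⟨g, hg, hgA⟩ := (halfSupported_halfHat θ φ).fourierInv_pow_succ 5
    have hgA' : 𝓕⁻ g = fun x => analyticSignal θ φ x ^ 6 := funext hgA
    have h0 := hg.integral_fourierInv_eq_zero hθ (by rw [hgA']; exact hA6)
    rw [hgA'] at h0
    have := integral_re (𝕜 := ℂ) hA6
    simp only [RCLike.re_to_complex] at this
    rw [this, h0, Complex.zero_re]
  have hφ6 : Integrable fun x => φ x ^ 6 := by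
    have : Integrable fun x => 64 * (analyticSignal θ φ x).re ^ 6 := by
      refine Integrable.const_mul (hint.mono' ?_ (ae_of_all _ fun x => ?_)) _
      · exact ((Complex.continuous_re.comp
          (continuous_analyticSignal θ φ)).pow 6).aestronglyMeasurable
      · rw [norm_pow]; gcongr; exact Complex.abs_re_le_norm _
    refine this.congr (ae_of_all _ fun x => ?_)
    simp only [analyticSignal_re hθ]; ring
  have hpt : ∀ x, (analyticSignal θ φ x).im ^ 6
      ≤ -2 * (analyticSignal θ φ x ^ 6).re + 63 * φ x ^ 6 := by
    intro x
    have hre := analyticSignal_re hθ φ x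
    set a := (analyticSignal θ φ x).re
    set b := (analyticSignal θ φ x).im
    have h6 : (analyticSignal θ φ x ^ 6).re
        = a ^ 6 - 15 * a ^ 4 * b ^ 2 + 15 * a ^ 2 * b ^ 4 - b ^ 6 := by
      simp only [pow_succ, pow_zero, one_mul, Complex.mul_re, Complex.mul_im]
      ring
    have hφ : φ x = 2 * a := by linarith
    rw [h6, hφ]
    -- with `A = a + i b`, the difference of the two sides is
    -- `(b² - 20 a²)² (b² + 10 a²) + 30 a⁴ b² + 30 a⁶`
    have h1 : 0 ≤ (b ^ 2 - 20 * a ^ 2) ^ 2 * (b ^ 2 + 10 * a ^ 2) := by positivity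
    have h2 : 0 ≤ a ^ 4 * b ^ 2 := by positivity
    have h3 : 0 ≤ a ^ 6 := by positivity
    nlinarith
  calc ∫ x, (analyticSignal θ φ x).im ^ 6
      ≤ ∫ x, (-2 * (analyticSignal θ φ x ^ 6).re + 63 * φ x ^ 6) := by
        refine integral_mono_of_nonneg (ae_of_all _ fun x => by positivity)
          ((hre6.const_mul _).add (hφ6.const_mul _)) (ae_of_all _ hpt)
    _ = 63 * ∫ x, φ x ^ 6 := by
        rw [integral_add (hre6.const_mul _) (hφ6.const_mul _), integral_const_mul,
          integral_const_mul, hzero, mul_zero, zero_add]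

theorem lintegral_enorm_analyticSignal_im_pow_le {θ : E3} (hθ : θ ≠ 0) (φ : 𝓢(E3, ℝ)) :
    ∫⁻ x, ‖(analyticSignal θ φ x).im‖ₑ ^ 6 ≤ 63 * ∫⁻ x, ‖φ x‖ₑ ^ 6 := by
  have hint := integrable_norm_analyticSignal_pow θ φ
  have h1 : ∀ f : E3 → ℝ, Continuous f → (∀ x, |f x| ≤ 2 * ‖analyticSignal θ φ x‖) →
      ∫⁻ x, ‖f x‖ₑ ^ 6 = ENNReal.ofReal (∫ x, f x ^ 6) := by
    intro f hf hle
    rw [ofReal_integral_eq_lintegral_ofReal]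
    · refine lintegral_congr fun x => ?_
      rw [← Even.pow_abs (by decide : Even 6), ENNReal.ofReal_pow (abs_nonneg _),
        Real.enorm_eq_ofReal_abs]
    · refine (hint.const_mul 64).mono' (hf.pow 6).aestronglyMeasurable (ae_of_all _ fun x => ?_)
      calc ‖f x ^ 6‖ = |f x| ^ 6 := by rw [norm_pow, Real.norm_eq_abs]
        _ ≤ (2 * ‖analyticSignal θ φ x‖) ^ 6 := by gcongr; exact hle x
        _ = _ := by ring
    · exact ae_of_all _ fun x => by positivity
  rw [h1 (fun x => (analyticSignal θ φ x).im)
    (Complex.continuous_im.comp (continuous_analyticSignal θ φ)), h1 φ φ.continuous,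
    show (63 : ℝ≥0∞) = ENNReal.ofReal 63 by norm_num, ← ENNReal.ofReal_mul (by norm_num)]
  · exact ENNReal.ofReal_le_ofReal (integral_analyticSignal_im_pow_le hθ φ)
  · intro x
    have := analyticSignal_re hθ φ x
    rw [show φ x = 2 * (analyticSignal θ φ x).re by linarith, abs_mul, abs_two]
    gcongr; exact Complex.abs_re_le_norm _
  · intro x
    have := Complex.abs_im_le_norm (analyticSignal θ φ x)
    linarith [norm_nonneg (analyticSignal θ φ x)]

end Directional

/-! ### The method of rotations -/

section Rotations

open ComplexConjugate

theorem inner_e_right (θ : E3) (j : Fin 3) : inner ℝ θ (e j) = θ j := by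
  simp [e, EuclideanSpace.inner_single_right]

theorem setIntegral_ball_comp (T : E3 ≃ₗᵢ[ℝ] E3) (f : E3 → ℝ) :
    ∫ θ in Metric.ball (0 : E3) 1, f (T θ) = ∫ θ in Metric.ball (0 : E3) 1, f θ := by
  have h := T.measurePreserving.setIntegral_preimage_emb
    T.toHomeomorph.measurableEmbedding f (Metric.ball 0 1)
  rwa [T.preimage_ball, map_zero] at h

/-- The integrand is odd for the reflection `η ↦ -η`, which fixes `ξ` and preserves the ball. -/
theorem setIntegral_ball_inner_mul_sign_of_orthogonal {ξ η : E3} (h : inner ℝ η ξ = 0) :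
    ∫ θ in Metric.ball (0 : E3) 1, inner ℝ θ η * (inner ℝ θ ξ / |inner ℝ θ ξ|) = 0 := by
  set T : E3 ≃ₗᵢ[ℝ] E3 := ((ℝ ∙ η)ᗮ).reflection with hT
  have h1 : T η = -η := Submodule.reflection_orthogonalComplement_singleton_eq_neg η
  have h2 : T ξ = ξ := Submodule.reflection_mem_subspace_eq_self
    (Submodule.mem_orthogonal_singleton_iff_inner_right.2 h)
  have h3 : ∀ θ v : E3, inner ℝ (T θ) v = inner ℝ θ (T v) := fun θ v => by
    rw [← T.inner_map_map θ (T v), hT, Submodule.reflection_reflection]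
  have key := setIntegral_ball_comp T
    (fun θ => inner ℝ θ η * (inner ℝ θ ξ / |inner ℝ θ ξ|))
  simp only [h3, h1, h2, inner_neg_right, neg_mul, integral_neg] at key
  linarith

/-- The mean over the unit ball of `|θ_0|`, up to the volume of the ball. -/
noncomputable def ballConst : ℝ := ∫ θ in Metric.ball (0 : E3) 1, |inner ℝ θ (e 0)|

theorem integrableOn_ball_of_continuous {f : E3 → ℝ} (hf : Continuous f) (r : ℝ) :
    IntegrableOn f (Metric.ball (0 : E3) r) :=
  (hf.continuousOn.integrableOn_compact (isCompact_closedBall 0 r)).mono_set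
    Metric.ball_subset_closedBall

theorem ballConst_pos : 0 < ballConst := by
  have hc : Continuous fun θ : E3 => |inner ℝ θ (e 0)| := by fun_prop
  refine (setIntegral_pos_iff_support_of_nonneg_ae (ae_of_all _ fun θ => abs_nonneg _)
    (integrableOn_ball_of_continuous hc 1)).2 ?_
  refine IsOpen.measure_pos volume ((hc.isOpen_support).inter Metric.isOpen_ball)
    ⟨(1 / 2 : ℝ) • e 0, ?_, ?_⟩
  · simp [e, inner_smul_left]
  · simp [e, norm_smul]; norm_num

/-- By rotation invariance, the direction of `ξ` can be taken to be that of `e 0`. -/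
theorem setIntegral_ball_abs_inner (ξ : E3) :
    ∫ θ in Metric.ball (0 : E3) 1, |inner ℝ θ ξ| = ‖ξ‖ * ballConst := by
  have hn : ‖ξ‖ = ‖‖ξ‖ • (e 0 : E3)‖ := by simp [e, norm_smul]
  set T : E3 ≃ₗᵢ[ℝ] E3 := ((ℝ ∙ (ξ - ‖ξ‖ • (e 0 : E3)))ᗮ).reflection with hT
  have h1 : T ξ = ‖ξ‖ • e 0 := Submodule.reflection_sub hn
  have key := setIntegral_ball_comp T (fun θ => |inner ℝ θ (T ξ)|)
  simp only [T.inner_map_map] at key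
  rw [key, h1, ballConst, ← integral_const_mul]
  simp only [inner_smul_right, abs_mul, abs_norm]

/-- The symbol of the Riesz transform is a mean of the symbols `sgn ⟪θ, ξ⟫` of the directional
Hilbert transforms. -/
theorem setIntegral_ball_coord_mul_sign (j : Fin 3) (ξ : E3) :
    ∫ θ in Metric.ball (0 : E3) 1, θ j * (inner ℝ θ ξ / |inner ℝ θ ξ|)
      = ballConst * (ξ j / ‖ξ‖) := by
  rcases eq_or_ne ξ 0 with rfl | hξ
  · simp
  have hξ' : ‖ξ‖ ≠ 0 := norm_ne_zero_iff.2 hξ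
  -- decompose `e j = η + a ξ` with `η` orthogonal to `ξ`
  set a : ℝ := ξ j / ‖ξ‖ ^ 2
  set η : E3 := e j - a • ξ
  have hη : inner ℝ η ξ = 0 := by
    rw [inner_sub_left, inner_smul_left, real_inner_comm, inner_e_right, real_inner_self_eq_norm_sq]
    simp only [a, conj_trivial]; field_simp; ring
  have hdec : ∀ θ : E3, θ j * (inner ℝ θ ξ / |inner ℝ θ ξ|)
      = inner ℝ θ η * (inner ℝ θ ξ / |inner ℝ θ ξ|) + a * |inner ℝ θ ξ| := by
    intro θ
    have : θ j = inner ℝ θ η + a * inner ℝ θ ξ := by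
      rw [inner_sub_right, inner_smul_right, inner_e_right]; ring
    rw [this, add_mul]
    congr 1
    rw [mul_assoc, mul_div_assoc', ← abs_mul_abs_self, mul_self_div_self]
  simp only [hdec]
  rw [integral_add, setIntegral_ball_inner_mul_sign_of_orthogonal hη, integral_const_mul,
    setIntegral_ball_abs_inner]
  · simp only [a]; field_simp; ring
  · have hc : Continuous fun θ : E3 => inner ℝ θ η := by fun_prop
    refine Integrable.mono (integrableOn_ball_of_continuous hc 1) ?_ (ae_of_all _ fun θ => ?_)
    · have : Measurable fun θ : E3 => inner ℝ θ η * (inner ℝ θ ξ / |inner ℝ θ ξ|) := by fun_prop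
      exact this.aestronglyMeasurable
    · rw [norm_mul, norm_div, Real.norm_eq_abs |_|, abs_abs]
      exact mul_le_of_le_one_right (norm_nonneg _) (div_self_le_one _)
  · have hc : Continuous fun θ : E3 => a * |inner ℝ θ ξ| := by fun_prop
    exact integrableOn_ball_of_continuous hc 1

/-- The directional Hilbert transform, with symbol `sgn ⟪θ, ξ⟫`, in terms of the analytic signal. -/
theorem fourierInv_sign_mul_hat {θ : E3} (hθ : θ ≠ 0) (φ : 𝓢(E3, ℝ)) (x : E3) :
    𝓕⁻ (fun ξ => ((inner ℝ θ ξ / |inner ℝ θ ξ| : ℝ) : ℂ) * hat φ ξ) x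
      = 2 * Complex.I * (analyticSignal θ φ x).im := by
  have hi := (halfSupported_halfHat θ φ).integrable
  have hi' : Integrable fun ξ => conj (-halfHat θ φ (-ξ)) :=
    (RCLike.conjCLE.integrable_comp_iff.2 hi.comp_neg.neg)
  have h : 𝓕⁻ (fun ξ => ((inner ℝ θ ξ / |inner ℝ θ ξ| : ℝ) : ℂ) * hat φ ξ) x
      = 𝓕⁻ (fun ξ => halfHat θ φ ξ + conj (-halfHat θ φ (-ξ))) x := by
    refine Real.fourierInv_congr_ae ?_ x
    filter_upwards [ae_inner_ne_zero hθ] with ξ hξ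
    rcases lt_or_gt_of_ne hξ with h | h
    · have h1 : halfHat θ φ ξ = 0 := indicator_of_notMem (by simpa using h.le) _
      rw [abs_of_neg h, div_neg, div_self hξ, hat_eq_halfHat_add φ hξ, h1]; simp
    · have h2 : halfHat θ φ (-ξ) = 0 := indicator_of_notMem (by simpa using h.le) _
      rw [abs_of_pos h, div_self hξ, hat_eq_halfHat_add φ hξ, h2]; simp
  have h3 : 𝓕⁻ (fun ξ => conj (-halfHat θ φ (-ξ))) x = - conj (analyticSignal θ φ x) := by
    rw [analyticSignal, conj_fourierInv, Real.fourierInv_eq', Real.fourierInv_eq', ← integral_neg]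
    simp
  rw [h, fourierInv_add_of_integrable hi hi', h3, ← sub_eq_add_neg]
  change analyticSignal θ φ x - _ = _
  rw [Complex.sub_conj]; push_cast; ring

/-- The Riesz transform is a mean of directional Hilbert transforms. -/
theorem ballConst_mul_rieszSchwartz (j : Fin 3) (φ : 𝓢(E3, ℝ)) (x : E3) :
    ballConst * rieszSchwartz j φ x
      = -2 * ∫ θ in Metric.ball (0 : E3) 1, θ j * (analyticSignal θ φ x).im := by
  set B := Metric.ball (0 : E3) 1
  have : IsFiniteMeasure (volume.restrict B) := ⟨by
    simpa using measure_ball_lt_top⟩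
  have hco : Continuous fun θ : E3 => θ j := (EuclideanSpace.proj (𝕜 := ℝ) j).continuous
  have hcast : ∀ ξ : E3, (ballConst : ℂ) * rieszFourier j φ ξ
      = ∫ θ in B, Complex.I * ((θ j * (inner ℝ θ ξ / |inner ℝ θ ξ|) : ℝ) : ℂ) * hat φ ξ := by
    intro ξ
    rw [integral_mul_const, integral_const_mul, integral_complex_ofReal,
      setIntegral_ball_coord_mul_sign, rieszFourier, rieszSymbol]
    push_cast; ring
  have hC : (ballConst * rieszSchwartz j φ x : ℂ)
      = ∫ θ in B, -2 * ((θ j * (analyticSignal θ φ x).im : ℝ) : ℂ) := by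
    calc (ballConst * rieszSchwartz j φ x : ℂ)
        = ∫ ξ, ∫ θ in B, Real.fourierChar (inner ℝ ξ x) •
            (Complex.I * ((θ j * (inner ℝ θ ξ / |inner ℝ θ ξ|) : ℝ) : ℂ) * hat φ ξ) := by
          rw [ofReal_rieszSchwartz, Real.fourierInv_eq, ← integral_const_mul]
          refine integral_congr_ae (ae_of_all _ fun ξ => ?_)
          simp only [Circle.smul_def, smul_eq_mul]
          rw [integral_const_mul, ← hcast]
          ring
      _ = ∫ θ in B, ∫ ξ, Real.fourierChar (inner ℝ ξ x) •
            (Complex.I * ((θ j * (inner ℝ θ ξ / |inner ℝ θ ξ|) : ℝ) : ℂ) * hat φ ξ) := by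
          refine integral_integral_swap ?_
          have hi : Integrable (fun z : E3 × E3 => ‖hat φ z.1‖ * 1)
              (volume.prod (volume.restrict B)) :=
            (hat φ).integrable.norm.mul_prod (integrable_const 1)
          refine hi.mono' ?_ ?_
          · have h1 : Measurable fun z : E3 × E3 => z.2 j * (inner ℝ z.2 z.1 / |inner ℝ z.2 z.1|) :=
              (hco.measurable.comp measurable_snd).mul (by fun_prop)
            have h2 : Continuous fun z : E3 × E3 => Real.fourierChar (inner ℝ z.1 x) :=
              Real.continuous_fourierChar.comp (by fun_prop)
            have h3 : Measurable fun z : E3 × E3 => hat φ z.1 :=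
              (hat φ).continuous.measurable.comp measurable_fst
            refine AEStronglyMeasurable.smul
              (f := fun z : E3 × E3 => Real.fourierChar (inner ℝ z.1 x))
              h2.aestronglyMeasurable ?_
            exact ((measurable_const.mul
              (Complex.measurable_ofReal.comp h1)).mul h3).aestronglyMeasurable
          · have hae : ∀ᵐ z ∂((volume : Measure E3).prod (volume.restrict B)), z.2 ∈ B := by
              have := (ae_restrict_mem (μ := volume) (Metric.isOpen_ball.measurableSet (s := B)))
              exact Measure.quasiMeasurePreserving_snd.ae this
            filter_upwards [hae] with z hz
            simp only [Function.uncurry, Circle.norm_smul, norm_mul, Complex.norm_I, one_mul,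
              Complex.norm_real, mul_one]
            refine mul_le_of_le_one_left (norm_nonneg _) (mul_le_one₀ ?_ (norm_nonneg _) ?_)
            · exact (PiLp.norm_apply_le z.2 j).trans (mem_ball_zero_iff.1 hz).le
            · rw [norm_div, Real.norm_eq_abs |_|, abs_abs]
              exact div_self_le_one _
      _ = ∫ θ in B, -2 * ((θ j * (analyticSignal θ φ x).im : ℝ) : ℂ) := by
          have hne : ∀ᵐ θ ∂(volume.restrict B), θ ≠ 0 :=
            ae_restrict_of_ae (Measure.ae_ne volume 0)
          refine integral_congr_ae ?_
          filter_upwards [hne] with θ hθ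
          have h := fourierInv_sign_mul_hat hθ φ x
          rw [Real.fourierInv_eq] at h
          calc _ = Complex.I * θ j * ∫ ξ, Real.fourierChar (inner ℝ ξ x) •
                (((inner ℝ θ ξ / |inner ℝ θ ξ| : ℝ) : ℂ) * hat φ ξ) := by
                rw [← integral_const_mul]
                refine integral_congr_ae (ae_of_all _ fun ξ => ?_)
                simp only [Circle.smul_def, smul_eq_mul]
                push_cast; ring
            _ = _ := by
                rw [h]; push_cast; linear_combination
                  (2 * (θ j : ℂ) * (analyticSignal θ φ x).im) * Complex.I_sq
  rw [integral_const_mul, integral_complex_ofReal] at hC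
  exact_mod_cast hC

end Rotations

/-! ### Bounds for the Riesz transforms without weights -/

section UnweightedBounds

/-- Jensen's inequality for the measure with density `k`. -/
theorem lintegral_mul_rpow_le {α : Type*} {m : MeasurableSpace α} {μ : Measure α} {p : ℝ}
    (hp : 1 < p) {k f : α → ℝ≥0∞} (hk : AEMeasurable k μ) (hf : AEMeasurable f μ) :
    (∫⁻ x, k x * f x ∂μ) ^ p ≤ (∫⁻ x, k x ∂μ) ^ (p - 1) * ∫⁻ x, k x * f x ^ p ∂μ := by
  have hp0 : 0 < p := by linarith
  have hpq := Real.HolderConjugate.conjExponent hp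
  set q := p.conjExponent
  have hq0 : 0 < q := hpq.symm.pos
  have hsum : 1 / q + 1 / p = 1 := by
    have := hpq.inv_add_inv_eq_one
    simp only [one_div]; linarith
  have h := ENNReal.lintegral_mul_le_Lp_mul_Lq μ hpq.symm (f := fun x => k x ^ (1 / q))
    (g := fun x => k x ^ (1 / p) * f x) (hk.pow_const _) ((hk.pow_const _).mul hf)
  have e1 : ∀ x, k x ^ (1 / q) * (k x ^ (1 / p) * f x) = k x * f x := fun x => by
    rw [← mul_assoc, ← ENNReal.rpow_add_of_nonneg _ _ (by positivity) (by positivity), hsum,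
      ENNReal.rpow_one]
  have e2 : ∀ x, (k x ^ (1 / q)) ^ q = k x := fun x => by
    rw [← ENNReal.rpow_mul, one_div_mul_cancel hq0.ne', ENNReal.rpow_one]
  have e3 : ∀ x, (k x ^ (1 / p) * f x) ^ p = k x * f x ^ p := fun x => by
    rw [ENNReal.mul_rpow_of_nonneg _ _ hp0.le, ← ENNReal.rpow_mul, one_div_mul_cancel hp0.ne',
      ENNReal.rpow_one]
  simp only [Pi.mul_apply, e1, e2, e3] at h
  calc (∫⁻ x, k x * f x ∂μ) ^ p
      ≤ ((∫⁻ x, k x ∂μ) ^ (1 / q) * (∫⁻ x, k x * f x ^ p ∂μ) ^ (1 / p)) ^ p := by gcongr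
    _ = (∫⁻ x, k x ∂μ) ^ (p - 1) * ∫⁻ x, k x * f x ^ p ∂μ := by
        rw [ENNReal.mul_rpow_of_nonneg _ _ hp0.le, ← ENNReal.rpow_mul, ← ENNReal.rpow_mul,
          one_div_mul_cancel hp0.ne', ENNReal.rpow_one]
        congr 2
        have : 1 / q = 1 - 1 / p := by linarith
        rw [this]; field_simp

theorem measurable_analyticSignal (φ : 𝓢(E3, ℝ)) :
    Measurable fun z : E3 × E3 => analyticSignal z.1 φ z.2 := by
  have h : ∀ z : E3 × E3, analyticSignal z.1 φ z.2 = ∫ ξ, ((Real.fourierChar (inner ℝ ξ z.2) : ℂ)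
      * {ξ : E3 | 0 < inner ℝ z.1 ξ}.indicator (hat φ) ξ) := fun z => by
    rw [analyticSignal, Real.fourierInv_eq]; rfl
  simp only [h]
  have hm : Measurable fun w : (E3 × E3) × E3 => ((Real.fourierChar (inner ℝ w.2 w.1.2) : ℂ)
      * {ξ : E3 | 0 < inner ℝ w.1.1 ξ}.indicator (hat φ) w.2) := by
    have h1 : Measurable fun w : (E3 × E3) × E3 => (Real.fourierChar (inner ℝ w.2 w.1.2) : ℂ) := by
      have : Continuous fun w : (E3 × E3) × E3 => Real.fourierChar (inner ℝ w.2 w.1.2) :=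
        Real.continuous_fourierChar.comp (by fun_prop)
      exact (continuous_subtype_val.comp this).measurable
    have h2 : Measurable fun w : (E3 × E3) × E3 =>
        {ξ : E3 | 0 < inner ℝ w.1.1 ξ}.indicator (hat φ) w.2 := by
      have hs : MeasurableSet {w : (E3 × E3) × E3 | 0 < inner ℝ w.1.1 w.2} :=
        measurableSet_lt measurable_const (by fun_prop)
      exact ((hat φ).continuous.measurable.comp measurable_snd).indicator hs
    exact h1.mul h2
  exact hm.stronglyMeasurable.integral_prod_right'.measurable

theorem eLpNorm_six_eq {α : Type*} {m : MeasurableSpace α} {μ : Measure α} (f : α → ℝ) :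
    eLpNorm f 6 μ = (∫⁻ x, ‖f x‖ₑ ^ 6 ∂μ) ^ (1 / 6 : ℝ) := by
  rw [eLpNorm_eq_lintegral_rpow_enorm_toReal (by norm_num) (by norm_num)]
  simp only [ENNReal.toReal_ofNat, ENNReal.rpow_ofNat]

/-- The Riesz transforms are bounded on `L⁶`. -/
theorem exists_eLpNorm_rieszSchwartz_six_le (j : Fin 3) : ∃ C : ℝ≥0∞, C ≠ ∞ ∧ ∀ φ : 𝓢(E3, ℝ),
    eLpNorm (rieszSchwartz j φ) 6 volume ≤ C * eLpNorm φ 6 volume := by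
  set B := Metric.ball (0 : E3) 1
  set K : ℝ≥0∞ := ENNReal.ofReal (2 / ballConst) ^ 6 * (volume B ^ 5 * (volume B * 63))
  have hB : volume B ≠ ∞ := measure_ball_lt_top.ne
  have hK : K ≠ ∞ := by
    refine ENNReal.mul_ne_top (by finiteness) (ENNReal.mul_ne_top (by finiteness) ?_)
    exact ENNReal.mul_ne_top hB (by norm_num)
  refine ⟨K ^ (1 / 6 : ℝ), ENNReal.rpow_ne_top_of_nonneg (by norm_num) hK, fun φ => ?_⟩
  rw [eLpNorm_six_eq, eLpNorm_six_eq, ← ENNReal.mul_rpow_of_nonneg _ _ (by norm_num)]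
  gcongr
  have hm := (Complex.measurable_im.comp (measurable_analyticSignal φ))
  have hpt : ∀ x, ‖rieszSchwartz j φ x‖ₑ ^ 6 ≤ ENNReal.ofReal (2 / ballConst) ^ 6 *
      (volume B ^ 5 * ∫⁻ θ in B, ‖(analyticSignal θ φ x).im‖ₑ ^ 6) := by
    intro x
    have h1 : rieszSchwartz j φ x
        = -(2 / ballConst) * ∫ θ in B, θ j * (analyticSignal θ φ x).im := by
      have := ballConst_mul_rieszSchwartz j φ x
      have := ballConst_pos.ne'
      field_simp; linarith
    have h2 : ‖rieszSchwartz j φ x‖ₑ ≤ ENNReal.ofReal (2 / ballConst) *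
        ∫⁻ θ in B, ‖(analyticSignal θ φ x).im‖ₑ := by
      rw [h1, enorm_mul, enorm_neg, Real.enorm_of_nonneg (div_nonneg zero_le_two ballConst_pos.le)]
      gcongr
      refine (enorm_integral_le_lintegral_enorm _).trans
        (setLIntegral_mono' Metric.isOpen_ball.measurableSet fun θ hθ => ?_)
      rw [enorm_mul]
      refine mul_le_of_le_one_left' ?_
      have : ‖θ j‖ ≤ 1 := (PiLp.norm_apply_le θ j).trans (mem_ball_zero_iff.1 hθ).le
      rw [← ofReal_norm]
      exact ENNReal.ofReal_le_one.2 this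
    have h3 := lintegral_mul_rpow_le (μ := volume.restrict B) (p := 6) (by norm_num)
      (k := fun _ => 1) (f := fun θ => ‖(analyticSignal θ φ x).im‖ₑ) aemeasurable_const
      ((hm.comp measurable_prodMk_right).enorm.aemeasurable)
    simp only [one_mul, lintegral_const, Measure.restrict_apply_univ,
      show (6 : ℝ) - 1 = (5 : ℕ) by norm_num, ENNReal.rpow_natCast, ENNReal.rpow_ofNat] at h3
    calc ‖rieszSchwartz j φ x‖ₑ ^ 6 ≤ (ENNReal.ofReal (2 / ballConst) *
        ∫⁻ θ in B, ‖(analyticSignal θ φ x).im‖ₑ) ^ 6 := by gcongr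
      _ ≤ _ := by rw [mul_pow]; gcongr
  calc ∫⁻ x, ‖rieszSchwartz j φ x‖ₑ ^ 6
      ≤ ∫⁻ x, ENNReal.ofReal (2 / ballConst) ^ 6 *
      (volume B ^ 5 * ∫⁻ θ in B, ‖(analyticSignal θ φ x).im‖ₑ ^ 6) := lintegral_mono hpt
    _ = ENNReal.ofReal (2 / ballConst) ^ 6 *
      (volume B ^ 5 * ∫⁻ θ in B, ∫⁻ x, ‖(analyticSignal θ φ x).im‖ₑ ^ 6) := by
        rw [lintegral_const_mul' _ _ (by finiteness), lintegral_const_mul' _ _ (by finiteness),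
          lintegral_lintegral_swap]
        exact ((hm.comp measurable_swap).enorm.pow_const 6).aemeasurable
    _ ≤ ENNReal.ofReal (2 / ballConst) ^ 6 *
      (volume B ^ 5 * ∫⁻ θ in B, 63 * ∫⁻ x, ‖φ x‖ₑ ^ 6) := by
        gcongr ENNReal.ofReal (2 / ballConst) ^ 6 * (volume B ^ 5 * ?_)
        refine lintegral_mono_ae ?_
        filter_upwards [ae_restrict_of_ae (Measure.ae_ne volume (0 : E3))] with θ hθ
        exact lintegral_enorm_analyticSignal_im_pow_le hθ φ
    _ = K * ∫⁻ x, ‖φ x‖ₑ ^ 6 := by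
        simp only [K, lintegral_const, Measure.restrict_apply_univ]; ring

theorem eLpNorm_six_fifths_eq {α : Type*} {m : MeasurableSpace α} {μ : Measure α} (f : α → ℝ) :
    eLpNorm f (6 / 5) μ = (∫⁻ x, ‖f x‖ₑ ^ (6 / 5 : ℝ) ∂μ) ^ (5 / 6 : ℝ) := by
  rw [eLpNorm_eq_lintegral_rpow_enorm_toReal (by simp) (by finiteness)]
  simp only [ENNReal.toReal_div, ENNReal.toReal_ofNat]
  norm_num

/-- A smooth cutoff function equal to `1` on the ball of radius `n + 1`. -/
noncomputable def cutoff (n : ℕ) : ContDiffBump (0 : E3) :=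
  ⟨n + 1, n + 2, by positivity, by linarith⟩

/-- The smooth, compactly supported function `χ_n r (1 / (n + 1) + r ²) ^ (-2 / 5)`, which for large
`n` is close to the extremal function `r |r| ^ (-4 / 5)` of the duality between `L^{6/5}`
and `L⁶`. -/
noncomputable def dualTest (r : E3 → ℝ) (n : ℕ) (x : E3) : ℝ :=
  r x * (1 / (n + 1) + r x ^ 2) ^ (-2 / 5 : ℝ) * cutoff n x

theorem dualTest_base_pos (r : E3 → ℝ) (n : ℕ) (x : E3) : 0 < (1 / (n + 1) + r x ^ 2 : ℝ) := by
  positivity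

theorem contDiff_dualTest {r : E3 → ℝ} (hr : ContDiff ℝ (⊤ : ℕ∞) r) (n : ℕ) :
    ContDiff ℝ (⊤ : ℕ∞) (dualTest r n) := by
  refine (hr.mul ?_).mul (cutoff n).contDiff
  exact (contDiff_const.add (hr.pow 2)).rpow_const_of_ne fun x => (dualTest_base_pos r n x).ne'

theorem hasCompactSupport_dualTest (r : E3 → ℝ) (n : ℕ) : HasCompactSupport (dualTest r n) :=
  (cutoff n).hasCompactSupport.mul_left

theorem mul_dualTest_nonneg (r : E3 → ℝ) (n : ℕ) (x : E3) : 0 ≤ r x * dualTest r n x := by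
  have h1 := Real.rpow_nonneg (dualTest_base_pos r n x).le (-2 / 5)
  have h2 := (cutoff n).nonneg (x := x)
  have : r x * dualTest r n x
      = r x ^ 2 * (1 / (n + 1) + r x ^ 2) ^ (-2 / 5 : ℝ) * cutoff n x := by rw [dualTest]; ring
  rw [this]; positivity

/-- The pointwise inequality behind `‖g‖_6 ^ 6 ≤ ∫ r g` for the test function `g = dualTest r n`. -/
theorem dualTest_pow_six_le (r : E3 → ℝ) (n : ℕ) (x : E3) :
    dualTest r n x ^ 6 ≤ r x * dualTest r n x := by
  set w : ℝ := 1 / (n + 1) + r x ^ 2 with hw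
  have hw0 : 0 < w := dualTest_base_pos r n x
  have h2 := (cutoff n).nonneg (x := x)
  have h3 := (cutoff n).le_one (x := x)
  set c := cutoff n x
  have h4 : (w ^ (-2 / 5 : ℝ)) ^ 6 = w ^ (-2 / 5 : ℝ) * (w ^ 2)⁻¹ := by
    rw [← Real.rpow_natCast, ← Real.rpow_mul hw0.le, ← Real.rpow_natCast w 2,
      ← Real.rpow_neg hw0.le, ← Real.rpow_add hw0]
    norm_num
  have h5 : (r x ^ 2) ^ 2 * (w ^ 2)⁻¹ ≤ 1 := by
    rw [← div_eq_mul_inv]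
    refine div_le_one_of_le₀ ?_ (by positivity)
    gcongr
    have : (0 : ℝ) ≤ 1 / (n + 1) := by positivity
    linarith
  have h6 : c ^ 6 ≤ c := by simpa using pow_le_pow_of_le_one h2 h3 (show 1 ≤ 6 by norm_num)
  have h7 := Real.rpow_nonneg hw0.le (-2 / 5)
  calc dualTest r n x ^ 6 = r x ^ 2 * w ^ (-2 / 5 : ℝ) * ((r x ^ 2) ^ 2 * (w ^ 2)⁻¹) * c ^ 6 := by
        rw [dualTest, mul_pow, mul_pow, h4]; ring
    _ ≤ r x ^ 2 * w ^ (-2 / 5 : ℝ) * 1 * c := by gcongr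
    _ = r x * dualTest r n x := by rw [dualTest]; ring

theorem tendsto_mul_dualTest (r : E3 → ℝ) (x : E3) :
    Tendsto (fun n => r x * dualTest r n x) atTop (𝓝 (|r x| ^ (6 / 5 : ℝ))) := by
  rcases eq_or_ne (r x) 0 with h0 | h0
  · simp [h0, dualTest]
  have h1 : Tendsto (fun n : ℕ => (1 / (n + 1) + r x ^ 2 : ℝ)) atTop (𝓝 (0 + r x ^ 2)) :=
    tendsto_one_div_add_atTop_nhds_zero_nat.add_const _
  have h2 : Tendsto (fun n : ℕ => (1 / (n + 1) + r x ^ 2 : ℝ) ^ (-2 / 5 : ℝ)) atTop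
      (𝓝 ((0 + r x ^ 2) ^ (-2 / 5 : ℝ))) := h1.rpow_const (Or.inl (by simpa using h0))
  have h3 : Tendsto (fun n : ℕ => cutoff n x) atTop (𝓝 1) := by
    refine tendsto_const_nhds.congr' ?_
    filter_upwards [eventually_ge_atTop ⌈‖x‖⌉₊] with n hn
    refine ((cutoff n).one_of_mem_closedBall ?_).symm
    rw [mem_closedBall_zero_iff]
    have : (‖x‖ : ℝ) ≤ n := (Nat.le_ceil _).trans (by exact_mod_cast hn)
    simp only [cutoff]; linarith
  have h4 := ((h2.const_mul (r x)).mul h3).const_mul (r x)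
  refine (h4.congr fun n => rfl).trans (le_of_eq ?_)
  congr 1
  rw [zero_add, mul_one, ← mul_assoc, ← abs_mul_abs_self, ← sq_abs, ← pow_two,
    ← Real.rpow_natCast, ← Real.rpow_mul (abs_nonneg _), ← Real.rpow_add (abs_pos.2 h0)]
  norm_num

/-- By skew-adjointness and duality, the Riesz transforms are bounded on `L^{6/5}`. -/
theorem exists_lintegral_rieszSchwartz_six_fifths_le (j : Fin 3) :
    ∃ C : ℝ≥0∞, C ≠ ∞ ∧ ∀ φ : 𝓢(E3, ℝ),
      ∫⁻ x, ‖rieszSchwartz j φ x‖ₑ ^ (6 / 5 : ℝ) ≤ C * ∫⁻ x, ‖φ x‖ₑ ^ (6 / 5 : ℝ) := by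
  obtain ⟨C, hC, hbound⟩ := exists_eLpNorm_rieszSchwartz_six_le j
  refine ⟨C ^ (6 / 5 : ℝ), ENNReal.rpow_ne_top_of_nonneg (by norm_num) hC, fun φ => ?_⟩
  set r := rieszSchwartz j φ with hr
  have hrs := contDiff_rieszSchwartz j φ
  have hcont : ∀ n, Continuous (dualTest r n) := fun n => (contDiff_dualTest hrs n).continuous
  have hA : ∀ n, ∫⁻ x, ENNReal.ofReal (r x * dualTest r n x)
      ≤ C ^ (6 / 5 : ℝ) * ∫⁻ x, ‖φ x‖ₑ ^ (6 / 5 : ℝ) := by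
    intro n
    set g : 𝓢(E3, ℝ) := (hasCompactSupport_dualTest r n).toSchwartzMap (contDiff_dualTest hrs n)
    have hg : ∀ x, g x = dualTest r n x := fun x => rfl
    set A := ∫⁻ x, ENNReal.ofReal (r x * dualTest r n x) with hAdef
    have hint : Integrable fun x => r x * dualTest r n x :=
      ((continuous_rieszSchwartz j φ).mul (hcont n)).integrable_of_hasCompactSupport
        (hasCompactSupport_dualTest r n).mul_left
    have hAtop : A ≠ ∞ := by
      have := hint.lintegral_lt_top
      exact this.ne
    have h1 : A = ENNReal.ofReal (∫ x, r x * g x) :=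
      (ofReal_integral_eq_lintegral_ofReal hint
        (ae_of_all _ fun x => mul_dualTest_nonneg r n x)).symm
    have h2 : A ≤ ∫⁻ x, ‖φ x‖ₑ * ‖rieszSchwartz j g x‖ₑ := by
      rw [h1, integral_rieszSchwartz_mul]
      calc ENNReal.ofReal (-∫ x, φ x * rieszSchwartz j g x)
          ≤ ‖-∫ x, φ x * rieszSchwartz j g x‖ₑ := by
            rw [Real.enorm_eq_ofReal_abs]
            exact ENNReal.ofReal_le_ofReal (le_abs_self _)
        _ = ‖∫ x, φ x * rieszSchwartz j g x‖ₑ := enorm_neg _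
        _ ≤ ∫⁻ x, ‖φ x * rieszSchwartz j g x‖ₑ := enorm_integral_le_lintegral_enorm _
        _ = _ := by simp only [enorm_mul]
    have h3 := ENNReal.lintegral_mul_le_Lp_mul_Lq volume (p := 6 / 5) (q := 6)
      ⟨by norm_num, by norm_num, by norm_num⟩ (f := fun x => ‖φ x‖ₑ)
      (g := fun x => ‖rieszSchwartz j g x‖ₑ) φ.continuous.enorm.aemeasurable
      (continuous_rieszSchwartz j g).enorm.aemeasurable
    have h4 : (∫⁻ x, ‖rieszSchwartz j g x‖ₑ ^ (6 : ℝ)) ^ (1 / 6 : ℝ) ≤ C * A ^ (1 / 6 : ℝ) := by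
      have := hbound g
      rw [eLpNorm_six_eq, eLpNorm_six_eq] at this
      simp only [ENNReal.rpow_ofNat]
      refine this.trans ?_
      gcongr
      refine lintegral_mono fun x => ?_
      simp only [hg]
      rw [Real.enorm_eq_ofReal_abs, ← ENNReal.ofReal_pow (abs_nonneg _),
        Even.pow_abs (by decide)]
      exact ENNReal.ofReal_le_ofReal (dualTest_pow_six_le r n x)
    set Φ := ∫⁻ x, ‖φ x‖ₑ ^ (6 / 5 : ℝ)
    -- `A` appears on both sides, with a smaller exponent on the right, and it is finite
    have h5 : A ≤ Φ ^ (1 / (6 / 5) : ℝ) * (C * A ^ (1 / 6 : ℝ)) :=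
      (h2.trans h3).trans (by gcongr)
    rcases eq_or_ne A 0 with hA0 | hA0
    · rw [hA0]; exact zero_le
    have h6 : A ^ (5 / 6 : ℝ) ≤ C * Φ ^ (5 / 6 : ℝ) := by
      have hpos : A ^ (1 / 6 : ℝ) ≠ 0 := by simp [hA0, hAtop]
      have htop : A ^ (1 / 6 : ℝ) ≠ ∞ := ENNReal.rpow_ne_top_of_nonneg (by norm_num) hAtop
      refine (ENNReal.mul_le_mul_iff_left hpos htop).1 ?_
      rw [← ENNReal.rpow_add _ _ hA0 hAtop]
      norm_num at h5 ⊢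
      calc A ≤ _ := h5
        _ = _ := by ring
    calc A = (A ^ (5 / 6 : ℝ)) ^ (6 / 5 : ℝ) := by rw [← ENNReal.rpow_mul]; norm_num
      _ ≤ (C * Φ ^ (5 / 6 : ℝ)) ^ (6 / 5 : ℝ) := by gcongr
      _ = C ^ (6 / 5 : ℝ) * Φ := by
        rw [ENNReal.mul_rpow_of_nonneg _ _ (by norm_num), ← ENNReal.rpow_mul]; norm_num
  calc ∫⁻ x, ‖r x‖ₑ ^ (6 / 5 : ℝ)
      = ∫⁻ x, liminf (fun n => ENNReal.ofReal (r x * dualTest r n x)) atTop := by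
        refine lintegral_congr fun x => ?_
        rw [Real.enorm_eq_ofReal_abs, ENNReal.ofReal_rpow_of_nonneg (abs_nonneg _) (by norm_num)]
        exact ((ENNReal.continuous_ofReal.tendsto _).comp
          (tendsto_mul_dualTest r x)).liminf_eq.symm
    _ ≤ liminf (fun n => ∫⁻ x, ENNReal.ofReal (r x * dualTest r n x)) atTop :=
        lintegral_liminf_le fun n =>
          (((continuous_rieszSchwartz j φ).mul (hcont n)).measurable.ennreal_ofReal)
    _ ≤ _ := liminf_le_of_le (by isBoundedDefault) fun b hb => by
        obtain ⟨n, hn⟩ := hb.exists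
        exact hn.trans (hA n)

theorem lintegral_rieszSchwartz_two_le (j : Fin 3) (φ : 𝓢(E3, ℝ)) :
    ∫⁻ x, ‖rieszSchwartz j φ x‖ₑ ^ (2 : ℝ) ≤ ∫⁻ x, ‖φ x‖ₑ ^ (2 : ℝ) := by
  have := eLpNorm_rieszSchwartz_two_le j φ
  rw [eLpNorm_eq_lintegral_rpow_enorm_toReal (by norm_num) (by norm_num),
    eLpNorm_eq_lintegral_rpow_enorm_toReal (by norm_num) (by norm_num)] at this
  simpa [ENNReal.rpow_le_rpow_iff] using this

end UnweightedBounds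

/-! ### Riesz transforms and the heat kernel -/

section HeatRepresentation

/-- The heat kernel `s ^ (-3 / 2) exp (-π |z| ² / s)`, whose Fourier transform is
`exp (-π s |ξ| ²)`. -/
noncomputable def heat (s : ℝ) (z : E3) : ℝ := s ^ (-3 / 2 : ℝ) * Real.exp (-Real.pi * ‖z‖ ^ 2 / s)

/-- The derivative `(2 π)⁻¹ ∂_j` of the heat kernel. -/
noncomputable def heatDeriv (j : Fin 3) (s : ℝ) (z : E3) : ℝ := -(z j / s) * heat s z

theorem integral_fourier_mul {V : Type*} [NormedAddCommGroup V] [InnerProductSpace ℝ V]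
    [FiniteDimensional ℝ V] [MeasurableSpace V] [BorelSpace V] {f g : V → ℂ}
    (hf : Integrable f) (hg : Integrable g) : ∫ x, 𝓕 f x * g x = ∫ x, f x * 𝓕 g x := by
  have h := integral_fourierInv_mul hf.comp_neg hg
  simp only [Real.fourierInv_eq_fourier_comp_neg, neg_neg] at h
  rw [h, ← integral_neg_eq_self]
  refine integral_congr_ae (ae_of_all _ fun x => ?_)
  simp only [neg_neg]
  rw [← Real.fourierInv_eq_fourier_comp_neg, Real.fourierInv_eq_fourier_neg, neg_neg]

theorem heat_nonneg {s : ℝ} (hs : 0 < s) (z : E3) : 0 ≤ heat s z := by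
  unfold heat; positivity

theorem heat_le {s : ℝ} (hs : 0 < s) (z : E3) : heat s z ≤ s ^ (-3 / 2 : ℝ) := by
  refine mul_le_of_le_one_right (by positivity) (Real.exp_le_one_iff.2 ?_)
  rw [neg_mul, neg_div, neg_nonpos]
  positivity

/-- The heat semigroup as a Fourier multiplier. -/
theorem integral_gaussian_mul_fourier {s : ℝ} (hs : 0 < s) (f : 𝓢(E3, ℂ)) (x : E3) :
    ∫ ξ, Complex.exp (-(Real.pi * s : ℝ) * ‖ξ‖ ^ 2 + 2 * Real.pi * Complex.I * inner ℝ x ξ)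
      * 𝓕 f ξ = ∫ y, (heat s (x - y) : ℂ) * f y := by
  have hps : 0 < Real.pi * s := mul_pos Real.pi_pos hs
  have hre : 0 < ((Real.pi * s : ℝ) : ℂ).re := by rwa [Complex.ofReal_re]
  rw [SchwartzMap.fourier_coe, ← integral_fourier_mul _ f.integrable]
  · refine integral_congr_ae (ae_of_all _ fun y => ?_)
    simp only
    rw [fourier_gaussian_innerProductSpace' hre]
    congr 1
    have hpi : (Real.pi : ℂ) ≠ 0 := by exact_mod_cast Real.pi_ne_zero
    have hs' : (s : ℂ) ≠ 0 := by exact_mod_cast hs.ne'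
    have e1 : (heat s (x - y) : ℂ)
        = (s : ℂ) ^ (-(3 / 2) : ℂ) * Complex.exp (-Real.pi * ‖x - y‖ ^ 2 / s) := by
      rw [heat, Complex.ofReal_mul, Complex.ofReal_cpow hs.le]
      push_cast
      congr 2; ring
    rw [e1, Complex.ofReal_mul, ← div_div, div_self hpi, one_div, Complex.inv_cpow,
      ← Complex.cpow_neg]
    · congr 2
      · simp
      · field_simp
    · rw [Complex.arg_ofReal_of_nonneg hs.le]; exact Real.pi_ne_zero.symm
  · exact GaussianFourier.integrable_cexp_neg_mul_sq_norm_add hre _ x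

theorem hasFDerivAt_heat {s : ℝ} (x y : E3) :
    HasFDerivAt (fun y => heat s (x - y))
      ((heat s (x - y) * (2 * Real.pi / s)) • innerSL ℝ (x - y)) y := by
  have h1 : HasFDerivAt (fun y : E3 => x - y) (-ContinuousLinearMap.id ℝ E3) y :=
    (hasFDerivAt_id y).const_sub x
  have h2 := (h1.norm_sq).const_mul (-Real.pi / s)
  have h3 := (h2.exp).const_mul (s ^ (-3 / 2 : ℝ))
  have e1 : (fun y => heat s (x - y))
      = fun y => s ^ (-3 / 2 : ℝ) * Real.exp (-Real.pi / s * ‖x - y‖ ^ 2) := by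
    funext y; rw [heat]; congr 2; ring
  rw [e1]
  refine h3.congr_fderiv ?_
  ext v
  simp only [heat]
  simp
  ring_nf

theorem continuous_heat {s : ℝ} (x : E3) : Continuous fun y => heat s (x - y) :=
  continuous_iff_continuousAt.2 fun y => (hasFDerivAt_heat x y).continuousAt

theorem continuous_heatDeriv {s : ℝ} (j : Fin 3) (x : E3) :
    Continuous fun y => heatDeriv j s (x - y) := by
  have h0 : Continuous fun y : E3 => (x - y) j :=
    (EuclideanSpace.proj (𝕜 := ℝ) j).continuous.comp (continuous_const.sub continuous_id)
  exact ((h0.div_const s).neg).mul (continuous_heat x)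

theorem integrable_heatDeriv_mul {s : ℝ} (hs : 0 < s) (j : Fin 3) (f : 𝓢(E3, ℂ)) (x : E3) :
    Integrable fun y => (heatDeriv j s (x - y) : ℂ) * f y := by
  have h1 : Integrable fun y => ‖x‖ * ‖f y‖ + ‖y‖ ^ 1 * ‖f y‖ :=
    (f.integrable.norm.const_mul _).add (f.integrable_pow_mul volume 1)
  refine (h1.const_mul (s ^ (-3 / 2 : ℝ) / s)).mono'
    ((Complex.continuous_ofReal.comp (continuous_heatDeriv j x)).mul
      f.continuous).aestronglyMeasurable (ae_of_all _ fun y => ?_)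
  have h2 : ‖(x - y) j‖ ≤ ‖x‖ + ‖y‖ := (PiLp.norm_apply_le (x - y) j).trans (norm_sub_le _ _)
  have h3 : ‖heat s (x - y)‖ ≤ s ^ (-3 / 2 : ℝ) := by
    rw [Real.norm_of_nonneg (heat_nonneg hs _)]; exact heat_le hs _
  rw [norm_mul, heatDeriv, Complex.norm_real, norm_mul, norm_neg, norm_div,
    Real.norm_of_nonneg hs.le]
  calc ‖(x - y) j‖ / s * ‖heat s (x - y)‖ * ‖f y‖
      ≤ (‖x‖ + ‖y‖) / s * s ^ (-3 / 2 : ℝ) * ‖f y‖ := by gcongr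
    _ = _ := by ring

theorem integral_heat_mul_lineDeriv {s : ℝ} (hs : 0 < s) (j : Fin 3) (f : 𝓢(E3, ℂ)) (x : E3) :
    ∫ y, (heat s (x - y) : ℂ) * ∂_{e j} f y
      = 2 * Real.pi * ∫ y, (heatDeriv j s (x - y) : ℂ) * f y := by
  have hd : ∀ y, HasFDerivAt (fun y => (heat s (x - y) : ℂ))
      (Complex.ofRealCLM.comp ((heat s (x - y) * (2 * Real.pi / s)) • innerSL ℝ (x - y))) y :=
    fun y => Complex.ofRealCLM.hasFDerivAt.comp y (hasFDerivAt_heat x y)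
  have hder : ∀ y, fderiv ℝ (fun y => (heat s (x - y) : ℂ)) y (e j)
      = -(2 * Real.pi) * (heatDeriv j s (x - y) : ℂ) := by
    intro y
    rw [(hd y).fderiv]
    simp only [ContinuousLinearMap.comp_apply, _root_.smul_apply, innerSL_apply_apply,
      inner_e_right, smul_eq_mul, Complex.ofRealCLM_apply, heatDeriv]
    push_cast; ring
  have hcC : Continuous fun y => (heat s (x - y) : ℂ) :=
    Complex.continuous_ofReal.comp (continuous_heat x)
  have hbd : ∀ y, ‖(heat s (x - y) : ℂ)‖ ≤ s ^ (-3 / 2 : ℝ) := fun y => by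
    rw [Complex.norm_real, Real.norm_of_nonneg (heat_nonneg hs _)]
    exact heat_le hs _
  have key := integral_mul_fderiv_eq_neg_fderiv_mul_of_integrable (μ := (volume : Measure E3))
    (f := fun y => (heat s (x - y) : ℂ)) (g := f) (v := e j) ?_ ?_ ?_
    (fun y _ => (hd y).differentiableAt) (fun y _ => f.differentiableAt)
  · simp only [SchwartzMap.lineDerivOp_apply_eq_fderiv]
    rw [key, ← integral_neg, ← integral_const_mul]
    refine integral_congr_ae (ae_of_all _ fun y => ?_)
    simp only [hder]; ring
  · refine ((integrable_heatDeriv_mul hs j f x).const_mul (-(2 * Real.pi : ℂ))).congr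
      (ae_of_all _ fun y => ?_)
    change _ = fderiv ℝ (fun y => (heat s (x - y) : ℂ)) y (e j) * f y
    rw [hder, mul_assoc]
  · have h1 : Integrable fun y => (∂_{e j} f) y := (∂_{e j} f).integrable
    simp only [SchwartzMap.lineDerivOp_apply_eq_fderiv] at h1
    exact h1.bdd_mul hcC.aestronglyMeasurable (ae_of_all _ hbd)
  · exact f.integrable.bdd_mul hcC.aestronglyMeasurable (ae_of_all _ hbd)

theorem integral_gaussian_mul_hat {s : ℝ} (hs : 0 < s) (j : Fin 3) (φ : 𝓢(E3, ℝ)) (x : E3) :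
    ∫ ξ, Real.fourierChar (inner ℝ ξ x) •
        (Complex.I * ((ξ j * Real.exp (-(Real.pi * ‖ξ‖ ^ 2 * s)) : ℝ) : ℂ) * hat φ ξ)
      = ((∫ y, heatDeriv j s (x - y) * φ y : ℝ) : ℂ) := by
  have h1 := integral_gaussian_mul_fourier hs (∂_{e j} (complexify φ)) x
  rw [integral_heat_mul_lineDeriv hs, SchwartzMap.fourier_lineDerivOp_eq] at h1
  have h2 : ∫ y, (heatDeriv j s (x - y) : ℂ) * complexify φ y
      = ((∫ y, heatDeriv j s (x - y) * φ y : ℝ) : ℂ) := by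
    rw [← integral_complex_ofReal]; simp
  have hpi : (2 * Real.pi : ℂ) ≠ 0 := by
    simp [Real.pi_ne_zero]
  rw [h2] at h1
  refine mul_left_cancel₀ hpi (Eq.trans ?_ h1)
  rw [← integral_const_mul]
  refine integral_congr_ae (ae_of_all _ fun ξ => ?_)
  simp only [_root_.smul_apply]
  rw [SchwartzMap.smulLeftCLM_apply_apply (by fun_prop), inner_e_right, Circle.smul_def,
    Real.fourierChar_apply, hat, Complex.exp_add, real_inner_comm x ξ]
  simp only [smul_eq_mul, Complex.real_smul, Complex.ofReal_mul, Complex.ofReal_exp]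
  have e1 : Complex.exp (((-(Real.pi * ‖ξ‖ ^ 2 * s) : ℝ)) : ℂ)
      = Complex.exp (-(Real.pi * s : ℝ) * ‖ξ‖ ^ 2) := by congr 1; push_cast; ring
  have e2 : Complex.exp (2 * Real.pi * inner ℝ x ξ * Complex.I)
      = Complex.exp (2 * Real.pi * Complex.I * inner ℝ x ξ) := by congr 1; ring
  rw [e1]
  push_cast
  rw [e2]
  ring

theorem integral_rpow_mul_gaussian {ξ : E3} (hξ : ξ ≠ 0) :
    ∫ s in Ioi (0 : ℝ), s ^ (-1 / 2 : ℝ) * Real.exp (-(Real.pi * ‖ξ‖ ^ 2 * s)) = 1 / ‖ξ‖ := by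
  have hn : 0 < ‖ξ‖ := norm_pos_iff.2 hξ
  have h := Real.integral_rpow_mul_exp_neg_mul_Ioi (a := 1 / 2) (r := Real.pi * ‖ξ‖ ^ 2)
    (by norm_num) (by positivity)
  rw [show (1 / 2 - 1 : ℝ) = -1 / 2 by norm_num] at h
  rw [h, Real.Gamma_one_half_eq, ← Real.sqrt_eq_rpow, ← Real.sqrt_mul (by positivity)]
  rw [show 1 / (Real.pi * ‖ξ‖ ^ 2) * Real.pi = (1 / ‖ξ‖) ^ 2 by
    have := Real.pi_ne_zero; field_simp]
  exact Real.sqrt_sq (by positivity)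

theorem integrableOn_rpow_mul_gaussian {ξ : E3} (hξ : ξ ≠ 0) :
    IntegrableOn (fun s => s ^ (-1 / 2 : ℝ) * Real.exp (-(Real.pi * ‖ξ‖ ^ 2 * s))) (Ioi 0) := by
  refine MeasureTheory.Integrable.of_integral_ne_zero ?_
  rw [integral_rpow_mul_gaussian hξ]
  exact one_div_ne_zero (norm_ne_zero_iff.2 hξ)

/-- The Riesz transform as an integral of derivatives of the heat semigroup, obtained from
`1 / |ξ| = ∫₀^∞ s ^ (-1 / 2) exp (-π s |ξ| ²) ds`. -/
theorem rieszSchwartz_eq_integral_heat (j : Fin 3) (φ : 𝓢(E3, ℝ)) (x : E3) :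
    IntegrableOn (fun s => s ^ (-1 / 2 : ℝ) * ∫ y, heatDeriv j s (x - y) * φ y) (Ioi 0) ∧
    rieszSchwartz j φ x
      = ∫ s in Ioi (0 : ℝ), s ^ (-1 / 2 : ℝ) * ∫ y, heatDeriv j s (x - y) * φ y := by
  have hco : Continuous fun θ : E3 => θ j := (EuclideanSpace.proj (𝕜 := ℝ) j).continuous
  set G : ℝ → E3 → ℂ := fun s ξ => Real.fourierChar (inner ℝ ξ x) •
    (Complex.I * ((ξ j * (s ^ (-1 / 2 : ℝ) * Real.exp (-(Real.pi * ‖ξ‖ ^ 2 * s))) : ℝ) : ℂ)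
      * hat φ ξ) with hG
  have hGm : AEStronglyMeasurable (Function.uncurry G) ((volume.restrict (Ioi 0)).prod volume) := by
    have h2 : Continuous fun z : ℝ × E3 => Real.fourierChar (inner ℝ z.2 x) :=
      Real.continuous_fourierChar.comp (by fun_prop)
    refine AEStronglyMeasurable.smul (f := fun z : ℝ × E3 => Real.fourierChar (inner ℝ z.2 x))
      h2.aestronglyMeasurable ?_
    have h3 : Measurable fun z : ℝ × E3 => hat φ z.2 :=
      (hat φ).continuous.measurable.comp measurable_snd
    have h4 : Measurable fun z : ℝ × E3 => z.2 j *
        (z.1 ^ (-1 / 2 : ℝ) * Real.exp (-(Real.pi * ‖z.2‖ ^ 2 * z.1))) :=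
      (hco.measurable.comp measurable_snd).mul (by fun_prop)
    exact ((measurable_const.mul (Complex.measurable_ofReal.comp h4)).mul h3).aestronglyMeasurable
  have hnorm : ∀ s ∈ Ioi (0 : ℝ), ∀ ξ, ‖G s ξ‖ = ‖ξ j‖ * ‖hat φ ξ‖ *
      (s ^ (-1 / 2 : ℝ) * Real.exp (-(Real.pi * ‖ξ‖ ^ 2 * s))) := by
    intro s (hs : 0 < s) ξ
    have : 0 ≤ s ^ (-1 / 2 : ℝ) * Real.exp (-(Real.pi * ‖ξ‖ ^ 2 * s)) := by positivity
    rw [hG]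
    simp only [Circle.norm_smul, norm_mul, Complex.norm_I, one_mul, Complex.norm_real]
    rw [← norm_mul (s ^ (-1 / 2 : ℝ)), Real.norm_of_nonneg this]
    ring
  have hGi : Integrable (Function.uncurry G) ((volume.restrict (Ioi 0)).prod volume) := by
    refine (integrable_prod_iff' hGm).2 ⟨?_, ?_⟩
    · filter_upwards [Measure.ae_ne volume (0 : E3)] with ξ hξ
      have h1 : IntegrableOn (fun s => ((s ^ (-1 / 2 : ℝ) *
          Real.exp (-(Real.pi * ‖ξ‖ ^ 2 * s)) : ℝ) : ℂ)) (Ioi 0) :=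
        (integrableOn_rpow_mul_gaussian hξ).ofReal
      have h2 := h1.const_mul (Real.fourierChar (inner ℝ ξ x) * (Complex.I * ξ j * hat φ ξ))
      refine h2.congr (ae_of_all _ fun s => ?_)
      simp only [hG, Function.uncurry, Circle.smul_def, smul_eq_mul]
      push_cast; ring
    · have h1 : Integrable fun ξ => ‖hat φ ξ‖ := (hat φ).integrable.norm
      refine h1.mono' hGm.norm.prod_swap.integral_prod_right' ?_
      filter_upwards [Measure.ae_ne volume (0 : E3)] with ξ hξ
      have h2 : ∫ s in Ioi (0 : ℝ), ‖Function.uncurry G (s, ξ)‖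
          = ‖ξ j‖ * ‖hat φ ξ‖ * (1 / ‖ξ‖) := by
        rw [← integral_rpow_mul_gaussian hξ, ← integral_const_mul]
        exact setIntegral_congr_fun measurableSet_Ioi fun s hs => hnorm s hs ξ
      rw [h2, Real.norm_of_nonneg (by positivity)]
      have : ‖ξ j‖ * (1 / ‖ξ‖) ≤ 1 := by
        rw [mul_one_div]
        exact div_le_one_of_le₀ (PiLp.norm_apply_le ξ j) (norm_nonneg _)
      calc ‖ξ j‖ * ‖hat φ ξ‖ * (1 / ‖ξ‖) = ‖hat φ ξ‖ * (‖ξ j‖ * (1 / ‖ξ‖)) := by ring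
        _ ≤ ‖hat φ ξ‖ := mul_le_of_le_one_right (norm_nonneg _) this
  have hinner : ∀ s ∈ Ioi (0 : ℝ), ∫ ξ, G s ξ
      = ((s ^ (-1 / 2 : ℝ) * ∫ y, heatDeriv j s (x - y) * φ y : ℝ) : ℂ) := by
    intro s (hs : 0 < s)
    rw [Complex.ofReal_mul, ← integral_gaussian_mul_hat hs, ← integral_const_mul]
    refine integral_congr_ae (ae_of_all _ fun ξ => ?_)
    simp only [hG, Circle.smul_def, smul_eq_mul]
    push_cast; ring
  have hIntC := hGi.integral_prod_left
  have hIntC' : IntegrableOn (fun s => ((s ^ (-1 / 2 : ℝ) *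
      ∫ y, heatDeriv j s (x - y) * φ y : ℝ) : ℂ)) (Ioi 0) :=
    (integrableOn_congr_fun hinner measurableSet_Ioi).1 hIntC
  refine ⟨by simpa using! hIntC'.re, ?_⟩
  have hC : (rieszSchwartz j φ x : ℂ) = ((∫ s in Ioi (0 : ℝ), s ^ (-1 / 2 : ℝ) *
      ∫ y, heatDeriv j s (x - y) * φ y : ℝ) : ℂ) := by
    rw [← integral_complex_ofReal, ← setIntegral_congr_fun measurableSet_Ioi hinner,
      integral_integral_swap hGi, ofReal_rieszSchwartz, Real.fourierInv_eq]
    refine integral_congr_ae ?_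
    filter_upwards [Measure.ae_ne volume (0 : E3)] with ξ hξ
    have h1 : ∫ s in Ioi (0 : ℝ), G s ξ = ∫ s in Ioi (0 : ℝ),
        (Real.fourierChar (inner ℝ ξ x) * (Complex.I * ξ j * hat φ ξ)) *
        ((s ^ (-1 / 2 : ℝ) * Real.exp (-(Real.pi * ‖ξ‖ ^ 2 * s)) : ℝ) : ℂ) := by
      refine integral_congr_ae (ae_of_all _ fun s => ?_)
      simp only [hG, Circle.smul_def, smul_eq_mul]
      push_cast; ring
    rw [h1, integral_const_mul, integral_complex_ofReal, integral_rpow_mul_gaussian hξ,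
      rieszFourier, rieszSymbol, Circle.smul_def, smul_eq_mul]
    push_cast; ring
  exact_mod_cast hC

end HeatRepresentation

/-! ### Commutators of Riesz transforms with functions -/

section Commutator

/-- The integral is cut at `s = c`, with `exp (-c / s) ≤ 6 (s / c) ^ 3` below and `exp (-c / s) ≤ 1`
above. -/
theorem lintegral_rpow_mul_exp_le {c : ℝ} (hc : 0 < c) :
    ∫⁻ s in Ioi (0 : ℝ), ENNReal.ofReal (s ^ (-3 : ℝ) * Real.exp (-c / s))
      ≤ ENNReal.ofReal (7 / c ^ 2) := by
  have h1 : ∫⁻ s in Ioc 0 c, ENNReal.ofReal (s ^ (-3 : ℝ) * Real.exp (-c / s))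
      ≤ ENNReal.ofReal (6 / c ^ 2) := by
    calc ∫⁻ s in Ioc 0 c, ENNReal.ofReal (s ^ (-3 : ℝ) * Real.exp (-c / s))
        ≤ ∫⁻ _ in Ioc 0 c, ENNReal.ofReal (6 / c ^ 3) := by
          refine setLIntegral_mono' measurableSet_Ioc fun s hs => ENNReal.ofReal_le_ofReal ?_
          have hs0 : 0 < s := hs.1
          have h := Real.pow_div_factorial_le_exp (c / s) (by positivity) 3
          rw [neg_div, Real.exp_neg, Real.rpow_neg hs0.le, ← mul_inv]
          have e : ((3 : ℕ).factorial : ℝ) = 6 := by norm_num [Nat.factorial]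
          rw [e] at h
          rw [show (6 : ℝ) / c ^ 3 = (c ^ 3 / 6)⁻¹ by rw [inv_div]]
          refine inv_anti₀ (by positivity) ?_
          have e2 : s ^ (3 : ℝ) = s ^ 3 := by norm_cast
          rw [e2]
          calc c ^ 3 / 6 = s ^ 3 * ((c / s) ^ 3 / 6) := by field_simp
            _ ≤ s ^ 3 * Real.exp (c / s) := by gcongr
      _ = ENNReal.ofReal (6 / c ^ 2) := by
          rw [lintegral_const, Measure.restrict_apply_univ, Real.volume_Ioc, sub_zero,
            ← ENNReal.ofReal_mul (by positivity)]
          congr 1; field_simp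
  have h2 : ∫⁻ s in Ioi c, ENNReal.ofReal (s ^ (-3 : ℝ) * Real.exp (-c / s))
      ≤ ENNReal.ofReal (1 / c ^ 2) := by
    calc ∫⁻ s in Ioi c, ENNReal.ofReal (s ^ (-3 : ℝ) * Real.exp (-c / s))
        ≤ ∫⁻ s in Ioi c, ENNReal.ofReal (s ^ (-3 : ℝ)) := by
          refine setLIntegral_mono' measurableSet_Ioi fun s hs => ENNReal.ofReal_le_ofReal ?_
          have hs0 : 0 < s := hc.trans hs
          refine mul_le_of_le_one_right (by positivity) (Real.exp_le_one_iff.2 ?_)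
          rw [neg_div, neg_nonpos]; positivity
      _ = ENNReal.ofReal (∫ s in Ioi c, s ^ (-3 : ℝ)) := by
          refine (ofReal_integral_eq_lintegral_ofReal
            (integrableOn_Ioi_rpow_of_lt (by norm_num) hc) ?_).symm
          filter_upwards [ae_restrict_mem measurableSet_Ioi] with s hs
          have hs0 : 0 < s := hc.trans hs
          positivity
      _ ≤ ENNReal.ofReal (1 / c ^ 2) := by
          refine ENNReal.ofReal_le_ofReal ?_
          rw [integral_Ioi_rpow_of_lt (by norm_num) hc]
          have : c ^ (-3 + 1 : ℝ) = 1 / c ^ 2 := by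
            rw [show (-3 + 1 : ℝ) = -(2 : ℕ) by norm_num, Real.rpow_neg hc.le, Real.rpow_natCast,
              one_div]
          rw [this]
          have : 0 < 1 / c ^ 2 := by positivity
          norm_num; norm_num at this; linarith
  rw [← Ioc_union_Ioi_eq_Ioi hc.le]
  refine (lintegral_union_le _ _ _).trans ((add_le_add h1 h2).trans (le_of_eq ?_))
  rw [← ENNReal.ofReal_add (by positivity) (by positivity)]
  congr 1; ring

/-- The size of the kernel of the Riesz transform. -/
theorem lintegral_heatDeriv_le (j : Fin 3) {z : E3} (hz : z ≠ 0) :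
    ∫⁻ s in Ioi (0 : ℝ), ‖s ^ (-1 / 2 : ℝ) * heatDeriv j s z‖ₑ
      ≤ ENNReal.ofReal (7 / ‖z‖ ^ 3) := by
  have hn : 0 < ‖z‖ := norm_pos_iff.2 hz
  have hc : 0 < Real.pi * ‖z‖ ^ 2 := by positivity
  calc ∫⁻ s in Ioi (0 : ℝ), ‖s ^ (-1 / 2 : ℝ) * heatDeriv j s z‖ₑ
      ≤ ∫⁻ s in Ioi (0 : ℝ), ENNReal.ofReal ‖z‖ *
          ENNReal.ofReal (s ^ (-3 : ℝ) * Real.exp (-(Real.pi * ‖z‖ ^ 2) / s)) := by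
        refine setLIntegral_mono' measurableSet_Ioi fun s (hs : 0 < s) => ?_
        rw [← ENNReal.ofReal_mul (norm_nonneg _), ← ofReal_norm]
        refine ENNReal.ofReal_le_ofReal ?_
        rw [norm_mul, heatDeriv, norm_mul, norm_neg, norm_div, Real.norm_of_nonneg hs.le,
          Real.norm_of_nonneg (heat_nonneg hs z), Real.norm_of_nonneg (by positivity), heat]
        have e : s ^ (-3 : ℝ) = s ^ (-1 / 2 : ℝ) * (s⁻¹ * s ^ (-3 / 2 : ℝ)) := by
          rw [← Real.rpow_neg_one, ← Real.rpow_add hs, ← Real.rpow_add hs]; norm_num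
        have h1 : ‖z j‖ ≤ ‖z‖ := PiLp.norm_apply_le z j
        rw [e]
        calc s ^ (-1 / 2 : ℝ) * (‖z j‖ / s * (s ^ (-3 / 2 : ℝ) *
              Real.exp (-Real.pi * ‖z‖ ^ 2 / s)))
            ≤ s ^ (-1 / 2 : ℝ) * (‖z‖ / s * (s ^ (-3 / 2 : ℝ) *
              Real.exp (-Real.pi * ‖z‖ ^ 2 / s))) := by gcongr
          _ = _ := by rw [neg_mul]; ring
    _ ≤ ENNReal.ofReal ‖z‖ * ENNReal.ofReal (7 / (Real.pi * ‖z‖ ^ 2) ^ 2) := by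
        rw [lintegral_const_mul' _ _ ENNReal.ofReal_ne_top]
        gcongr
        exact lintegral_rpow_mul_exp_le hc
    _ ≤ ENNReal.ofReal (7 / ‖z‖ ^ 3) := by
        rw [← ENNReal.ofReal_mul (norm_nonneg _)]
        refine ENNReal.ofReal_le_ofReal ?_
        have h1 : (1 : ℝ) ≤ Real.pi ^ 2 := by nlinarith [Real.pi_gt_three]
        calc ‖z‖ * (7 / (Real.pi * ‖z‖ ^ 2) ^ 2) = 7 / ‖z‖ ^ 3 / Real.pi ^ 2 := by
              have := Real.pi_ne_zero; field_simp
          _ ≤ 7 / ‖z‖ ^ 3 := div_le_self (by positivity) h1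

/-- The commutator of `R_j` with the multiplication by `v` has the kernel of `R_j`, multiplied by
`v y - v x`. This factor vanishes on the diagonal, so that only the size of the kernel matters and
no principal value is needed. -/
theorem enorm_commutator_le (j : Fin 3) {v : E3 → ℝ} (hv : Continuous v) {φ ψ : 𝓢(E3, ℝ)}
    (hψ : ∀ y, ψ y = v y * φ y) (x : E3) :
    ‖rieszSchwartz j ψ x - v x * rieszSchwartz j φ x‖ₑ
      ≤ ∫⁻ y, ENNReal.ofReal (7 / ‖x - y‖ ^ 3) * (‖v y - v x‖ₑ * ‖φ y‖ₑ) := by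
  obtain ⟨hi1, h1⟩ := rieszSchwartz_eq_integral_heat j ψ x
  obtain ⟨hi2, h2⟩ := rieszSchwartz_eq_integral_heat j φ x
  have hint : ∀ s ∈ Ioi (0 : ℝ), ∀ f : 𝓢(E3, ℝ),
      Integrable fun y => heatDeriv j s (x - y) * f y := fun s hs f => by
    have := (integrable_heatDeriv_mul hs j (complexify f) x).re
    refine this.congr (ae_of_all _ fun y => ?_)
    simp
  have h3 : rieszSchwartz j ψ x - v x * rieszSchwartz j φ x = ∫ s in Ioi (0 : ℝ),
      ∫ y, s ^ (-1 / 2 : ℝ) * heatDeriv j s (x - y) * ((v y - v x) * φ y) := by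
    rw [h1, h2, ← integral_const_mul, ← integral_sub hi1 (hi2.const_mul _)]
    refine setIntegral_congr_fun measurableSet_Ioi fun s hs => ?_
    rw [← mul_assoc, mul_comm (v x), mul_assoc, ← mul_sub, ← integral_const_mul,
      ← integral_sub (hint s hs ψ) ((hint s hs φ).const_mul _), ← integral_const_mul]
    refine integral_congr_ae (ae_of_all _ fun y => ?_)
    simp only [hψ]; ring
  have hm : Measurable fun z : ℝ × E3 => z.1 ^ (-1 / 2 : ℝ) * heatDeriv j z.1 (x - z.2) := by
    have h0 : Measurable fun z : ℝ × E3 => (x - z.2) j :=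
      ((EuclideanSpace.proj (𝕜 := ℝ) j).continuous.comp
        (continuous_const.sub continuous_snd)).measurable
    unfold heatDeriv heat
    fun_prop
  calc ‖rieszSchwartz j ψ x - v x * rieszSchwartz j φ x‖ₑ
      ≤ ∫⁻ s in Ioi (0 : ℝ), ∫⁻ y,
        ‖s ^ (-1 / 2 : ℝ) * heatDeriv j s (x - y)‖ₑ * (‖v y - v x‖ₑ * ‖φ y‖ₑ) := by
        rw [h3]
        refine (enorm_integral_le_lintegral_enorm _).trans (lintegral_mono fun s => ?_)
        refine (enorm_integral_le_lintegral_enorm _).trans (lintegral_mono fun y => ?_)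
        rw [← enorm_mul (v y - v x), ← enorm_mul]
    _ = ∫⁻ y, ∫⁻ s in Ioi (0 : ℝ),
        ‖s ^ (-1 / 2 : ℝ) * heatDeriv j s (x - y)‖ₑ * (‖v y - v x‖ₑ * ‖φ y‖ₑ) := by
        refine lintegral_lintegral_swap ?_
        have h4 : Measurable fun z : ℝ × E3 => ‖v z.2 - v x‖ₑ * ‖φ z.2‖ₑ :=
          ((hv.comp continuous_snd).sub continuous_const).measurable.enorm.mul
            (φ.continuous.comp continuous_snd).measurable.enorm
        exact (hm.enorm.mul h4).aemeasurable
    _ ≤ ∫⁻ y, ENNReal.ofReal (7 / ‖x - y‖ ^ 3) * (‖v y - v x‖ₑ * ‖φ y‖ₑ) := by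
        refine lintegral_mono_ae ?_
        filter_upwards [Measure.ae_ne volume x] with y hy
        rw [lintegral_mul_const]
        · gcongr
          exact lintegral_heatDeriv_le j (sub_ne_zero.2 hy.symm)
        · exact (hm.comp measurable_prodMk_right).enorm

end Commutator

/-! ### Commutators with powers of the Japanese bracket -/

section CommutatorKernel

/-- The Japanese bracket `√(1 + |x|²)`, a smooth substitute for `1 + |x|`. -/
noncomputable def bracket (x : E3) : ℝ := Real.sqrt (1 + ‖x‖ ^ 2)

theorem bracket_sq (x : E3) : bracket x ^ 2 = 1 + ‖x‖ ^ 2 := Real.sq_sqrt (by positivity)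

theorem one_le_bracket (x : E3) : 1 ≤ bracket x := by
  rw [bracket, Real.one_le_sqrt]; nlinarith [sq_nonneg ‖x‖]

theorem bracket_pos (x : E3) : 0 < bracket x := one_pos.trans_le (one_le_bracket x)

theorem norm_le_bracket (x : E3) : ‖x‖ ≤ bracket x :=
  Real.le_sqrt_of_sq_le (by linarith)

theorem bracket_le_one_add_norm (x : E3) : bracket x ≤ 1 + ‖x‖ := by
  rw [bracket, Real.sqrt_le_left (by positivity)]; nlinarith [norm_nonneg x]

theorem one_add_norm_le_bracket (x : E3) : 1 + ‖x‖ ≤ 2 * bracket x := by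
  linarith [one_le_bracket x, norm_le_bracket x]

theorem continuous_bracket : Continuous bracket := by unfold bracket; fun_prop

theorem bracket_le_add (x y : E3) : bracket x ≤ bracket y + ‖x - y‖ := by
  have h1 : ‖x‖ ≤ ‖y‖ + ‖x - y‖ := by
    calc ‖x‖ = ‖y + (x - y)‖ := by congr 1; abel
      _ ≤ _ := norm_add_le _ _
  have h2 := norm_le_bracket y
  have h3 := bracket_pos y
  have h4 := norm_nonneg (x - y)
  refine abs_le_of_sq_le_sq' ?_ (by positivity) |>.2
  rw [bracket_sq]
  nlinarith [bracket_sq y, norm_nonneg x, norm_nonneg y]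

theorem abs_bracket_sub_le (x y : E3) : |bracket y - bracket x| ≤ ‖x - y‖ := by
  rw [abs_le]
  have := bracket_le_add y x
  rw [norm_sub_rev] at this
  constructor <;> linarith [bracket_le_add x y]

/-- The function `(r ^ s - 1) / (r ^ s + 1)` is bounded by a multiple of `(r - 1) / (r + 1)`: it
is bounded, and it vanishes at `r = 1`, where the second function has a simple zero. -/
theorem abs_rpow_sub_one_le {r s : ℝ} (hr : 0 < r) (hs : 0 ≤ s) :
    |r ^ s - 1| ≤ (6 * s + 3) * (|r - 1| / (r + 1)) * (1 + r ^ s) := by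
  have hp : 0 < r ^ s := Real.rpow_pos_of_pos hr s
  have hq : 0 ≤ |r - 1| / (r + 1) := by positivity
  by_cases h : 1 / 3 ≤ |r - 1| / (r + 1)
  -- away from `r = 1`, the quotient `|r - 1| / (r + 1)` is bounded below
  · have h1 : |r ^ s - 1| ≤ 1 + r ^ s := by rw [abs_le]; constructor <;> linarith
    have h2 : 1 ≤ (6 * s + 3) * (|r - 1| / (r + 1)) := by nlinarith
    nlinarith
  · push Not at h
    rw [div_lt_iff₀ (by linarith)] at h
    -- near `r = 1`, write `r ^ s = exp (s log r)`
    have hexp : ∀ x : ℝ, |Real.exp x - 1| ≤ |x| * (1 + Real.exp x) := fun x => by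
      have e1 := Real.exp_pos x
      have e2 := Real.add_one_le_exp (-x)
      have e3 := Real.add_one_le_exp x
      have e4 : Real.exp (-x) * Real.exp x = 1 := by rw [← Real.exp_add]; simp
      rcases le_total 0 x with hx | hx
      · rw [abs_of_nonneg hx, abs_of_nonneg (by linarith)]; nlinarith
      · rw [abs_of_nonpos hx, abs_of_nonpos (by linarith [Real.exp_le_one_iff.2 hx])]; nlinarith
    have hlog : |Real.log r| ≤ 6 * (|r - 1| / (r + 1)) := by
      have l1 := Real.log_le_sub_one_of_pos hr
      have l2 := Real.log_le_sub_one_of_pos (inv_pos.2 hr)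
      rw [Real.log_inv] at l2
      have hlt := abs_lt.1 h
      have hr1 : 1 / 2 ≤ r := by linarith
      have hr2 : r ≤ 2 := by linarith
      have hm : |Real.log r| ≤ 2 * |r - 1| := by
        rcases le_total 1 r with h1 | h1
        · rw [abs_of_nonneg (Real.log_nonneg h1), abs_of_nonneg (by linarith)]; linarith
        · rw [abs_of_nonpos (Real.log_nonpos hr.le h1), abs_of_nonpos (by linarith)]
          have : r⁻¹ ≤ 3 - 2 * r := by
            rw [inv_le_iff_one_le_mul₀ hr]; nlinarith
          linarith
      calc _ ≤ 2 * |r - 1| := hm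
        _ ≤ _ := by
          rw [mul_div_assoc', le_div_iff₀ (by linarith)]; nlinarith [abs_nonneg (r - 1)]
    rw [Real.rpow_def_of_pos hr] at hp ⊢
    calc _ ≤ |Real.log r * s| * (1 + Real.exp (Real.log r * s)) := hexp _
      _ ≤ (6 * (|r - 1| / (r + 1)) * s) * (1 + Real.exp (Real.log r * s)) := by
        rw [abs_mul, abs_of_nonneg hs]; gcongr
      _ = (6 * s) * (|r - 1| / (r + 1)) * (1 + Real.exp (Real.log r * s)) := by ring
      _ ≤ _ := by gcongr; linarith

/-- The commutator of a Riesz transform with a power of the bracket has a kernel which is less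
singular, at the diagonal and at infinity, than that of the Riesz transform. -/
noncomputable def commKernel (x y : E3) : ℝ := (‖x - y‖ ^ 2)⁻¹ * (bracket x + bracket y)⁻¹

theorem commKernel_comm (x y : E3) : commKernel x y = commKernel y x := by
  rw [commKernel, commKernel, norm_sub_rev, add_comm (bracket x)]

theorem commKernel_nonneg (x y : E3) : 0 ≤ commKernel x y := by
  have := bracket_pos x
  have := bracket_pos y
  unfold commKernel; positivity

theorem measurable_commKernel : Measurable fun z : E3 × E3 => commKernel z.1 z.2 := by
  have := continuous_bracket.measurable
  unfold commKernel
  fun_prop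

/-- The kernel of the commutator of `R_j` with `bracket ^ (-s)` is bounded by `commKernel` and by
its conjugate by `bracket ^ s`. The factor `bracket y ^ (-s)` is put aside, as it combines with the
function on which the commutator acts. -/
theorem abs_bracket_rpow_sub_le {s : ℝ} (hs : 0 ≤ s) (x y : E3) :
    7 / ‖x - y‖ ^ 3 * |bracket y ^ (-s) - bracket x ^ (-s)|
      ≤ 7 * (6 * s + 3) * (commKernel x y + bracket x ^ (-s) * commKernel x y * bracket y ^ s)
        * bracket y ^ (-s) := by
  have hx := bracket_pos x
  have hy := bracket_pos y
  rcases eq_or_ne x y with rfl | hne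
  · simp [commKernel]
  have hd : 0 < ‖x - y‖ := norm_pos_iff.2 (sub_ne_zero.2 hne)
  have h1 := abs_rpow_sub_one_le (div_pos hy hx) hs
  have hxs := Real.rpow_pos_of_pos hx s
  have hys := Real.rpow_pos_of_pos hy s
  have e1 : bracket y ^ (-s) - bracket x ^ (-s)
      = -(((bracket y / bracket x) ^ s - 1) * bracket y ^ (-s)) := by
    rw [Real.div_rpow hy.le hx.le, Real.rpow_neg hx.le, Real.rpow_neg hy.le]; field_simp; ring
  have e2 : |bracket y / bracket x - 1| / (bracket y / bracket x + 1)
      ≤ ‖x - y‖ * (bracket x + bracket y)⁻¹ := by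
    have : bracket y / bracket x - 1 = (bracket y - bracket x) / bracket x := by field_simp
    rw [this, abs_div, abs_of_pos hx]
    calc |bracket y - bracket x| / bracket x / (bracket y / bracket x + 1)
        = |bracket y - bracket x| * (bracket x + bracket y)⁻¹ := by field_simp; ring
      _ ≤ _ := by gcongr; exact abs_bracket_sub_le x y
  have e3 : (bracket y / bracket x) ^ s = bracket x ^ (-s) * bracket y ^ s := by
    rw [Real.div_rpow hy.le hx.le, Real.rpow_neg hx.le]; field_simp
  have hyn := Real.rpow_pos_of_pos hy (-s)
  rw [e1, abs_neg, abs_mul, abs_of_pos hyn]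
  calc 7 / ‖x - y‖ ^ 3 * (|(bracket y / bracket x) ^ s - 1| * bracket y ^ (-s))
      ≤ 7 / ‖x - y‖ ^ 3 * (((6 * s + 3) * (‖x - y‖ * (bracket x + bracket y)⁻¹) *
          (1 + (bracket y / bracket x) ^ s)) * bracket y ^ (-s)) := by
        have : 0 ≤ (bracket y / bracket x) ^ s := by positivity
        gcongr; exact h1.trans (by gcongr)
    _ = _ := by rw [e3, commKernel]; field_simp

theorem lintegral_comp_smul (f : E3 → ℝ≥0∞) {r : ℝ} (hr : 0 < r) :
    ∫⁻ x, f (r • x) = ENNReal.ofReal ((r ^ 3)⁻¹) * ∫⁻ x, f x := by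
  have h := Measure.map_addHaar_smul (volume : Measure E3) hr.ne'
  have e : ∫⁻ x, f (r • x) = ∫⁻ x, f x ∂(Measure.map (fun x : E3 => r • x) volume) :=
    (lintegral_map_equiv f (Homeomorph.smulOfNeZero r hr.ne').toMeasurableEquiv).symm
  rw [e, h, lintegral_smul_measure, finrank_euclideanSpace, Fintype.card_fin,
    abs_of_pos (by positivity), smul_eq_mul]

theorem lintegral_ball_inv_sq_lt_top :
    ∫⁻ x in Metric.ball (0 : E3) (1 / 2), ENNReal.ofReal ((‖x‖ ^ 2)⁻¹) < ∞ := by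
  have h : IntegrableOn (fun x : E3 => (‖x‖ ^ 2)⁻¹) (Metric.ball 0 (1 / 2)) := by
    refine (integrableOn_fun_norm_addHaar volume (f := fun t : ℝ => (t ^ 2)⁻¹)).2 ?_
    rw [finrank_euclideanSpace, Fintype.card_fin]
    refine (integrableOn_const (C := (1 : ℝ)) (by simp)).congr_fun (fun t ht => ?_)
      measurableSet_Ioo
    have := ht.1.ne'
    simp [this]
  exact h.lintegral_lt_top

theorem lintegral_norm_rpow_lt_top {a : ℝ} (ha : 0 < a) (ha3 : a < 3) :
    ∫⁻ x : E3, ENNReal.ofReal (((1 + ‖x‖) ^ 3)⁻¹ * ‖x‖ ^ (-a)) < ∞ := by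
  have h : Integrable (fun x : E3 => ((1 + ‖x‖) ^ 3)⁻¹ * ‖x‖ ^ (-a)) := by
    refine (integrable_fun_norm_addHaar volume
      (f := fun t : ℝ => ((1 + t) ^ 3)⁻¹ * t ^ (-a))).2 ?_
    rw [finrank_euclideanSpace, Fintype.card_fin]
    have hm : Measurable fun t : ℝ => t ^ (3 - 1) • (((1 + t) ^ 3)⁻¹ * t ^ (-a)) := by fun_prop
    have hI : (Ioi (0 : ℝ)) = Ioo 0 1 ∪ Ici 1 := by
      rw [Ioo_union_Ici_eq_Ioi]; norm_num
    rw [hI]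
    refine IntegrableOn.union ?_ ?_
    · refine ((intervalIntegral.integrableOn_Ioo_rpow_iff (s := 2 - a) one_pos).2
        (by linarith)).mono' hm.aestronglyMeasurable ?_
      filter_upwards [ae_restrict_mem measurableSet_Ioo] with t ht
      have ht0 : 0 < t := ht.1
      rw [Real.norm_of_nonneg (by positivity), sub_eq_add_neg, Real.rpow_add ht0, smul_eq_mul]
      have : ((1 + t) ^ 3)⁻¹ ≤ 1 := inv_le_one_of_one_le₀ (one_le_pow₀ (by linarith))
      have e : t ^ (3 - 1) = t ^ (2 : ℝ) := by norm_cast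
      rw [e]
      gcongr
      exact mul_le_of_le_one_left (by positivity) this
    · have : IntegrableOn (fun t : ℝ => t ^ (-1 - a)) (Ici 1) := by
        rw [integrableOn_Ici_iff_integrableOn_Ioi]
        exact integrableOn_Ioi_rpow_of_lt (by linarith) one_pos
      refine this.mono' hm.aestronglyMeasurable ?_
      filter_upwards [ae_restrict_mem measurableSet_Ici] with t ht
      have ht0 : 0 < t := lt_of_lt_of_le one_pos ht
      rw [Real.norm_of_nonneg (by positivity), sub_eq_add_neg, Real.rpow_add ht0, smul_eq_mul,
        Real.rpow_neg_one, ← mul_assoc]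
      gcongr
      rw [← div_eq_mul_inv, div_le_iff₀ (by positivity), inv_mul_eq_div, le_div_iff₀ ht0]
      calc t ^ (3 - 1) * t = t ^ 3 := by ring
        _ ≤ (1 + t) ^ 3 := by gcongr; linarith
  exact h.lintegral_lt_top

/-- The operator with kernel `commKernel` maps `bracket ^ (-a)` to a function that is bounded by a
multiple of `bracket ^ (-a)`, which makes this power a weight for Schur's test. The condition
`a < 3` is the integrability of `|y| ^ (-a)` at the origin, and `0 < a` gives the decay at
infinity. -/
theorem exists_lintegral_commKernel_le {a : ℝ} (ha : 0 < a) (ha3 : a < 3) :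
    ∃ C : ℝ≥0∞, C ≠ ∞ ∧ ∀ x, ∫⁻ y, ENNReal.ofReal (commKernel x y * bracket y ^ (-a))
      ≤ C * ENNReal.ofReal (bracket x ^ (-a)) := by
  set C₁ := ∫⁻ x in Metric.ball (0 : E3) (1 / 2), ENNReal.ofReal ((‖x‖ ^ 2)⁻¹) with hC₁
  set C₂ := ∫⁻ x : E3, ENNReal.ofReal (((1 + ‖x‖) ^ 3)⁻¹ * ‖x‖ ^ (-a)) with hC₂
  refine ⟨ENNReal.ofReal (2 ^ a) * C₁ + 25 * C₂, ENNReal.add_ne_top.2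
    ⟨ENNReal.mul_ne_top ENNReal.ofReal_ne_top lintegral_ball_inv_sq_lt_top.ne,
    ENNReal.mul_ne_top (by simp) (lintegral_norm_rpow_lt_top ha ha3).ne⟩, fun x => ?_⟩
  set X := bracket x with hX
  have hX0 : 0 < X := bracket_pos x
  let f : E3 → ℝ≥0∞ := (Metric.ball (0 : E3) (X / 2)).indicator
    fun z => ENNReal.ofReal ((‖z‖ ^ 2)⁻¹)
  let g : E3 → ℝ≥0∞ := fun y => ENNReal.ofReal (((X + ‖y‖) ^ 3)⁻¹ * ‖y‖ ^ (-a))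
  have hfm : Measurable f := Measurable.indicator (by fun_prop) measurableSet_ball
  have hgm : Measurable g := by fun_prop
  have hf : ∫⁻ z, f z = ENNReal.ofReal X * C₁ := by
    have h := lintegral_comp_smul f hX0
    have e : ∫⁻ z, f (X • z) = ENNReal.ofReal ((X ^ 2)⁻¹) * C₁ := by
      rw [hC₁, ← lintegral_indicator measurableSet_ball, ← lintegral_const_mul' _ _
        ENNReal.ofReal_ne_top]
      refine lintegral_congr fun z => ?_
      have hmem : X • z ∈ Metric.ball (0 : E3) (X / 2) ↔ z ∈ Metric.ball (0 : E3) (1 / 2) := by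
        rw [mem_ball_zero_iff, mem_ball_zero_iff, norm_smul, Real.norm_of_nonneg hX0.le]
        constructor <;> intro h <;> nlinarith
      by_cases hz : z ∈ Metric.ball (0 : E3) (1 / 2)
      · simp only [f]
        rw [indicator_of_mem (hmem.2 hz), indicator_of_mem hz, ← ENNReal.ofReal_mul (by positivity),
          norm_smul, mul_pow, mul_inv, Real.norm_of_nonneg hX0.le]
      · simp only [f]
        rw [indicator_of_notMem (mt hmem.1 hz), indicator_of_notMem hz, mul_zero]
    rw [e] at h
    have h2 : ENNReal.ofReal (X ^ 3) * (ENNReal.ofReal ((X ^ 3)⁻¹) * ∫⁻ z, f z) = ∫⁻ z, f z := by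
      rw [← mul_assoc, ← ENNReal.ofReal_mul (by positivity), mul_inv_cancel₀ (by positivity),
        ENNReal.ofReal_one, one_mul]
    rw [← h2, ← h, ← mul_assoc, ← ENNReal.ofReal_mul (by positivity)]
    congr 2; field_simp
  have hg : ∫⁻ y, g y = ENNReal.ofReal (X ^ (-a)) * C₂ := by
    have h := lintegral_comp_smul g hX0
    have e : ∫⁻ z, g (X • z) = ENNReal.ofReal ((X ^ 3)⁻¹ * X ^ (-a)) * C₂ := by
      rw [hC₂, ← lintegral_const_mul' _ _ ENNReal.ofReal_ne_top]
      refine lintegral_congr fun z => ?_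
      simp only [g]
      rw [← ENNReal.ofReal_mul (by positivity), norm_smul, Real.norm_of_nonneg hX0.le,
        Real.mul_rpow hX0.le (norm_nonneg _)]
      congr 1
      rw [show X + X * ‖z‖ = X * (1 + ‖z‖) by ring, mul_pow, mul_inv]; ring
    rw [e] at h
    have h2 : ENNReal.ofReal (X ^ 3) * (ENNReal.ofReal ((X ^ 3)⁻¹) * ∫⁻ z, g z) = ∫⁻ z, g z := by
      rw [← mul_assoc, ← ENNReal.ofReal_mul (by positivity), mul_inv_cancel₀ (by positivity),
        ENNReal.ofReal_one, one_mul]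
    rw [← h2, ← h, ← mul_assoc, ← ENNReal.ofReal_mul (by positivity)]
    congr 2; field_simp
  -- for `|x - y| < X / 2` the brackets of `x` and `y` are comparable, and otherwise
  -- `X + |y| ≤ 5 |x - y|`
  have hpt : ∀ᵐ y, ENNReal.ofReal (commKernel x y * bracket y ^ (-a))
      ≤ ENNReal.ofReal (2 ^ a * X ^ (-a) * X⁻¹) * f (x - y) + 25 * g y := by
    filter_upwards [Measure.ae_ne volume (0 : E3)] with y hy
    have hy0 : 0 < ‖y‖ := norm_pos_iff.2 hy
    have hY0 := bracket_pos y
    have hlip := bracket_le_add x y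
    by_cases hd : ‖x - y‖ < X / 2
    · refine le_add_right ?_
      simp only [f]
      rw [indicator_of_mem (by rwa [mem_ball_zero_iff]), ← ENNReal.ofReal_mul (by positivity)]
      refine ENNReal.ofReal_le_ofReal ?_
      have h1 : bracket y ^ (-a) ≤ 2 ^ a * X ^ (-a) := by
        have : (X / 2) ^ (-a) = 2 ^ a * X ^ (-a) := by
          rw [Real.div_rpow hX0.le (by norm_num), Real.rpow_neg (by norm_num : (0:ℝ) ≤ 2),
            div_inv_eq_mul, mul_comm]
        rw [← this]
        exact Real.rpow_le_rpow_of_nonpos (by positivity) (by linarith) (by linarith)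
      have h2 : (X + bracket y)⁻¹ ≤ X⁻¹ := by gcongr; linarith
      rw [commKernel]
      calc (‖x - y‖ ^ 2)⁻¹ * (X + bracket y)⁻¹ * bracket y ^ (-a)
          ≤ (‖x - y‖ ^ 2)⁻¹ * X⁻¹ * (2 ^ a * X ^ (-a)) := by gcongr
        _ = _ := by ring
    · push Not at hd
      refine le_add_left ?_
      rw [show (25 : ℝ≥0∞) = ENNReal.ofReal 25 by simp]
      simp only [g]
      rw [← ENNReal.ofReal_mul (by norm_num)]
      refine ENNReal.ofReal_le_ofReal ?_
      have hd0 : 0 < ‖x - y‖ := by linarith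
      have hlip' := bracket_le_add y x
      rw [norm_sub_rev] at hlip'
      have h3 : (‖x - y‖ ^ 2)⁻¹ ≤ 25 * ((X + ‖y‖) ^ 2)⁻¹ := by
        rw [← div_eq_mul_inv, inv_eq_one_div, div_le_div_iff₀ (by positivity) (by positivity),
          one_mul]
        have : X + ‖y‖ ≤ 5 * ‖x - y‖ := by linarith [norm_le_bracket y]
        calc (X + ‖y‖) ^ 2 ≤ (5 * ‖x - y‖) ^ 2 := by gcongr
          _ = _ := by ring
      have h4 : (X + bracket y)⁻¹ ≤ (X + ‖y‖)⁻¹ := by gcongr; exact norm_le_bracket y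
      have h5 : bracket y ^ (-a) ≤ ‖y‖ ^ (-a) :=
        Real.rpow_le_rpow_of_nonpos hy0 (norm_le_bracket y) (by linarith)
      rw [commKernel]
      calc (‖x - y‖ ^ 2)⁻¹ * (X + bracket y)⁻¹ * bracket y ^ (-a)
          ≤ 25 * ((X + ‖y‖) ^ 2)⁻¹ * (X + ‖y‖)⁻¹ * ‖y‖ ^ (-a) := by gcongr
        _ = _ := by rw [pow_succ _ 2, mul_inv]; ring
  refine (lintegral_mono_ae hpt).trans ?_
  rw [lintegral_add_right _ (hgm.const_mul _), lintegral_const_mul' _ _ ENNReal.ofReal_ne_top,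
    lintegral_sub_left_eq_self f x, hf, lintegral_const_mul _ hgm, hg, add_mul]
  refine add_le_add (le_of_eq ?_) (le_of_eq (by ring))
  rw [← mul_assoc, ← ENNReal.ofReal_mul (by positivity)]
  have : 2 ^ a * X ^ (-a) * X⁻¹ * X = 2 ^ a * X ^ (-a) := by field_simp
  rw [this, ENNReal.ofReal_mul (by positivity)]; ring

end CommutatorKernel

/-! ### Weighted bounds for the Riesz transforms -/

section WeightedBounds

/-- Schur's test on `L^p`, with the weight `h`. -/
theorem lintegral_rpow_lintegral_mul_le {p : ℝ} (hp : 1 < p) {K : E3 → E3 → ℝ≥0∞}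
    (hK : Measurable (Function.uncurry K)) {h g : E3 → ℝ≥0∞} (hh : Measurable h)
    (hg : Measurable g) (h0 : ∀ x, h x ≠ 0) (ht : ∀ x, h x ≠ ∞) {A B : ℝ≥0∞}
    (hA : ∀ x, ∫⁻ y, K x y * h y ≤ A * h x)
    (hB : ∀ y, ∫⁻ x, K x y * h x ^ (p - 1) ≤ B * h y ^ (p - 1)) :
    ∫⁻ x, (∫⁻ y, K x y * g y) ^ p ≤ A ^ (p - 1) * B * ∫⁻ y, g y ^ p := by
  have hp1 : 0 < p - 1 := by linarith
  have hKx : ∀ x, Measurable (K x) := fun x => hK.comp measurable_prodMk_left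
  have hKy : ∀ y, Measurable fun x => K x y := fun y => hK.comp measurable_prodMk_right
  have h1 : ∀ x, (∫⁻ y, K x y * g y) ^ p
      ≤ (A * h x) ^ (p - 1) * ∫⁻ y, K x y * h y * (g y / h y) ^ p := fun x => by
    have e : ∀ y, K x y * g y = K x y * h y * (g y / h y) := fun y => by
      rw [mul_assoc, ENNReal.mul_div_cancel (h0 y) (ht y)]
    simp only [e]
    refine (lintegral_mul_rpow_le hp (k := fun y => K x y * h y) (f := fun y => g y / h y)
      ((hKx x).mul hh).aemeasurable (hg.div hh).aemeasurable).trans ?_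
    gcongr
    exact hA x
  have hm : Measurable fun z : E3 × E3 =>
      (A * h z.1) ^ (p - 1) * (K z.1 z.2 * h z.2 * (g z.2 / h z.2) ^ p) := by
    have := hh.comp (measurable_fst : Measurable (Prod.fst : E3 × E3 → E3))
    have h2 := hh.comp (measurable_snd : Measurable (Prod.snd : E3 × E3 → E3))
    have h3 := (hg.div hh).comp (measurable_snd : Measurable (Prod.snd : E3 × E3 → E3))
    exact ((this.const_mul A).pow_const _).mul ((hK.mul h2).mul (h3.pow_const _))
  calc ∫⁻ x, (∫⁻ y, K x y * g y) ^ p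
      ≤ ∫⁻ x, ∫⁻ y, (A * h x) ^ (p - 1) * (K x y * h y * (g y / h y) ^ p) := by
        refine lintegral_mono fun x => (h1 x).trans (le_of_eq ?_)
        rw [lintegral_const_mul]
        exact ((hKx x).mul hh).mul ((hg.div hh).pow_const _)
    _ = ∫⁻ y, ∫⁻ x, (A * h x) ^ (p - 1) * (K x y * h y * (g y / h y) ^ p) :=
        lintegral_lintegral_swap hm.aemeasurable
    _ ≤ ∫⁻ y, A ^ (p - 1) * B * g y ^ p := by
        refine lintegral_mono fun y => ?_
        have e : ∀ x, (A * h x) ^ (p - 1) * (K x y * h y * (g y / h y) ^ p)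
            = A ^ (p - 1) * (h y * (g y / h y) ^ p) * (K x y * h x ^ (p - 1)) := fun x => by
          rw [ENNReal.mul_rpow_of_nonneg _ _ hp1.le]; ring
        simp only [e]
        have hmy : Measurable fun x => K x y * h x ^ (p - 1) := (hKy y).mul (hh.pow_const _)
        rw [lintegral_const_mul _ hmy]
        calc A ^ (p - 1) * (h y * (g y / h y) ^ p) * ∫⁻ x, K x y * h x ^ (p - 1)
            ≤ A ^ (p - 1) * (h y * (g y / h y) ^ p) * (B * h y ^ (p - 1)) := by gcongr; exact hB y
          _ = A ^ (p - 1) * B * ((h y ^ (1 : ℝ) * h y ^ (p - 1)) * (g y / h y) ^ p) := by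
            rw [ENNReal.rpow_one]; ring
          _ = A ^ (p - 1) * B * g y ^ p := by
            rw [← ENNReal.rpow_add _ _ (h0 y) (ht y), add_sub_cancel,
              ← ENNReal.mul_rpow_of_nonneg _ _ (by linarith : 0 ≤ p),
              ENNReal.mul_div_cancel (h0 y) (ht y)]
    _ = _ := lintegral_const_mul _ (hg.pow_const _)

/-- The bounds for `commKernel` with the weights `bracket ^ (-b)` and `bracket ^ (-(b + c))` give a
bound with the weight `bracket ^ (-b)` for the sum of `commKernel` and of its conjugate by
`bracket ^ c`. -/
theorem lintegral_commKernel_add_le {M : ℝ} (hM0 : 0 ≤ M) (x : E3) (b c : ℝ) {C D : ℝ≥0∞}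
    (hC : ∫⁻ y, ENNReal.ofReal (commKernel x y * bracket y ^ (-b))
      ≤ C * ENNReal.ofReal (bracket x ^ (-b)))
    (hD : ∫⁻ y, ENNReal.ofReal (commKernel x y * bracket y ^ (-(b + c)))
      ≤ D * ENNReal.ofReal (bracket x ^ (-(b + c)))) :
    ∫⁻ y, ENNReal.ofReal (M * (commKernel x y + bracket x ^ c * commKernel x y *
      bracket y ^ (-c)) * bracket y ^ (-b))
      ≤ ENNReal.ofReal M * (C + D) * ENNReal.ofReal (bracket x ^ (-b)) := by
  have hbm := continuous_bracket.measurable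
  have hmx : Measurable fun y => commKernel x y := by unfold commKernel; fun_prop
  have hx := bracket_pos x
  have e : ∀ y, ENNReal.ofReal (M * (commKernel x y + bracket x ^ c * commKernel x y *
      bracket y ^ (-c)) * bracket y ^ (-b))
      = ENNReal.ofReal M * (ENNReal.ofReal (commKernel x y * bracket y ^ (-b)) +
        ENNReal.ofReal (bracket x ^ c) *
          ENNReal.ofReal (commKernel x y * bracket y ^ (-(b + c)))) := fun y => by
    have hy := bracket_pos y
    have hk := commKernel_nonneg x y
    rw [← ENNReal.ofReal_mul (by positivity), ← ENNReal.ofReal_add (by positivity)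
      (by positivity), ← ENNReal.ofReal_mul hM0, neg_add, Real.rpow_add hy]
    congr 1; ring
  simp only [e]
  have hm1 : Measurable fun y => ENNReal.ofReal (commKernel x y * bracket y ^ (-(b + c))) :=
    (hmx.mul (hbm.pow_const _)).ennreal_ofReal
  rw [lintegral_const_mul' _ _ ENNReal.ofReal_ne_top,
    lintegral_add_right _ (hm1.const_mul _), lintegral_const_mul _ hm1, mul_assoc]
  rw [add_mul]
  gcongr ENNReal.ofReal M * ?_
  refine add_le_add hC ?_
  calc _ ≤ ENNReal.ofReal (bracket x ^ c) * (D * ENNReal.ofReal (bracket x ^ (-(b + c)))) :=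
        mul_le_mul_right hD _
    _ = D * (ENNReal.ofReal (bracket x ^ c) * ENNReal.ofReal (bracket x ^ (-(b + c)))) := by ring
    _ = _ := by
      rw [← ENNReal.ofReal_mul (by positivity), ← Real.rpow_add hx]; congr 3; ring

/-- Schur's test for the kernel of `abs_bracket_rpow_sub_le`, with the weight `bracket ^ (-a)`. The
four exponents `a`, `a - s`, `a (p - 1)` and `a (p - 1) + s` all have to be in `(0, 3)`. -/
theorem exists_lintegral_commutator_le {p s a : ℝ} (hp : 1 < p) (hs : 0 ≤ s) (h1 : s < a)
    (h2 : a < 3) (h3 : s + a * (p - 1) < 3) :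
    ∃ C : ℝ≥0∞, C ≠ ∞ ∧ ∀ g : E3 → ℝ≥0∞, Measurable g →
      ∫⁻ x, (∫⁻ y, ENNReal.ofReal (7 * (6 * s + 3) *
        (commKernel x y + bracket x ^ (-s) * commKernel x y * bracket y ^ s)) * g y) ^ p
        ≤ C * ∫⁻ y, g y ^ p := by
  have hb0 : 0 < a * (p - 1) := mul_pos (by linarith) (by linarith)
  obtain ⟨C₁, hC₁, k₁⟩ := exists_lintegral_commKernel_le (a := a) (by linarith) h2
  obtain ⟨C₂, hC₂, k₂⟩ := exists_lintegral_commKernel_le (a := a - s) (by linarith) (by linarith)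
  obtain ⟨C₃, hC₃, k₃⟩ := exists_lintegral_commKernel_le hb0 (by linarith)
  obtain ⟨C₄, hC₄, k₄⟩ := exists_lintegral_commKernel_le (a := s + a * (p - 1))
    (by linarith) h3
  set M : ℝ := 7 * (6 * s + 3) with hM
  have hM0 : 0 ≤ M := by positivity
  have hcm := measurable_commKernel
  have hbm := continuous_bracket.measurable
  have hnn : ∀ x y : E3, 0 ≤ M * (commKernel x y + bracket x ^ (-s) * commKernel x y *
      bracket y ^ s) := fun x y => by
    have := bracket_pos x
    have := bracket_pos y
    have := commKernel_nonneg x y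
    positivity
  have hne : ∀ C D : ℝ≥0∞, C ≠ ∞ → D ≠ ∞ → ENNReal.ofReal M * (C + D) ≠ ∞ := fun C D hC hD =>
    ENNReal.mul_ne_top ENNReal.ofReal_ne_top (ENNReal.add_ne_top.2 ⟨hC, hD⟩)
  refine ⟨(ENNReal.ofReal M * (C₁ + C₂)) ^ (p - 1) * (ENNReal.ofReal M * (C₃ + C₄)),
    ENNReal.mul_ne_top (ENNReal.rpow_ne_top_of_nonneg (by linarith) (hne _ _ hC₁ hC₂))
      (hne _ _ hC₃ hC₄), fun g hg => ?_⟩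
  refine lintegral_rpow_lintegral_mul_le hp
    (K := fun x y => ENNReal.ofReal (M * (commKernel x y + bracket x ^ (-s) * commKernel x y *
      bracket y ^ s)))
    (h := fun x => ENNReal.ofReal (bracket x ^ (-a))) ?_ (hbm.pow_const _).ennreal_ofReal hg
    (fun x => ?_) (fun x => ENNReal.ofReal_ne_top) (fun x => ?_) (fun y => ?_)
  · have h5 := hbm.comp (measurable_fst : Measurable (Prod.fst : E3 × E3 → E3))
    have h6 := hbm.comp (measurable_snd : Measurable (Prod.snd : E3 × E3 → E3))
    exact (measurable_const.mul (hcm.add (((h5.pow_const _).mul hcm).mul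
      (h6.pow_const _)))).ennreal_ofReal
  · have := Real.rpow_pos_of_pos (bracket_pos x) (-a)
    simpa using this
  · have h := lintegral_commKernel_add_le hM0 x a (-s) (k₁ x)
      (by simpa only [← sub_eq_add_neg] using k₂ x)
    simp only [neg_neg] at h
    refine le_trans (le_of_eq (lintegral_congr fun y => ?_)) h
    rw [← ENNReal.ofReal_mul (hnn x y)]
  · have h := lintegral_commKernel_add_le hM0 y (a * (p - 1)) s (k₃ y)
      (by simpa only [add_comm s] using k₄ y)
    have ep : ∀ x : E3, ENNReal.ofReal (bracket x ^ (-a)) ^ (p - 1)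
        = ENNReal.ofReal (bracket x ^ (-(a * (p - 1)))) := fun x => by
      have := bracket_pos x
      rw [ENNReal.ofReal_rpow_of_nonneg (by positivity) (by linarith), ← Real.rpow_mul this.le]
      congr 2; ring
    simp only [ep]
    refine le_trans (le_of_eq (lintegral_congr fun x => ?_)) h
    rw [← ENNReal.ofReal_mul (hnn x y), commKernel_comm x y]
    congr 1; ring

theorem lintegral_weighted (δ : ℝ) {f : E3 → ℝ≥0∞} (hf : Measurable f) :
    ∫⁻ x, f x ∂(weighted δ) = ∫⁻ x, ENNReal.ofReal ((1 + ‖x‖) ^ (-δ)) * f x := by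
  rw [weighted, lintegral_withDensity_eq_lintegral_mul _ (by fun_prop) hf]; rfl

/-- The weighted bounds follow from the unweighted ones: conjugation by the weight costs a
commutator, which is bounded by Schur's test. -/
theorem exists_lintegral_rieszSchwartz_weighted_le {p δ a : ℝ} (hp : 1 < p) (hδ : 0 ≤ δ)
    (h1 : δ / p < a) (h2 : a < 3) (h3 : δ / p + a * (p - 1) < 3) (j : Fin 3)
    (hR : ∃ C : ℝ≥0∞, C ≠ ∞ ∧ ∀ φ : 𝓢(E3, ℝ),
      ∫⁻ x, ‖rieszSchwartz j φ x‖ₑ ^ p ≤ C * ∫⁻ x, ‖φ x‖ₑ ^ p) :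
    ∃ C : ℝ≥0∞, C ≠ ∞ ∧ ∀ φ : 𝓢(E3, ℝ),
      ∫⁻ x, ‖rieszSchwartz j φ x‖ₑ ^ p ∂(weighted δ) ≤ C * ∫⁻ x, ‖φ x‖ₑ ^ p ∂(weighted δ) := by
  have hp0 : 0 < p := by linarith
  set s := δ / p with hs
  have hs0 : 0 ≤ s := by positivity
  obtain ⟨C, hC, hR⟩ := hR
  obtain ⟨D, hD, hS⟩ := exists_lintegral_commutator_le hp hs0 h1 h2 h3
  let v : E3 → ℝ := fun x => bracket x ^ (-s)
  have hv0 : ∀ x, 0 < v x := fun x => Real.rpow_pos_of_pos (bracket_pos x) _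
  have hve : v = fun x => (1 + ‖x‖ ^ 2) ^ (-s / 2) := by
    funext x
    simp only [v]
    rw [← bracket_sq, ← Real.rpow_natCast, ← Real.rpow_mul (bracket_pos x).le]
    congr 1; push_cast; ring
  have hvt : Function.HasTemperateGrowth v := by
    rw [hve]; exact Function.hasTemperateGrowth_one_add_norm_sq_rpow _ _
  have hvc : Continuous v := continuous_bracket.rpow_const fun x => Or.inl (bracket_pos x).ne'
  refine ⟨2 ^ (p - 1) * (C + D) * ENNReal.ofReal (2 ^ δ), ENNReal.mul_ne_top (ENNReal.mul_ne_top
    (ENNReal.rpow_ne_top_of_nonneg (by linarith) (by simp)) (ENNReal.add_ne_top.2 ⟨hC, hD⟩))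
    ENNReal.ofReal_ne_top, fun φ => ?_⟩
  set ψ : 𝓢(E3, ℝ) := SchwartzMap.smulLeftCLM ℝ v φ with hψd
  have hψ : ∀ y, ψ y = v y * φ y := fun y => by
    rw [hψd, SchwartzMap.smulLeftCLM_apply_apply hvt, smul_eq_mul]
  have hRm := (continuous_rieszSchwartz j φ).measurable
  have hvp : ∀ x, ‖v x‖ₑ ^ p = ENNReal.ofReal (bracket x ^ (-δ)) := fun x => by
    rw [Real.enorm_of_nonneg (hv0 x).le, ENNReal.ofReal_rpow_of_pos (hv0 x)]
    simp only [v]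
    rw [← Real.rpow_mul (bracket_pos x).le, hs]
    congr 2; field_simp
  have hmain : ∀ x, ‖v x * rieszSchwartz j φ x‖ₑ ^ p ≤ 2 ^ (p - 1) *
      (‖rieszSchwartz j ψ x‖ₑ ^ p + (∫⁻ y, ENNReal.ofReal (7 * (6 * s + 3) *
        (commKernel x y + bracket x ^ (-s) * commKernel x y * bracket y ^ s)) * ‖ψ y‖ₑ) ^ p) := by
    intro x
    refine le_trans ?_ (ENNReal.rpow_add_le_mul_rpow_add_rpow _ _ hp.le)
    gcongr
    calc ‖v x * rieszSchwartz j φ x‖ₑ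
        = ‖rieszSchwartz j ψ x - (rieszSchwartz j ψ x - v x * rieszSchwartz j φ x)‖ₑ := by
          congr 1; ring
      _ ≤ _ := enorm_sub_le
      _ ≤ _ := by
        gcongr
        refine (enorm_commutator_le j hvc hψ x).trans (lintegral_mono fun y => ?_)
        rw [hψ, enorm_mul, ← mul_assoc, ← mul_assoc]
        gcongr ?_ * _
        rw [← ofReal_norm, ← ofReal_norm, Real.norm_eq_abs, Real.norm_of_nonneg (hv0 y).le,
          ← ENNReal.ofReal_mul (by positivity), ← ENNReal.ofReal_mul]
        · exact ENNReal.ofReal_le_ofReal (abs_bracket_rpow_sub_le hs0 x y)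
        · have := bracket_pos x
          have := bracket_pos y
          have := commKernel_nonneg x y
          positivity
  calc ∫⁻ x, ‖rieszSchwartz j φ x‖ₑ ^ p ∂(weighted δ)
      ≤ ∫⁻ x, ‖v x * rieszSchwartz j φ x‖ₑ ^ p := by
        rw [lintegral_weighted δ (hRm.enorm.pow_const _)]
        refine lintegral_mono fun x => ?_
        rw [enorm_mul, ENNReal.mul_rpow_of_nonneg _ _ hp0.le, hvp]
        gcongr ENNReal.ofReal ?_ * _
        exact Real.rpow_le_rpow_of_nonpos (bracket_pos x) (bracket_le_one_add_norm x)
          (by linarith)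
    _ ≤ 2 ^ (p - 1) * (C * (∫⁻ x, ‖ψ x‖ₑ ^ p) + D * ∫⁻ x, ‖ψ x‖ₑ ^ p) := by
        refine (lintegral_mono hmain).trans ?_
        rw [lintegral_const_mul' _ _ (ENNReal.rpow_ne_top_of_nonneg (by linarith) (by simp)),
          lintegral_add_left ((continuous_rieszSchwartz j ψ).measurable.enorm.pow_const _)]
        gcongr
        · exact hR ψ
        · exact hS _ ψ.continuous.measurable.enorm
    _ = 2 ^ (p - 1) * (C + D) * ∫⁻ x, ‖ψ x‖ₑ ^ p := by ring
    _ ≤ 2 ^ (p - 1) * (C + D) * (ENNReal.ofReal (2 ^ δ) * ∫⁻ x, ‖φ x‖ₑ ^ p ∂(weighted δ)) := by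
        gcongr
        rw [lintegral_weighted δ (φ.continuous.measurable.enorm.pow_const _),
          ← lintegral_const_mul' _ _ ENNReal.ofReal_ne_top]
        refine lintegral_mono fun x => ?_
        rw [hψ, enorm_mul, ENNReal.mul_rpow_of_nonneg _ _ hp0.le, hvp, ← mul_assoc,
          ← ENNReal.ofReal_mul (by positivity)]
        gcongr ENNReal.ofReal ?_ * _
        have hx := bracket_pos x
        calc bracket x ^ (-δ) = 2 ^ δ * (2 * bracket x) ^ (-δ) := by
              rw [Real.mul_rpow (by norm_num) hx.le, Real.rpow_neg (by norm_num : (0:ℝ) ≤ 2)]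
              have : (0 : ℝ) < 2 ^ δ := by positivity
              field_simp
          _ ≤ 2 ^ δ * (1 + ‖x‖) ^ (-δ) := by
              gcongr 2 ^ δ * ?_
              exact Real.rpow_le_rpow_of_nonpos (by positivity) (one_add_norm_le_bracket x)
                (by linarith)
    _ = _ := by ring

/-- All the Riesz transforms of Schwartz functions are bounded for the norm of `L^p_{w_δ}`. -/
def RieszBounded (p : ℝ≥0∞) (δ : ℝ) : Prop :=
  ∃ C : ℝ≥0∞, C ≠ ∞ ∧ ∀ (j : Fin 3) (φ : 𝓢(E3, ℝ)),
    eLpNorm (rieszSchwartz j φ) p (weighted δ) ≤ C * eLpNorm φ p (weighted δ)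

theorem rieszBounded_of_forall {p : ℝ≥0∞} {δ : ℝ} (h0 : p ≠ 0) (ht : p ≠ ∞)
    (h : ∀ j : Fin 3, ∃ C : ℝ≥0∞, C ≠ ∞ ∧ ∀ φ : 𝓢(E3, ℝ),
      ∫⁻ x, ‖rieszSchwartz j φ x‖ₑ ^ p.toReal ∂(weighted δ)
        ≤ C * ∫⁻ x, ‖φ x‖ₑ ^ p.toReal ∂(weighted δ)) : RieszBounded p δ := by
  choose C hC h using h
  refine ⟨∑ j, C j ^ (1 / p.toReal), (ENNReal.sum_lt_top.2 fun j _ =>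
    ENNReal.rpow_lt_top_of_nonneg (by positivity) (hC j)).ne, fun j φ => ?_⟩
  rw [eLpNorm_eq_lintegral_rpow_enorm_toReal h0 ht, eLpNorm_eq_lintegral_rpow_enorm_toReal h0 ht]
  calc _ ≤ (C j * ∫⁻ x, ‖φ x‖ₑ ^ p.toReal ∂(weighted δ)) ^ (1 / p.toReal) := by
        gcongr; exact h j φ
    _ = C j ^ (1 / p.toReal) * (∫⁻ x, ‖φ x‖ₑ ^ p.toReal ∂(weighted δ)) ^ (1 / p.toReal) :=
        ENNReal.mul_rpow_of_nonneg _ _ (by positivity)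
    _ ≤ _ := by
        gcongr
        exact Finset.single_le_sum (f := fun j => C j ^ (1 / p.toReal)) (fun _ _ => by positivity)
          (Finset.mem_univ j)

/-- The Schur exponent `a` has to satisfy `γ / 2 < a` and `γ / 2 + a < 3`: the value `3 / 2` reaches
the whole range `γ < 3`. -/
theorem rieszBounded_two {γ : ℝ} (h0 : 0 ≤ γ) (h : γ < 3) : RieszBounded 2 γ := by
  refine rieszBounded_of_forall (by simp) (by simp) fun j => ?_
  rw [ENNReal.toReal_ofNat]
  exact exists_lintegral_rieszSchwartz_weighted_le (a := 3 / 2) (by norm_num) h0 (by linarith)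
    (by norm_num) (by linarith) j ⟨1, by simp, fun φ => by
      rw [one_mul]; exact lintegral_rieszSchwartz_two_le j φ⟩

/-- The Schur exponent `a` has to satisfy `γ < a < 3` and `γ + a / 5 < 3`: the value `5 / 2` reaches
the whole range `γ < 5 / 2`, which is the Muckenhoupt condition. -/
theorem rieszBounded_six_fifths {γ : ℝ} (h0 : 0 ≤ γ) (h : γ < 5 / 2) :
    RieszBounded (6 / 5) (6 * γ / 5) := by
  have e : ((6 / 5 : ℝ≥0∞)).toReal = 6 / 5 := by simp
  refine rieszBounded_of_forall (by simp) (ENNReal.div_ne_top (by simp) (by simp)) fun j => ?_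
  rw [e]
  exact exists_lintegral_rieszSchwartz_weighted_le (a := 5 / 2) (by norm_num) (by linarith)
    (by linarith) (by norm_num) (by linarith) j (exists_lintegral_rieszSchwartz_six_fifths_le j)

end WeightedBounds

/-! ### Extension of the Riesz transforms to weighted spaces -/

section RieszExtension

theorem complexify_sub (φ ψ : 𝓢(E3, ℝ)) : complexify (φ - ψ) = complexify φ - complexify ψ :=
  map_sub (SchwartzMap.postcompCLM Complex.ofRealCLM) φ ψ

theorem hat_sub (φ ψ : 𝓢(E3, ℝ)) : hat (φ - ψ) = hat φ - hat ψ := by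
  rw [hat, complexify_sub]
  exact map_sub (FourierTransform.fourierCLM ℂ 𝓢(E3, ℂ)) (complexify φ) (complexify ψ)

theorem rieszSchwartz_sub (j : Fin 3) (φ ψ : 𝓢(E3, ℝ)) (x : E3) :
    rieszSchwartz j (φ - ψ) x = rieszSchwartz j φ x - rieszSchwartz j ψ x := by
  apply Complex.ofReal_injective
  rw [Complex.ofReal_sub, ofReal_rieszSchwartz, ofReal_rieszSchwartz, ofReal_rieszSchwartz]
  have h1 : rieszFourier j φ = fun ξ => rieszFourier j (φ - ψ) ξ + rieszFourier j ψ ξ := by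
    funext ξ
    simp only [rieszFourier, hat_sub, _root_.sub_apply]; ring
  have h2 := fourierInv_add_of_integrable (integrable_rieszFourier j (φ - ψ))
    (integrable_rieszFourier j ψ) x
  rw [h1, eq_sub_iff_add_eq]
  exact h2.symm

theorem weighted_le_volume {δ : ℝ} (hδ : 0 ≤ δ) : weighted δ ≤ volume := by
  have h : weighted δ ≤ (volume : Measure E3).withDensity 1 := by
    refine withDensity_mono (ae_of_all _ fun x => ?_)
    rw [Pi.one_apply, ENNReal.ofReal_le_one]
    exact Real.rpow_le_one_of_one_le_of_nonpos (by linarith [norm_nonneg x]) (by linarith)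
  rwa [withDensity_one] at h

theorem isFiniteMeasureOnCompacts_weighted {δ : ℝ} (hδ : 0 ≤ δ) :
    IsFiniteMeasureOnCompacts (weighted δ) :=
  ⟨fun K hK => ((weighted_le_volume hδ) K).trans_lt hK.measure_lt_top⟩

instance (δ : ℝ) : SFinite (weighted δ) := by unfold weighted; infer_instance

variable {p : ℝ≥0∞} {δ : ℝ}

theorem memLp_schwartz_weighted (hδ : 0 ≤ δ) (p : ℝ≥0∞) (φ : 𝓢(E3, ℝ)) :
    MemLp φ p (weighted δ) := (φ.memLp p volume).mono_measure (weighted_le_volume hδ)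

theorem RieszBounded.memLp (hδ : 0 ≤ δ) (h : RieszBounded p δ) (j : Fin 3) (φ : 𝓢(E3, ℝ)) :
    MemLp (rieszSchwartz j φ) p (weighted δ) := by
  obtain ⟨C, hC, h⟩ := h
  exact ⟨(continuous_rieszSchwartz j φ).aestronglyMeasurable,
    (h j φ).trans_lt (ENNReal.mul_lt_top hC.lt_top (memLp_schwartz_weighted hδ p φ).2)⟩

/-- One approximating sequence determines the extension of the Riesz transform. -/
theorem RieszBounded.isRieszTransform (hδ : 0 ≤ δ) (hp : 1 ≤ p) (h : RieszBounded p δ) {j : Fin 3}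
    {f g : E3 → ℝ} (hf : MemLp f p (weighted δ)) (hg : MemLp g p (weighted δ)) {φ : ℕ → 𝓢(E3, ℝ)}
    (hφ : Tendsto (fun n => eLpNorm (fun x => φ n x - f x) p (weighted δ)) atTop (𝓝 0))
    (hφg : Tendsto (fun n => eLpNorm (fun x => rieszSchwartz j (φ n) x - g x) p (weighted δ))
      atTop (𝓝 0)) : IsRieszTransform p (weighted δ) j f g := by
  obtain ⟨C, hC, hb⟩ := id h
  refine ⟨hf, hg, fun ψ hψ => ?_⟩
  have h1 : ∀ n, eLpNorm (fun x => rieszSchwartz j (ψ n) x - g x) p (weighted δ)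
      ≤ C * (eLpNorm (fun x => ψ n x - f x) p (weighted δ)
        + eLpNorm (fun x => φ n x - f x) p (weighted δ))
        + eLpNorm (fun x => rieszSchwartz j (φ n) x - g x) p (weighted δ) := fun n => by
    have e1 : (fun x => rieszSchwartz j (ψ n) x - g x)
        = rieszSchwartz j (ψ n - φ n) + fun x => rieszSchwartz j (φ n) x - g x := by
      funext x; simp only [Pi.add_apply, rieszSchwartz_sub]; ring
    have e2 : ⇑(ψ n - φ n) = (fun x => ψ n x - f x) - fun x => φ n x - f x := by
      funext x; simp
    rw [e1]
    refine (eLpNorm_add_le (h.memLp hδ j _).1 ((h.memLp hδ j _).1.sub hg.1) hp).trans ?_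
    refine add_le_add ?_ le_rfl
    refine (hb j _).trans ?_
    gcongr
    rw [e2]
    exact eLpNorm_sub_le ((memLp_schwartz_weighted hδ p _).1.sub hf.1)
      ((memLp_schwartz_weighted hδ p _).1.sub hf.1) hp
  have h2 : Tendsto (fun n => C * (eLpNorm (fun x => ψ n x - f x) p (weighted δ)
        + eLpNorm (fun x => φ n x - f x) p (weighted δ))
        + eLpNorm (fun x => rieszSchwartz j (φ n) x - g x) p (weighted δ)) atTop (𝓝 0) := by
    have := (ENNReal.Tendsto.const_mul (hψ.add hφ) (Or.inr hC)).add hφg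
    simpa using this
  exact tendsto_of_tendsto_of_tendsto_of_le_of_le tendsto_const_nhds h2 (fun _ => zero_le) h1

theorem exists_schwartz_tendsto (hδ : 0 ≤ δ) (hp : 1 ≤ p) (hpt : p ≠ ∞) {f : E3 → ℝ}
    (hf : MemLp f p (weighted δ)) : ∃ φ : ℕ → 𝓢(E3, ℝ),
      Tendsto (fun n => eLpNorm (fun x => φ n x - f x) p (weighted δ)) atTop (𝓝 0) := by
  have := isFiniteMeasureOnCompacts_weighted hδ
  have h : ∀ n : ℕ, ∃ φ : 𝓢(E3, ℝ), eLpNorm (fun x => φ x - f x) p (weighted δ)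
      ≤ ENNReal.ofReal (1 / (n + 1)) := fun n => by
    obtain ⟨g, hg, hgs, h⟩ := hf.exist_eLpNorm_sub_le hpt hp (ε := 1 / (n + 1)) (by positivity)
    refine ⟨hg.toSchwartzMap hgs, ?_⟩
    rw [eLpNorm_sub_comm] at h
    exact h
  choose φ hφ using h
  refine ⟨φ, tendsto_of_tendsto_of_tendsto_of_le_of_le tendsto_const_nhds ?_ (fun _ => zero_le) hφ⟩
  have := ENNReal.tendsto_ofReal (tendsto_one_div_add_atTop_nhds_zero_nat (𝕜 := ℝ))
  simpa using this

theorem tendsto_eLpNorm_of_sub {α : Type*} {m : MeasurableSpace α} {μ : Measure α} (hp : 1 ≤ p)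
    {f : ℕ → α → ℝ} {g : α → ℝ} (hf : ∀ n, MemLp (f n) p μ) (hg : MemLp g p μ)
    (h : Tendsto (fun n => eLpNorm (fun x => f n x - g x) p μ) atTop (𝓝 0)) :
    Tendsto (fun n => eLpNorm (f n) p μ) atTop (𝓝 (eLpNorm g p μ)) := by
  have h1 : ∀ n, eLpNorm g p μ ≤ eLpNorm (f n) p μ + eLpNorm (fun x => f n x - g x) p μ :=
    fun n => by
      have e : g = f n - fun x => f n x - g x := by funext x; simp
      conv_lhs => rw [e]
      exact eLpNorm_sub_le (hf n).1 ((hf n).1.sub hg.1) hp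
  have h2 : ∀ n, eLpNorm (f n) p μ ≤ eLpNorm g p μ + eLpNorm (fun x => f n x - g x) p μ :=
    fun n => by
      have e : f n = g + fun x => f n x - g x := by funext x; simp
      conv_lhs => rw [e]
      exact eLpNorm_add_le hg.1 ((hf n).1.sub hg.1) hp
  refine tendsto_of_tendsto_of_tendsto_of_le_of_le (g := fun n => eLpNorm g p μ
    - eLpNorm (fun x => f n x - g x) p μ) (h := fun n => eLpNorm g p μ
    + eLpNorm (fun x => f n x - g x) p μ) ?_ ?_ (fun n => tsub_le_iff_right.2 (h1 n)) h2
  · simpa using ENNReal.Tendsto.sub tendsto_const_nhds h (Or.inl hg.2.ne)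
  · simpa using tendsto_const_nhds.add h

/-- The bound for Schwartz functions passes to the extension of the Riesz transforms. -/
theorem RieszBounded.exists_eLpNorm_le (hδ : 0 ≤ δ) (hp : 1 ≤ p) (hpt : p ≠ ∞)
    (h : RieszBounded p δ) : ∃ C : ℝ≥0∞, C ≠ ∞ ∧ ∀ (j : Fin 3) (f g : E3 → ℝ),
      IsRieszTransform p (weighted δ) j f g →
        eLpNorm g p (weighted δ) ≤ C * eLpNorm f p (weighted δ) := by
  obtain ⟨C, hC, hb⟩ := id h
  refine ⟨C, hC, fun j f g hfg => ?_⟩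
  obtain ⟨φ, hφ⟩ := exists_schwartz_tendsto hδ hp hpt hfg.1
  exact le_of_tendsto_of_tendsto'
    (tendsto_eLpNorm_of_sub hp (fun n => h.memLp hδ j (φ n)) hfg.2.1 (hfg.2.2 φ hφ))
    (ENNReal.Tendsto.const_mul (tendsto_eLpNorm_of_sub hp
      (fun n => memLp_schwartz_weighted hδ p (φ n)) hfg.1 hφ) (Or.inr hC)) (fun n => hb j (φ n))

theorem eLpNorm_prod_rpow {μ : Measure ℝ} {ν : Measure E3} [SFinite ν] (h0 : p ≠ 0) (hpt : p ≠ ∞)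
    {f : ℝ × E3 → ℝ} (hf : AEStronglyMeasurable f (μ.prod ν)) :
    eLpNorm f p (μ.prod ν) ^ p.toReal
      = ∫⁻ t, eLpNorm (fun x => f (t, x)) p ν ^ p.toReal ∂μ := by
  have hp : 0 < p.toReal := ENNReal.toReal_pos h0 hpt
  simp only [eLpNorm_eq_lintegral_rpow_enorm_toReal h0 hpt, ← ENNReal.rpow_mul,
    one_div_mul_cancel hp.ne', ENNReal.rpow_one]
  exact lintegral_prod _ (hf.enorm.pow_const _)

/-- Convergence to zero in `L^p` of a product space implies the convergence to zero of the norms of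
almost all the slices, along a subsequence. -/
theorem exists_subseq_ae_tendsto_slice {μ : Measure ℝ} {ν : Measure E3} [SFinite ν] (h0 : p ≠ 0)
    (hpt : p ≠ ∞) {H : ℕ → ℝ × E3 → ℝ} (hH : ∀ n, AEStronglyMeasurable (H n) (μ.prod ν))
    (h : Tendsto (fun n => eLpNorm (H n) p (μ.prod ν)) atTop (𝓝 0)) :
    ∃ ns : ℕ → ℕ, StrictMono ns ∧ ∀ᵐ t ∂μ,
      Tendsto (fun k => eLpNorm (fun x => H (ns k) (t, x)) p ν) atTop (𝓝 0) := by
  have hp : 0 < p.toReal := ENNReal.toReal_pos h0 hpt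
  have h1 : Tendsto (fun n => eLpNorm (H n) p (μ.prod ν) ^ p.toReal) atTop (𝓝 0) := by
    have := (ENNReal.continuous_rpow_const (y := p.toReal)).tendsto 0 |>.comp h
    rwa [ENNReal.zero_rpow_of_pos hp] at this
  obtain ⟨ns, hns, hle⟩ := extraction_forall_of_eventually
    (P := fun k n => eLpNorm (H n) p (μ.prod ν) ^ p.toReal ≤ (2⁻¹ : ℝ≥0∞) ^ k) fun k =>
    h1.eventually_le_const (ENNReal.pow_pos (by simp) k)
  refine ⟨ns, hns, ?_⟩
  have hm : ∀ k, AEMeasurable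
      (fun t => eLpNorm (fun x => H (ns k) (t, x)) p ν ^ p.toReal) μ := fun k => by
    simp only [eLpNorm_eq_lintegral_rpow_enorm_toReal h0 hpt, ← ENNReal.rpow_mul,
      one_div_mul_cancel hp.ne', ENNReal.rpow_one]
    exact ((hH (ns k)).enorm.pow_const _).lintegral_prod_right'
  have hfin : ∫⁻ t, ∑' k, eLpNorm (fun x => H (ns k) (t, x)) p ν ^ p.toReal ∂μ ≠ ∞ := by
    rw [lintegral_tsum hm]
    refine ne_top_of_le_ne_top ?_ (ENNReal.tsum_le_tsum fun k =>
      (eLpNorm_prod_rpow h0 hpt (hH (ns k))).symm.le.trans (hle k))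
    rw [ENNReal.tsum_geometric]
    simp
  filter_upwards [ae_lt_top' (AEMeasurable.tsum hm) hfin] with t ht
  have h2 := ENNReal.tendsto_atTop_zero_of_tsum_ne_top ht.ne
  have h3 := (ENNReal.continuous_rpow_const (y := p.toReal⁻¹)).tendsto 0 |>.comp h2
  rw [ENNReal.zero_rpow_of_pos (inv_pos.2 hp)] at h3
  refine h3.congr fun k => ?_
  simp only [Function.comp_apply]
  rw [← ENNReal.rpow_mul, mul_inv_cancel₀ hp.ne', ENNReal.rpow_one]

theorem isClosedEmbedding_prodMk (t : ℝ) : IsClosedEmbedding (Prod.mk t : E3 → ℝ × E3) := by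
  refine ⟨isEmbedding_prodMkRight t, ?_⟩
  have : range (Prod.mk t : E3 → ℝ × E3) = Prod.fst ⁻¹' {t} := by
    ext ⟨s, x⟩; simp [eq_comm]
  rw [this]
  exact isClosed_singleton.preimage continuous_fst

/-- The restriction of a test function in space-time to a time slice. -/
noncomputable def slice {Φ : ℝ × E3 → ℝ} (hΦ : HasCompactSupport Φ)
    (hs : ContDiff ℝ (⊤ : ℕ∞) Φ) (t : ℝ) : 𝓢(E3, ℝ) :=
  HasCompactSupport.toSchwartzMap (f := fun x => Φ (t, x))
    (hΦ.comp_isClosedEmbedding ((isClosedEmbedding_prodMk t)))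
    (hs.comp (contDiff_const.prodMk contDiff_id))

/-- The Riesz transforms of the slices are jointly measurable, as parametric integrals. -/
theorem measurable_rieszSchwartz_slice {Φ : ℝ × E3 → ℝ} (hΦ : HasCompactSupport Φ)
    (hs : ContDiff ℝ (⊤ : ℕ∞) Φ) (j : Fin 3) :
    StronglyMeasurable fun z : ℝ × E3 => rieszSchwartz j (slice hΦ hs z.1) z.2 := by
  obtain ⟨A, hA⟩ : ∃ A : ℝ × E3 → ℂ,
      A = fun w => 𝓕 (fun y : E3 => ((Φ (w.1, y) : ℝ) : ℂ)) w.2 := ⟨_, rfl⟩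
  have h1 : StronglyMeasurable A := by
    rw [hA]
    simp only [Real.fourier_eq']
    refine StronglyMeasurable.integral_prod_right (f := fun (w : ℝ × E3) (y : E3) =>
      Complex.exp (↑(-2 * Real.pi * inner ℝ y w.2) * Complex.I) • ((Φ (w.1, y) : ℝ) : ℂ)) ?_
    have := hs.continuous
    exact (by fun_prop : Continuous fun z : (ℝ × E3) × E3 =>
      Complex.exp (↑(-2 * Real.pi * inner ℝ z.2 z.1.2) * Complex.I) •
        ((Φ (z.1.1, z.2) : ℝ) : ℂ)).stronglyMeasurable
  have hr : (fun z : ℝ × E3 => rieszSchwartz j (slice hΦ hs z.1) z.2) = fun z : ℝ × E3 =>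
      (∫ ξ, Complex.exp (↑(2 * Real.pi * inner ℝ ξ z.2) * Complex.I) •
        (rieszSymbol j ξ * A (z.1, ξ))).re := by
    funext z
    rw [hA, ← Real.fourierInv_eq']
    rfl
  rw [hr]
  refine Complex.continuous_re.comp_stronglyMeasurable
    (StronglyMeasurable.integral_prod_right (f := fun (z : ℝ × E3) (ξ : E3) =>
      Complex.exp (↑(2 * Real.pi * inner ℝ ξ z.2) * Complex.I) •
        (rieszSymbol j ξ * A (z.1, ξ))) ?_)
  have hc : Continuous fun z : (ℝ × E3) × E3 =>
    Complex.exp (↑(2 * Real.pi * inner ℝ z.2 z.1.2) * Complex.I) := by fun_prop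
  have hm : Measurable fun z : (ℝ × E3) × E3 => (z.1.1, z.2) := by fun_prop
  have hR : StronglyMeasurable fun z : (ℝ × E3) × E3 => rieszSymbol j z.2 :=
    ((measurable_rieszSymbol j).comp measurable_snd).stronglyMeasurable
  exact hc.stronglyMeasurable.smul (hR.mul (h1.comp_measurable hm))

/-- The Riesz transform of a function of space-time can be taken slice by slice, with a jointly
measurable result. -/
theorem RieszBounded.exists_isRieszTransform_slice (hδ : 0 ≤ δ) (hp : 1 ≤ p) (hpt : p ≠ ∞)
    (h : RieszBounded p δ) (j : Fin 3) {I : Set ℝ} {f : ℝ → E3 → ℝ}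
    (hf : MemLp (Function.uncurry f) p ((volume.restrict I).prod (weighted δ))) :
    ∃ g : ℝ → E3 → ℝ, MemLp (Function.uncurry g) p ((volume.restrict I).prod (weighted δ)) ∧
      ∀ᵐ t ∂(volume.restrict I), IsRieszTransform p (weighted δ) j (f t) (g t) := by
  have hp0 : p ≠ 0 := (one_pos.trans_le hp).ne'
  have hpp : 0 < p.toReal := ENNReal.toReal_pos hp0 hpt
  obtain ⟨C, hC, hb⟩ := id h
  have := isFiniteMeasureOnCompacts_weighted hδ
  set ν := (volume.restrict I).prod (weighted δ) with hν
  have hνv : ν ≤ (volume : Measure (ℝ × E3)) := by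
    rw [hν, Measure.volume_eq_prod]
    exact Measure.prod_mono Measure.restrict_le_self (weighted_le_volume hδ)
  have : IsFiniteMeasureOnCompacts ν := ⟨fun K hK => (hνv K).trans_lt hK.measure_lt_top⟩
  -- approximation by smooth functions of compact support in space-time, whose slices are Schwartz
  have happ : ∀ n : ℕ, ∃ Φ : ℝ × E3 → ℝ, HasCompactSupport Φ ∧ ContDiff ℝ (⊤ : ℕ∞) Φ ∧
      eLpNorm (fun z => Φ z - f z.1 z.2) p ν ≤ ENNReal.ofReal ((1 / 2) ^ n) := fun n => by
    obtain ⟨Φ, h1, h2, h3⟩ := hf.exist_eLpNorm_sub_le hpt hp (ε := (1 / 2) ^ n) (by positivity)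
    rw [eLpNorm_sub_comm] at h3
    exact ⟨Φ, h1, h2, h3⟩
  choose Φ hΦ hs hle using happ
  let G : ℕ → ℝ × E3 → ℝ := fun n z => rieszSchwartz j (slice (hΦ n) (hs n) z.1) z.2
  have hGm : ∀ n, AEStronglyMeasurable (G n) ν := fun n =>
    (measurable_rieszSchwartz_slice (hΦ n) (hs n) j).aestronglyMeasurable
  have hΦm : ∀ n, AEStronglyMeasurable (Φ n) ν := fun n => (hs n).continuous.aestronglyMeasurable
  have hmono : ∀ {A B : ℝ × E3 → ℝ}, AEStronglyMeasurable A ν → AEStronglyMeasurable B ν →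
      (∀ t, eLpNorm (fun x => A (t, x)) p (weighted δ)
        ≤ C * eLpNorm (fun x => B (t, x)) p (weighted δ)) →
      eLpNorm A p ν ≤ C * eLpNorm B p ν := by
    intro A B hA hB hAB
    rw [← ENNReal.rpow_le_rpow_iff hpp, ENNReal.mul_rpow_of_nonneg _ _ hpp.le,
      eLpNorm_prod_rpow hp0 hpt hA, eLpNorm_prod_rpow hp0 hpt hB,
      ← lintegral_const_mul' _ _ (ENNReal.rpow_ne_top_of_nonneg hpp.le hC)]
    refine lintegral_mono fun t => ?_
    rw [← ENNReal.mul_rpow_of_nonneg _ _ hpp.le]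
    gcongr
    exact hAB t
  have hGb : ∀ n, eLpNorm (G n) p ν ≤ C * eLpNorm (Φ n) p ν := fun n =>
    hmono (hGm n) (hΦm n) fun t => hb j (slice (hΦ n) (hs n) t)
  -- the Riesz transforms of the approximations form a Cauchy sequence
  have hGd : ∀ n m, eLpNorm (G n - G m) p ν ≤ C * eLpNorm (Φ n - Φ m) p ν := fun n m =>
    hmono ((hGm n).sub (hGm m)) ((hΦm n).sub (hΦm m)) fun t => by
      have := hb j (slice (hΦ n) (hs n) t - slice (hΦ m) (hs m) t)
      have e : rieszSchwartz j (slice (hΦ n) (hs n) t - slice (hΦ m) (hs m) t)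
          = fun x => (G n - G m) (t, x) := funext fun x => rieszSchwartz_sub j _ _ x
      rw [e] at this
      exact this
  have hfm := hf.1
  have hΦL : ∀ n, MemLp (Φ n) p ν := fun n => (hs n).continuous.memLp_of_hasCompactSupport (hΦ n)
  have hGL : ∀ n, MemLp (G n) p ν := fun n => ⟨hGm n, (hGb n).trans_lt
    (ENNReal.mul_lt_top hC.lt_top (hΦL n).2)⟩
  have hΦd : ∀ N n m, N ≤ n → N ≤ m → eLpNorm (Φ n - Φ m) p ν
      ≤ ENNReal.ofReal (2 * (1 / 2) ^ N) := fun N n m hn hm => by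
    have e : Φ n - Φ m = (fun z => Φ n z - f z.1 z.2) - fun z => Φ m z - f z.1 z.2 := by
      funext z; simp
    rw [e]
    refine (eLpNorm_sub_le ((hΦm n).sub hfm) ((hΦm m).sub hfm) hp).trans ?_
    rw [two_mul, ENNReal.ofReal_add (by positivity) (by positivity)]
    refine add_le_add ((hle n).trans ?_) ((hle m).trans ?_) <;>
    exact ENNReal.ofReal_le_ofReal (pow_le_pow_of_le_one (by norm_num) (by norm_num) ‹_›)
  obtain ⟨g, hg, hlim⟩ := Lp.cauchy_complete_eLpNorm hp hGL
    (B := fun N => ENNReal.ofReal ((2 * C.toReal + 1) * (1 / 2) ^ N)) (by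
      rw [← ENNReal.ofReal_tsum_of_nonneg]
      · exact ENNReal.ofReal_ne_top
      · intro n; positivity
      · exact (summable_geometric_of_lt_one (by norm_num) (by norm_num)).mul_left _)
    (fun N n m hn hm => by
      calc eLpNorm (G n - G m) p ν ≤ C * ENNReal.ofReal (2 * (1 / 2) ^ N) :=
            (hGd n m).trans (by gcongr; exact hΦd N n m hn hm)
        _ = ENNReal.ofReal (2 * C.toReal * (1 / 2) ^ N) := by
            conv_lhs => rw [← ENNReal.ofReal_toReal hC]
            rw [← ENNReal.ofReal_mul ENNReal.toReal_nonneg]; congr 1; ring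
        _ < _ := by
            rw [ENNReal.ofReal_lt_ofReal_iff (by positivity)]
            have : (0 : ℝ) < (1 / 2) ^ N := by positivity
            nlinarith)
  have hΦlim : Tendsto (fun n => eLpNorm (fun z => Φ n z - f z.1 z.2) p ν) atTop (𝓝 0) := by
    refine tendsto_of_tendsto_of_tendsto_of_le_of_le tendsto_const_nhds ?_ (fun _ => zero_le) hle
    have := ENNReal.tendsto_ofReal (tendsto_pow_atTop_nhds_zero_of_lt_one (r := (1 / 2 : ℝ))
      (by norm_num) (by norm_num))
    simpa using this
  obtain ⟨ns, hns, h1⟩ := exists_subseq_ae_tendsto_slice hp0 hpt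
    (fun n => (hΦm n).sub hfm) hΦlim
  obtain ⟨ms, hms, h2⟩ := exists_subseq_ae_tendsto_slice hp0 hpt
    (fun n => (hGm (ns n)).sub hg.1) (hlim.comp hns.tendsto_atTop)
  have hslice : ∀ {A : ℝ × E3 → ℝ}, MemLp A p ν →
      ∀ᵐ t ∂(volume.restrict I), MemLp (fun x => A (t, x)) p (weighted δ) := by
    intro A hA
    have hfin : ∫⁻ t in I, eLpNorm (fun x => A (t, x)) p (weighted δ) ^ p.toReal ≠ ∞ := by
      rw [← eLpNorm_prod_rpow hp0 hpt hA.1]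
      exact ENNReal.rpow_ne_top_of_nonneg hpp.le hA.2.ne
    have hm : AEMeasurable (fun t => eLpNorm (fun x => A (t, x)) p (weighted δ) ^ p.toReal)
        (volume.restrict I) := by
      simp only [eLpNorm_eq_lintegral_rpow_enorm_toReal hp0 hpt, ← ENNReal.rpow_mul,
        one_div_mul_cancel hpp.ne', ENNReal.rpow_one]
      exact (hA.1.enorm.pow_const _).lintegral_prod_right'
    filter_upwards [hA.1.prodMk_left, ae_lt_top' hm hfin] with t h1 h2
    exact ⟨h1, (ENNReal.rpow_lt_top_iff_of_pos hpp).1 h2⟩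
  refine ⟨fun t x => g (t, x), hg, ?_⟩
  filter_upwards [h1, h2, hslice hf, hslice hg] with t ht1 ht2 ht3 ht4
  exact h.isRieszTransform hδ hp ht3 ht4
    (φ := fun k => slice (hΦ (ns (ms k))) (hs (ns (ms k))) t)
    (ht1.comp hms.tendsto_atTop) ht2

end RieszExtension

/-! ### The Laplacian of `R_i R_j f` -/

section RieszDuality

open ComplexConjugate

/-- The Laplacian of a Schwartz function. -/
noncomputable def lap (ψ : 𝓢(E3, ℝ)) : 𝓢(E3, ℝ) := ∑ k, ∂_{e k} (∂_{e k} ψ)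

theorem complexify_lineDeriv (m : E3) (φ : 𝓢(E3, ℝ)) :
    complexify (∂_{m} φ) = ∂_{m} (complexify φ) := by
  ext x
  rw [complexify_apply, SchwartzMap.lineDerivOp_apply_eq_fderiv,
    SchwartzMap.lineDerivOp_apply_eq_fderiv]
  have h : HasFDerivAt (complexify φ) (Complex.ofRealCLM.comp (fderiv ℝ φ x)) x :=
    Complex.ofRealCLM.hasFDerivAt.comp x φ.differentiableAt.hasFDerivAt
  rw [h.fderiv]; rfl

theorem hat_lineDeriv (k : Fin 3) (φ : 𝓢(E3, ℝ)) (ξ : E3) :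
    hat (∂_{e k} φ) ξ = 2 * Real.pi * Complex.I * ξ k * hat φ ξ := by
  rw [hat, complexify_lineDeriv, SchwartzMap.fourier_lineDerivOp_eq, smul_apply,
    SchwartzMap.smulLeftCLM_apply_apply (by fun_prop), inner_e_right, hat,
    smul_eq_mul, Complex.real_smul]
  ring

theorem hat_add (φ ψ : 𝓢(E3, ℝ)) : hat (φ + ψ) = hat φ + hat ψ :=
  (congrArg (fun f : 𝓢(E3, ℂ) => 𝓕 f) (map_add (SchwartzMap.postcompCLM Complex.ofRealCLM)
    φ ψ)).trans (map_add (FourierTransform.fourierCLM ℂ 𝓢(E3, ℂ)) (complexify φ) (complexify ψ))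

theorem hat_lap (ψ : 𝓢(E3, ℝ)) (ξ : E3) :
    hat (lap ψ) ξ = -(4 * Real.pi ^ 2 * ‖ξ‖ ^ 2) * hat ψ ξ := by
  have h : (‖ξ‖ : ℂ) ^ 2 = ξ 0 ^ 2 + ξ 1 ^ 2 + ξ 2 ^ 2 := by
    have := EuclideanSpace.real_norm_sq_eq ξ
    rw [Fin.sum_univ_three] at this
    exact_mod_cast this
  rw [lap, Fin.sum_univ_three, hat_add, hat_add, _root_.add_apply, _root_.add_apply, h]
  simp only [hat_lineDeriv]
  linear_combination (4 * Real.pi ^ 2 * (ξ 0 ^ 2 + ξ 1 ^ 2 + ξ 2 ^ 2) * hat ψ ξ) * Complex.I_sq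

/-- The identity `R_i R_j Δ = -∂_i ∂_j`, in a weak form: the function `R_j f` need not be a
Schwartz function, so that the second Riesz transform is put on the test function. -/
theorem integral_rieszSchwartz_mul_rieszSchwartz_lap (i j : Fin 3) (f ψ : 𝓢(E3, ℝ)) :
    ∫ x, rieszSchwartz j f x * rieszSchwartz i (lap ψ) x = ∫ x, f x * ∂_{e i} (∂_{e j} ψ) x := by
  have h1 := integral_conj_fourierInv_mul (integrable_rieszFourier j f) (memLp_rieszFourier j f 2)
    (integrable_rieszFourier i (lap ψ)) (memLp_rieszFourier i (lap ψ) 2)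
  have h2 := integral_conj_fourierInv_mul (hat f).integrable ((hat f).memLp 2)
    (hat (∂_{e i} (∂_{e j} ψ))).integrable ((hat (∂_{e i} (∂_{e j} ψ))).memLp 2)
  simp only [fourierInv_hat, ← ofReal_rieszSchwartz, Complex.conj_ofReal] at h1 h2
  have h3 : ∀ ξ, conj (rieszFourier j f ξ) * rieszFourier i (lap ψ) ξ
      = conj (hat f ξ) * hat (∂_{e i} (∂_{e j} ψ)) ξ := by
    intro ξ
    simp only [rieszFourier, map_mul, conj_rieszSymbol, hat_lap, hat_lineDeriv]
    rcases eq_or_ne ξ 0 with rfl | hξ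
    · simp [rieszSymbol]
    · have : (‖ξ‖ : ℂ) ≠ 0 := by exact_mod_cast norm_ne_zero_iff.2 hξ
      simp only [rieszSymbol, Complex.ofReal_div]
      field_simp
      ring
  rw [integral_congr_ae (ae_of_all _ h3), ← h2] at h1
  simp only [← Complex.ofReal_mul] at h1
  rw [integral_complex_ofReal, integral_complex_ofReal] at h1
  exact Complex.ofReal_injective h1

variable {p : ℝ≥0∞} {δ : ℝ}

/-- Norms in `L^p_{w_δ}` control integrals over compact sets. -/
theorem exists_eLpNorm_one_restrict_le (hδ : 0 ≤ δ) (hp : 1 ≤ p) (hpt : p ≠ ∞) {K : Set E3}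
    (hK : IsCompact K) : ∃ C : ℝ≥0∞, C ≠ ∞ ∧ ∀ f : E3 → ℝ, AEStronglyMeasurable f volume →
      eLpNorm f 1 (volume.restrict K) ≤ C * eLpNorm f p (weighted δ) := by
  obtain ⟨R, hR⟩ := hK.isBounded.exists_norm_le
  have hR0 : 0 < 1 + |R| := by positivity
  set c : ℝ := (1 + |R|) ^ δ with hc
  have hc0 : 0 < c := Real.rpow_pos_of_pos hR0 _
  have hle : volume.restrict K ≤ ENNReal.ofReal c • weighted δ := by
    have h1 : (volume.withDensity fun x : E3 =>
        ENNReal.ofReal ((1 + ‖x‖) ^ (-δ))).restrict K ≤ weighted δ :=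
      Measure.restrict_le_self
    rw [restrict_withDensity hK.measurableSet] at h1
    have h2 : volume.restrict K ≤ ENNReal.ofReal c •
        (volume.restrict K).withDensity fun x : E3 => ENNReal.ofReal ((1 + ‖x‖) ^ (-δ)) := by
      rw [← withDensity_smul _ (by fun_prop)]
      conv_lhs => rw [← withDensity_one (μ := volume.restrict K)]
      refine withDensity_mono ?_
      filter_upwards [ae_restrict_mem hK.measurableSet] with x hx
      rw [Pi.one_apply, Pi.smul_apply, smul_eq_mul, ← ENNReal.ofReal_mul hc0.le,
        ENNReal.one_le_ofReal, hc, Real.rpow_neg (by positivity), ← div_eq_mul_inv,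
        one_le_div (by positivity)]
      gcongr
      exact (hR x hx).trans (le_abs_self R)
    refine h2.trans ?_
    intro s
    simp only [Measure.smul_apply]
    gcongr
  refine ⟨ENNReal.ofReal c ^ (1 / p).toReal *
      volume.restrict K univ ^ (1 / (1 : ℝ≥0∞).toReal - 1 / p.toReal),
    ENNReal.mul_ne_top (ENNReal.rpow_ne_top_of_nonneg (by positivity) ENNReal.ofReal_ne_top)
    (ENNReal.rpow_ne_top_of_nonneg ?_ ?_), fun f hf => ?_⟩
  · have : 1 ≤ p.toReal := by
      rw [← ENNReal.toReal_one]; exact ENNReal.toReal_mono hpt hp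
    rw [ENNReal.toReal_one, sub_nonneg]
    gcongr
  · rw [Measure.restrict_apply_univ]; exact hK.measure_lt_top.ne
  calc eLpNorm f 1 (volume.restrict K)
      ≤ eLpNorm f p (volume.restrict K) *
        volume.restrict K univ ^ (1 / (1 : ℝ≥0∞).toReal - 1 / p.toReal) :=
        eLpNorm_le_eLpNorm_mul_rpow_measure_univ hp hf.restrict
    _ ≤ eLpNorm f p (ENNReal.ofReal c • weighted δ) *
        volume.restrict K univ ^ (1 / (1 : ℝ≥0∞).toReal - 1 / p.toReal) := by
        gcongr
    _ = _ := by rw [eLpNorm_smul_measure_of_ne_top hpt, smul_eq_mul]; ring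

/-- Absolute continuity: measurability for the weighted measure and for the Lebesgue measure are
the same. -/
theorem volume_absolutelyContinuous_weighted (δ : ℝ) : (volume : Measure E3) ≪ weighted δ := by
  refine withDensity_absolutelyContinuous' (by fun_prop) (ae_of_all _ fun x => ?_)
  have : 0 < (1 + ‖x‖) ^ (-δ) := by positivity
  simpa using this

theorem tendsto_integral_mul_of_tendsto_eLpNorm (hδ : 0 ≤ δ) (hp : 1 ≤ p) (hpt : p ≠ ∞)
    {f : ℕ → E3 → ℝ} {g : E3 → ℝ} (hf : ∀ n, MemLp (f n) p (weighted δ))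
    (hg : MemLp g p (weighted δ))
    (h : Tendsto (fun n => eLpNorm (fun x => f n x - g x) p (weighted δ)) atTop (𝓝 0))
    {χ : E3 → ℝ} (hχ : Continuous χ) (hχs : HasCompactSupport χ) :
    Tendsto (fun n => ∫ x, f n x * χ x) atTop (𝓝 (∫ x, g x * χ x)) := by
  obtain ⟨C, hC, hb⟩ := exists_eLpNorm_one_restrict_le hδ hp hpt hχs.isCompact
  obtain ⟨M, hM⟩ := hχs.exists_bound_of_continuous hχ
  have hac := volume_absolutelyContinuous_weighted δ
  have key : ∀ u : E3 → ℝ, MemLp u p (weighted δ) →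
      eLpNorm (fun x => u x * χ x) 1 volume
        ≤ ENNReal.ofReal M * (C * eLpNorm u p (weighted δ)) := fun u hu => by
    calc eLpNorm (fun x => u x * χ x) 1 volume
        ≤ eLpNorm (M • (tsupport χ).indicator u) 1 volume := by
          refine eLpNorm_mono fun x => ?_
          by_cases hx : x ∈ tsupport χ
          · rw [Pi.smul_apply, indicator_of_mem hx, smul_eq_mul, norm_mul, norm_mul, mul_comm]
            gcongr
            exact (hM x).trans (le_abs_self M)
          · rw [image_eq_zero_of_notMem_tsupport hx, mul_zero, norm_zero]
            positivity
      _ ≤ ‖M‖ₑ * eLpNorm ((tsupport χ).indicator u) 1 volume := eLpNorm_const_smul_le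
      _ ≤ _ := by
          have hM0 : 0 ≤ M := (norm_nonneg _).trans (hM 0)
          rw [Real.enorm_of_nonneg hM0,
            eLpNorm_indicator_eq_eLpNorm_restrict hχs.isCompact.measurableSet]
          gcongr
          exact hb u (hu.1.mono_ac hac)
  have hint : ∀ u : E3 → ℝ, MemLp u p (weighted δ) → Integrable fun x => u x * χ x := fun u hu =>
    memLp_one_iff_integrable.1 ⟨(hu.1.mono_ac hac).mul hχ.aestronglyMeasurable,
      (key u hu).trans_lt (ENNReal.mul_lt_top ENNReal.ofReal_lt_top
        (ENNReal.mul_lt_top hC.lt_top hu.2))⟩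
  refine tendsto_integral_of_L1 _ (hint g hg).1 (Eventually.of_forall fun n => hint _ (hf n)) ?_
  have hlim : Tendsto (fun n => ENNReal.ofReal M *
      (C * eLpNorm (fun x => f n x - g x) p (weighted δ))) atTop (𝓝 0) := by
    have := ENNReal.Tendsto.const_mul (a := ENNReal.ofReal M)
      (ENNReal.Tendsto.const_mul h (Or.inr hC)) (Or.inr ENNReal.ofReal_ne_top)
    simpa using this
  refine tendsto_of_tendsto_of_tendsto_of_le_of_le tendsto_const_nhds hlim (fun _ => zero_le)
    fun n => ?_
  have := key _ ((hf n).sub hg)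
  rw [eLpNorm_one_eq_lintegral_enorm] at this
  simp only [Pi.sub_apply, sub_mul] at this
  exact this

theorem tendsto_integral_mul_zero_of_eLpNorm_two {f : ℕ → E3 → ℝ} {g : E3 → ℝ}
    (hf : ∀ n, MemLp (f n) 2 volume) (h : Tendsto (fun n => eLpNorm (f n) 2 volume) atTop (𝓝 0))
    (hg : MemLp g 2 volume) : Tendsto (fun n => ∫ x, f n x * g x) atTop (𝓝 0) := by
  have hlim : Tendsto (fun n => eLpNorm (f n) 2 volume * eLpNorm g 2 volume) atTop (𝓝 0) := by
    have := ENNReal.Tendsto.mul_const h (Or.inr hg.2.ne)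
    simpa using this
  refine tendsto_zero_iff_enorm_tendsto_zero.2 (tendsto_of_tendsto_of_tendsto_of_le_of_le
    tendsto_const_nhds hlim (fun _ => zero_le) fun n => ?_)
  refine (enorm_integral_le_lintegral_enorm _).trans ?_
  rw [← eLpNorm_one_eq_lintegral_enorm]
  exact eLpNorm_smul_le_mul_eLpNorm (p := 2) (q := 2) (r := 1) (f := g) (φ := f n) hg.1 (hf n).1

theorem hasCompactSupport_lineDeriv (m : E3) {θ : 𝓢(E3, ℝ)} (hθ : HasCompactSupport θ) :
    HasCompactSupport (∂_{m} θ : 𝓢(E3, ℝ)) :=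
  hθ.mono' (subset_closure.trans (SchwartzMap.tsupport_lineDerivOp_subset m θ))

theorem hasCompactSupport_lap {ψ : 𝓢(E3, ℝ)} (hψ : HasCompactSupport ψ) :
    HasCompactSupport (lap ψ) := by
  have h (k : Fin 3) := hasCompactSupport_lineDeriv (e k) (hasCompactSupport_lineDeriv (e k) hψ)
  rw [lap, Fin.sum_univ_three]
  exact ((h 0).add (h 1)).add (h 2)

/-- On `L^p_{w_δ}`, the operator `R_i R_j` satisfies `Δ R_i R_j = -∂_i ∂_j`, tested against
smooth functions of compact support. -/
theorem IsRieszRiesz.integral_mul_lap (hδ : 0 ≤ δ) (hp : 1 ≤ p) (hpt : p ≠ ∞)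
    (hb : RieszBounded p δ)
    (h2 : ∃ K : ℝ≥0∞, K ≠ ∞ ∧ ∀ f : E3 → ℝ, AEStronglyMeasurable f volume →
      eLpNorm f p (weighted δ) ≤ K * eLpNorm f 2 volume)
    {i j : Fin 3} {f g : E3 → ℝ} (hfg : IsRieszRiesz p (weighted δ) i j f g) {ψ : 𝓢(E3, ℝ)}
    (hψ : HasCompactSupport ψ) :
    ∫ x, g x * lap ψ x = -∫ x, f x * ∂_{e i} (∂_{e j} ψ) x := by
  obtain ⟨K, hK, h2⟩ := h2
  obtain ⟨u, hu, hg⟩ := hfg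
  obtain ⟨φ, hφ⟩ := exists_schwartz_tendsto hδ hp hpt hu.1
  -- `R_j φ_n` is not a Schwartz function, but it is in `L²`, hence it is approximated in `L²`, and
  -- so in `L^p_{w_δ}`, by a Schwartz function `η_n`
  have happ : ∀ n : ℕ, ∃ η : 𝓢(E3, ℝ),
      eLpNorm (fun x => η x - rieszSchwartz j (φ n) x) 2 volume
        ≤ ENNReal.ofReal (1 / (n + 1)) := fun n => by
    obtain ⟨g, hg, hgs, h⟩ := (memLp_rieszSchwartz_two j (φ n)).exist_eLpNorm_sub_le (by simp)
      (by simp) (ε := 1 / (n + 1)) (by positivity)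
    refine ⟨hg.toSchwartzMap hgs, ?_⟩
    rw [eLpNorm_sub_comm] at h
    exact h
  choose η hη using happ
  have hη0 : Tendsto (fun n => eLpNorm (fun x => η n x - rieszSchwartz j (φ n) x) 2 volume)
      atTop (𝓝 0) := by
    refine tendsto_of_tendsto_of_tendsto_of_le_of_le tendsto_const_nhds ?_ (fun _ => zero_le) hη
    have := ENNReal.tendsto_ofReal (tendsto_one_div_add_atTop_nhds_zero_nat (𝕜 := ℝ))
    simpa using this
  have hηm : ∀ n, AEStronglyMeasurable (fun x => η n x - rieszSchwartz j (φ n) x) volume :=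
    fun n => ((η n).continuous.sub (continuous_rieszSchwartz j (φ n))).aestronglyMeasurable
  have hηu : Tendsto (fun n => eLpNorm (fun x => η n x - u x) p (weighted δ)) atTop (𝓝 0) := by
    have hlim : Tendsto (fun n => K * eLpNorm (fun x => η n x - rieszSchwartz j (φ n) x) 2 volume
        + eLpNorm (fun x => rieszSchwartz j (φ n) x - u x) p (weighted δ)) atTop (𝓝 0) := by
      have := (ENNReal.Tendsto.const_mul hη0 (Or.inr hK)).add (hu.2.2 φ hφ)
      simpa using this
    refine tendsto_of_tendsto_of_tendsto_of_le_of_le tendsto_const_nhds hlim (fun _ => zero_le)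
      fun n => ?_
    have e : (fun x => η n x - u x) = (fun x => η n x - rieszSchwartz j (φ n) x)
        + fun x => rieszSchwartz j (φ n) x - u x := by funext x; simp
    simp only
    rw [e]
    refine (eLpNorm_add_le ?_ ?_ hp).trans ?_
    · exact ((η n).continuous.sub (continuous_rieszSchwartz j (φ n))).aestronglyMeasurable
    · exact (hb.memLp hδ j (φ n)).1.sub hu.2.1.1
    · exact add_le_add (h2 _ (hηm n)) le_rfl
  have l1 := tendsto_integral_mul_of_tendsto_eLpNorm hδ hp hpt (fun n => hb.memLp hδ i (η n))
    hg.2.1 (hg.2.2 η hηu) (lap ψ).continuous (hasCompactSupport_lap hψ)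
  have l2 := tendsto_integral_mul_of_tendsto_eLpNorm hδ hp hpt
    (fun n => memLp_schwartz_weighted hδ p (φ n)) hu.1 hφ
    (∂_{e i} (∂_{e j} ψ) : 𝓢(E3, ℝ)).continuous
    (hasCompactSupport_lineDeriv _ (hasCompactSupport_lineDeriv _ hψ))
  have hL2 : ∀ n, MemLp (fun x => η n x - rieszSchwartz j (φ n) x) 2 volume := fun n =>
    ((η n).memLp 2).sub (memLp_rieszSchwartz_two j (φ n))
  have hRl := memLp_rieszSchwartz_two i (lap ψ)
  have l3 : Tendsto (fun n => ∫ x, (η n x - rieszSchwartz j (φ n) x) * rieszSchwartz i (lap ψ) x)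
      atTop (𝓝 0) :=
    tendsto_integral_mul_zero_of_eLpNorm_two hL2 hη0 hRl
  have e : ∀ n, ∫ x, rieszSchwartz i (η n) x * lap ψ x
      = -(∫ x, (η n x - rieszSchwartz j (φ n) x) * rieszSchwartz i (lap ψ) x)
        - ∫ x, φ n x * ∂_{e i} (∂_{e j} ψ) x := fun n => by
    rw [integral_rieszSchwartz_mul, ← integral_rieszSchwartz_mul_rieszSchwartz_lap]
    have i1 : Integrable fun x => (η n x - rieszSchwartz j (φ n) x) * rieszSchwartz i (lap ψ) x :=
      (hL2 n).integrable_mul hRl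
    have i2 : Integrable fun x => rieszSchwartz j (φ n) x * rieszSchwartz i (lap ψ) x :=
      (memLp_rieszSchwartz_two j (φ n)).integrable_mul hRl
    rw [neg_sub_left, ← integral_add i2 i1, neg_inj]
    refine integral_congr_ae (ae_of_all _ fun x => ?_)
    simp only; ring
  simp only [e] at l1
  have l4 := (l3.neg).sub l2
  rw [neg_zero, zero_sub] at l4
  exact tendsto_nhds_unique l1 l4

/-- Hölder's inequality gives `L² ⊆ L^{6/5}_{w_{6γ/5}}`, since `w_{6γ/5} ^ (5 / 2) = w_{3γ}` is
integrable for `γ > 1`. -/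
theorem exists_eLpNorm_six_fifths_le {γ : ℝ} (hγ : 1 < γ) :
    ∃ K : ℝ≥0∞, K ≠ ∞ ∧ ∀ f : E3 → ℝ, AEStronglyMeasurable f volume →
      eLpNorm f (6 / 5) (weighted (6 * γ / 5)) ≤ K * eLpNorm f 2 volume := by
  have hi : Integrable fun x : E3 => (1 + ‖x‖) ^ (-(3 * γ)) := by
    refine integrable_one_add_norm ?_
    rw [finrank_euclideanSpace, Fintype.card_fin]; push_cast; linarith
  set A := ∫⁻ x : E3, ENNReal.ofReal ((1 + ‖x‖) ^ (-(3 * γ))) with hA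
  have hAt : A ≠ ∞ := hi.lintegral_lt_top.ne
  have hpq : (5 / 2 : ℝ).HolderConjugate (5 / 3) := by
    rw [Real.holderConjugate_iff]; norm_num
  refine ⟨(A ^ (1 / (5 / 2 : ℝ))) ^ (5 / 6 : ℝ), ENNReal.rpow_ne_top_of_nonneg (by norm_num)
    (ENNReal.rpow_ne_top_of_nonneg (by norm_num) hAt), fun f hf => ?_⟩
  have hfm : AEMeasurable (fun x => ‖f x‖ₑ ^ (6 / 5 : ℝ)) volume := hf.enorm.pow_const _
  have h := ENNReal.lintegral_mul_le_Lp_mul_Lq volume hpq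
    (f := fun x : E3 => ENNReal.ofReal ((1 + ‖x‖) ^ (-(6 * γ / 5))))
    (g := fun x => ‖f x‖ₑ ^ (6 / 5 : ℝ)) (by fun_prop) hfm
  have e1 : ∀ x : E3, ENNReal.ofReal ((1 + ‖x‖) ^ (-(6 * γ / 5))) ^ (5 / 2 : ℝ)
      = ENNReal.ofReal ((1 + ‖x‖) ^ (-(3 * γ))) := fun x => by
    rw [ENNReal.ofReal_rpow_of_nonneg (by positivity) (by norm_num),
      ← Real.rpow_mul (by positivity)]
    congr 2; ring
  have e2 : ∀ x : E3, (‖f x‖ₑ ^ (6 / 5 : ℝ)) ^ (5 / 3 : ℝ) = ‖f x‖ₑ ^ (2 : ℝ) := fun x => by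
    rw [← ENNReal.rpow_mul]; norm_num
  simp only [e1, e2, Pi.mul_apply] at h
  rw [eLpNorm_six_fifths_eq, weighted,
    lintegral_withDensity_eq_lintegral_mul₀ (by fun_prop) hfm,
    eLpNorm_eq_lintegral_rpow_enorm_toReal (by simp) (by simp), ENNReal.toReal_ofNat]
  calc _ ≤ (A ^ (1 / (5 / 2 : ℝ)) *
          (∫⁻ x, ‖f x‖ₑ ^ (2 : ℝ)) ^ (1 / (5 / 3 : ℝ))) ^ (5 / 6 : ℝ) := by
        gcongr
        exact h
    _ = _ := by
        rw [ENNReal.mul_rpow_of_nonneg _ _ (by norm_num), ← ENNReal.rpow_mul (lintegral _ _)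
          (1 / (5 / 3 : ℝ))]
        norm_num

end RieszDuality

/-! ### Local integrability in space-time and distributional derivatives -/

section LocalIntegrability

/-- A mixed norm controls the integral over a time interval of finite length, if the norm in space
controls the integral for the measure `ν`. -/
theorem integrable_of_memMixed {V : Type*} [NormedAddCommGroup V] {r p : ℝ≥0∞} {I : Set ℝ}
    {μ ν : Measure E3} [SFinite μ] [SFinite ν] {f : ℝ → E3 → V} (hr : 1 ≤ r) (h0 : p ≠ 0)
    (hpt : p ≠ ∞) (hI : volume I ≠ ∞) (hνμ : ν ≪ μ) {C : ℝ≥0∞} (hC : C ≠ ∞)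
    (h : ∀ g : E3 → V, AEStronglyMeasurable g μ → eLpNorm g 1 ν ≤ C * eLpNorm g p μ)
    (hf : MemMixed r p I μ f) : Integrable (Function.uncurry f) ((volume.restrict I).prod ν) := by
  have hm : AEStronglyMeasurable (Function.uncurry f) ((volume.restrict I).prod ν) :=
    hf.1.mono_ac (Measure.AbsolutelyContinuous.rfl.prod hνμ)
  have hmp : AEMeasurable (fun t => eLpNorm (f t) p μ) (volume.restrict I) := by
    simp only [eLpNorm_eq_lintegral_rpow_enorm_toReal h0 hpt]
    exact (AEMeasurable.lintegral_prod_right' (hf.1.enorm.pow_const _)).pow_const _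
  refine ⟨hm, ?_⟩
  rw [hasFiniteIntegral_iff_enorm, lintegral_prod _ hm.enorm]
  have hfin : ∫⁻ t in I, eLpNorm (f t) p μ < ∞ := by
    have h1 := eLpNorm_le_eLpNorm_mul_rpow_measure_univ (p := 1) (q := r)
      (f := fun t => eLpNorm (f t) p μ) hr hmp.aestronglyMeasurable
    rw [eLpNorm_one_eq_lintegral_enorm] at h1
    simp only [enorm_eq_self] at h1
    refine h1.trans_lt (ENNReal.mul_lt_top hf.2 (ENNReal.rpow_lt_top_of_nonneg ?_ ?_))
    · rw [ENNReal.toReal_one, div_one, sub_nonneg]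
      rcases eq_or_ne r ∞ with rfl | hrt
      · simp
      · have : 1 ≤ r.toReal := by rw [← ENNReal.toReal_one]; exact ENNReal.toReal_mono hrt hr
        exact div_le_one_of_le₀ this (by positivity)
    · rwa [Measure.restrict_apply_univ]
  refine lt_of_le_of_lt (lintegral_mono_ae ?_)
    (lt_of_eq_of_lt (lintegral_const_mul' C _ hC) (ENNReal.mul_lt_top hC.lt_top hfin))
  filter_upwards [hf.1.prodMk_left] with t ht
  have := h (f t) ht
  rwa [eLpNorm_one_eq_lintegral_enorm] at this

/-- Integrability on bounded subsets of `(0,T) × ℝ³`. -/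
def SlabIntegrable {V : Type*} [NormedAddCommGroup V] (T : ℝ) (f : ℝ → E3 → V) : Prop :=
  ∀ R : ℝ, IntegrableOn (Function.uncurry f) (Ioo 0 T ×ˢ Metric.ball (0 : E3) R)

theorem MemMixedLoc.slabIntegrable {V : Type*} [NormedAddCommGroup V] {r : ℝ≥0∞} (hr : 1 ≤ r)
    {f : ℝ → E3 → V} (hf : MemMixedLoc r 2 f) (T : ℝ) : SlabIntegrable T f := by
  intro R
  rcases le_or_gt T 0 with hT | hT
  · rw [Ioo_eq_empty (by linarith), empty_prod]; exact integrableOn_empty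
  rcases le_or_gt R 0 with hR | hR
  · rw [Metric.ball_eq_empty.2 hR, prod_empty]; exact integrableOn_empty
  have h := integrable_of_memMixed (ν := volume.restrict (Metric.ball (0 : E3) R)) hr (by simp)
    (by simp) (by simp) Measure.AbsolutelyContinuous.rfl
    (C := volume.restrict (Metric.ball (0 : E3) R) univ ^
      (1 / (1 : ℝ≥0∞).toReal - 1 / (2 : ℝ≥0∞).toReal))
    (ENNReal.rpow_ne_top_of_nonneg (by norm_num)
      (by rw [Measure.restrict_apply_univ]; exact measure_ball_lt_top.ne))
    (fun g hg => by
      rw [mul_comm]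
      exact eLpNorm_le_eLpNorm_mul_rpow_measure_univ (by norm_num) hg) (hf T R hT hR)
  rwa [Measure.prod_restrict, ← Measure.volume_eq_prod] at h

theorem MemMixed.slabIntegrable {r p : ℝ≥0∞} {δ T : ℝ} (hδ : 0 ≤ δ) (hr : 1 ≤ r) (hp : 1 ≤ p)
    (hpt : p ≠ ∞) {f : ℝ → E3 → ℝ} (hf : MemMixed r p (Ioo 0 T) (weighted δ) f) :
    SlabIntegrable T f := by
  intro R
  obtain ⟨C, hC, hb⟩ := exists_eLpNorm_one_restrict_le hδ hp hpt
    (isCompact_closedBall (0 : E3) R)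
  have hac := volume_absolutelyContinuous_weighted δ
  have h := integrable_of_memMixed (ν := volume.restrict (Metric.closedBall (0 : E3) R)) hr
    (one_pos.trans_le hp).ne' hpt (by simp)
    (Measure.restrict_le_self.absolutelyContinuous.trans hac) hC
    (fun g hg => hb g (hg.mono_ac hac)) hf
  rw [Measure.prod_restrict, ← Measure.volume_eq_prod] at h
  exact IntegrableOn.mono_set h (prod_mono_right Metric.ball_subset_closedBall)

theorem SlabIntegrable.locallyIntegrableOn {V : Type*} [NormedAddCommGroup V] {T : ℝ}
    {f : ℝ → E3 → V} (hf : SlabIntegrable T f) :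
    LocallyIntegrableOn (Function.uncurry f) (slab T : Set (ℝ × E3)) := by
  rintro ⟨t, x⟩ ⟨ht, -⟩
  refine ⟨Ioo 0 T ×ˢ Metric.ball (0 : E3) (‖x‖ + 1), mem_nhdsWithin_of_mem_nhds
    ((isOpen_Ioo.prod Metric.isOpen_ball).mem_nhds ⟨ht, ?_⟩), hf _⟩
  rw [mem_ball_zero_iff]; linarith

theorem locallyIntegrableOn_halfSpace {V : Type*} [NormedAddCommGroup V]
    {f : ℝ → E3 → V} (hf : ∀ T, SlabIntegrable T f) :
    LocallyIntegrableOn (Function.uncurry f) (halfSpace : Set (ℝ × E3)) := by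
  rintro ⟨t, x⟩ ⟨ht, -⟩
  refine ⟨Ioo 0 (t + 1) ×ˢ Metric.ball (0 : E3) (‖x‖ + 1), mem_nhdsWithin_of_mem_nhds
    ((isOpen_Ioo.prod Metric.isOpen_ball).mem_nhds ⟨⟨ht, by linarith⟩, ?_⟩), hf _ _⟩
  rw [mem_ball_zero_iff]; linarith

theorem SlabIntegrable.ae_locallyIntegrable {V : Type*} [NormedAddCommGroup V] {T : ℝ}
    {f : ℝ → E3 → V} (hf : SlabIntegrable T f) :
    ∀ᵐ t ∂(volume.restrict (Ioo 0 T)), LocallyIntegrable (f t) := by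
  have h : ∀ n : ℕ, ∀ᵐ t ∂(volume.restrict (Ioo 0 T)),
      IntegrableOn (f t) (Metric.ball (0 : E3) n) := fun n => by
    have := hf n
    rw [IntegrableOn, Measure.volume_eq_prod, ← Measure.prod_restrict] at this
    exact this.prod_right_ae
  filter_upwards [ae_all_iff.2 h] with t ht x
  obtain ⟨n, hn⟩ := exists_nat_gt ‖x‖
  exact ⟨Metric.ball 0 n, Metric.isOpen_ball.mem_nhds (by rwa [mem_ball_zero_iff]), ht n⟩

theorem SlabIntegrable.integrable_mul {T : ℝ} {f : ℝ → E3 → ℝ} (hf : SlabIntegrable T f)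
    {Ψ : ℝ × E3 → ℝ} (hΨ : Continuous Ψ) {R M : ℝ} (hM : ∀ z, ‖Ψ z‖ ≤ M)
    (hR : ∀ z, R ≤ ‖z.2‖ → Ψ z = 0) :
    IntegrableOn (fun z : ℝ × E3 => Ψ z * f z.1 z.2) (Ioo 0 T ×ˢ univ) := by
  have h1 : IntegrableOn (fun z : ℝ × E3 => Ψ z * f z.1 z.2) (Ioo 0 T ×ˢ Metric.ball (0 : E3) R) :=
    Integrable.bdd_mul (hf R) hΨ.aestronglyMeasurable (ae_of_all _ hM)
  refine h1.of_forall_sdiff_eq_zero (measurableSet_Ioo.prod MeasurableSet.univ) fun z hz => ?_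
  have : ¬ ‖z.2‖ < R := fun h => hz.2 ⟨hz.1.1, by rwa [mem_ball_zero_iff]⟩
  rw [hR z (not_lt.1 this), zero_mul]

theorem integrableOn_slab_iff {T : ℝ} {f : ℝ × E3 → ℝ} :
    IntegrableOn f (Ioo 0 T ×ˢ univ) ↔
      Integrable f ((volume.restrict (Ioo 0 T)).prod (volume : Measure E3)) := by
  rw [IntegrableOn, Measure.volume_eq_prod, ← Measure.prod_restrict, Measure.restrict_univ]

theorem setIntegral_slab {T : ℝ} {f : ℝ × E3 → ℝ} (hf : IntegrableOn f (Ioo 0 T ×ˢ univ)) :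
    ∫ z in Ioo 0 T ×ˢ univ, f z = ∫ t in Ioo 0 T, ∫ x, f (t, x) := by
  rw [← integral_prod _ (integrableOn_slab_iff.1 hf), Measure.volume_eq_prod,
    ← Measure.prod_restrict, Measure.restrict_univ]

theorem SlabIntegrable.integrableOn_integral_mul {T : ℝ} {f : ℝ → E3 → ℝ} (hf : SlabIntegrable T f)
    {χ : E3 → ℝ} (hχ : Continuous χ) (hχs : HasCompactSupport χ) :
    IntegrableOn (fun t => ∫ x, χ x * f t x) (Ioo 0 T) := by
  obtain ⟨M, hM⟩ := hχs.exists_bound_of_continuous hχ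
  obtain ⟨R, hR⟩ := hχs.isCompact.isBounded.subset_ball (0 : E3)
  have h := hf.integrable_mul (Ψ := fun z => χ z.2) (by fun_prop) (R := R) (fun z => hM z.2)
    fun z hz => image_eq_zero_of_notMem_tsupport fun h => by
      have := hR h
      rw [mem_ball_zero_iff] at this; linarith
  exact (integrableOn_slab_iff.1 h).integral_prod_left

theorem SlabIntegrable.integral_tensor_mul {T : ℝ} {f : ℝ → E3 → ℝ} (hf : SlabIntegrable T f)
    {α : ℝ → ℝ} (hα : Continuous α) (hαc : HasCompactSupport α) (hαs : Function.support α ⊆ Ioo 0 T)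
    {χ : E3 → ℝ} (hχ : Continuous χ) (hχs : HasCompactSupport χ) :
    ∫ z : ℝ × E3, α z.1 * χ z.2 * f z.1 z.2 = ∫ t, α t * ∫ x, χ x * f t x := by
  obtain ⟨M, hM⟩ := hχs.exists_bound_of_continuous hχ
  obtain ⟨N, hN⟩ := hαc.exists_bound_of_continuous hα
  obtain ⟨R, hR⟩ := hχs.isCompact.isBounded.subset_ball (0 : E3)
  have h := hf.integrable_mul (Ψ := fun z => α z.1 * χ z.2) (by fun_prop) (R := R) (M := N * M)
    (fun z => (norm_mul_le _ _).trans (mul_le_mul (hN _) (hM _) (norm_nonneg _)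
      ((norm_nonneg _).trans (hN 0))))
    fun z hz => by
      rw [image_eq_zero_of_notMem_tsupport (f := χ) fun h => ?_, mul_zero]
      have := hR h
      rw [mem_ball_zero_iff] at this; linarith
  have e1 : ∫ t, α t * ∫ x, χ x * f t x = ∫ t in Ioo 0 T, α t * ∫ x, χ x * f t x := by
    refine (setIntegral_eq_integral_of_forall_compl_eq_zero fun t ht => ?_).symm
    rw [Function.notMem_support.1 (mt (fun h => hαs h) ht), zero_mul]
  rw [e1, ← setIntegral_eq_integral_of_forall_compl_eq_zero (s := Ioo 0 T ×ˢ univ),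
    setIntegral_slab h]
  · refine integral_congr_ae (ae_of_all _ fun t => ?_)
    simp only [mul_assoc]
    rw [integral_const_mul]
  · intro z hz
    have : z.1 ∉ Ioo 0 T := fun h => hz ⟨h, mem_univ _⟩
    rw [Function.notMem_support.1 (mt (fun h => hαs h) this), zero_mul, zero_mul]

/-- The tensor product `α(t) φ(x)` as a test function on space-time. -/
noncomputable def tensorTest {Ω : Opens (ℝ × E3)} (α : ℝ → ℝ) (φ : E3 → ℝ)
    (hα : ContDiff ℝ (⊤ : ℕ∞) α) (hαc : HasCompactSupport α) (hφ : ContDiff ℝ (⊤ : ℕ∞) φ)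
    (hφc : HasCompactSupport φ) (hΩ : tsupport α ×ˢ univ ⊆ (Ω : Set (ℝ × E3))) : 𝓓(Ω, ℝ) where
  toFun z := α z.1 * φ z.2
  contDiff' := (hα.comp contDiff_fst).mul (hφ.comp contDiff_snd)
  hasCompactSupport' := by
    refine HasCompactSupport.intro (hαc.isCompact.prod hφc.isCompact) fun z hz => ?_
    rw [mem_prod, not_and_or] at hz
    rcases hz with hz | hz
    · rw [image_eq_zero_of_notMem_tsupport hz, zero_mul]
    · rw [image_eq_zero_of_notMem_tsupport (f := φ) hz, mul_zero]
  tsupport_subset' := by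
    refine (closure_minimal (fun z hz => ?_) ((isClosed_tsupport α).prod isClosed_univ)).trans hΩ
    exact ⟨subset_tsupport α (left_ne_zero_of_mul hz), mem_univ _⟩

theorem toDistr_dx_apply {Ω : Opens (ℝ × E3)} {f : ℝ → E3 → ℝ}
    (hf : LocallyIntegrableOn (Function.uncurry f) (Ω : Set (ℝ × E3))) (k : Fin 3) (Φ : 𝓓(Ω, ℝ)) :
    dx k (toDistr Ω f) Φ = -∫ z : ℝ × E3, (∂_{((0 : ℝ), e k)} Φ : 𝓓(Ω, ℝ)) z * f z.1 z.2 := by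
  rw [dx, Distribution.lineDerivOp_apply_apply, map_neg, toDistr_apply hf]

theorem lineDeriv_testFunction_apply {Ω : Opens (ℝ × E3)} (Φ : 𝓓(Ω, ℝ)) (v z : ℝ × E3) :
    (∂_{v} Φ : 𝓓(Ω, ℝ)) z = fderiv ℝ Φ z v := by
  have h : (∂_{v} Φ : 𝓓(Ω, ℝ)) z = lineDeriv ℝ Φ z v := by
    rw [TestFunction.lineDerivOp_eq_lineDerivCLM (𝕜 := ℝ), TestFunction.lineDerivCLM_apply,
      if_pos (by simp)]
  rw [h]
  exact (Φ.contDiff.differentiable (by simp) z).lineDeriv_eq_fderiv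

/-- The slices of a function with a distributional gradient in space-time satisfy the
integration by parts formula, for a given test function at almost every time. -/
theorem ae_integral_fderiv_mul_eq {f g : ℝ → E3 → ℝ} (hf : ∀ T, SlabIntegrable T f)
    (hg : ∀ T, SlabIntegrable T g) {k : Fin 3}
    (hfg : dx k (toDistr halfSpace f) = toDistr halfSpace g) {φ : E3 → ℝ}
    (hφ : ContDiff ℝ (⊤ : ℕ∞) φ) (hφc : HasCompactSupport φ) :
    ∀ᵐ t ∂(volume.restrict (Ioi 0)),
      ∫ x, fderiv ℝ φ x (e k) * f t x = -∫ x, φ x * g t x := by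
  have hdc : Continuous fun x => fderiv ℝ φ x (e k) :=
    (hφ.continuous_fderiv (by simp)).clm_apply continuous_const
  have hds : HasCompactSupport fun x => fderiv ℝ φ x (e k) := hφc.fderiv_apply ℝ (e k)
  have key := isOpen_Ioi.ae_eq_zero_of_integral_contDiff_smul_eq_zero (U := Ioi (0 : ℝ))
    (μ := volume) (f := fun t => (∫ x, fderiv ℝ φ x (e k) * f t x) + ∫ x, φ x * g t x) ?_ ?_
  · rw [ae_restrict_iff' measurableSet_Ioi]
    filter_upwards [key] with t ht h0
    exact eq_neg_of_add_eq_zero_left (ht h0)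
  · intro t ht
    refine ⟨Ioo 0 (t + 1), mem_nhdsWithin_of_mem_nhds (isOpen_Ioo.mem_nhds ⟨ht, by linarith⟩), ?_⟩
    exact ((hf _).integrableOn_integral_mul hdc hds).add
      ((hg _).integrableOn_integral_mul hφ.continuous hφc)
  · intro α hα hαc hαs
    obtain ⟨R, hR⟩ := hαc.isCompact.isBounded.subset_ball (0 : ℝ)
    have hαT : Function.support α ⊆ Ioo 0 R := fun t ht => by
      have h1 := hαs (subset_tsupport α ht)
      have h2 := hR (subset_tsupport α ht)
      rw [mem_ball_zero_iff] at h2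
      exact ⟨h1, (le_abs_self t).trans_lt h2⟩
    let Φ : 𝓓(halfSpace, ℝ) := tensorTest α φ hα hαc hφ hφc
      (prod_mono_left hαs)
    have h1 : dx k (toDistr halfSpace f) Φ = toDistr halfSpace g Φ := by rw [hfg]
    rw [toDistr_dx_apply (locallyIntegrableOn_halfSpace hf),
      toDistr_apply (locallyIntegrableOn_halfSpace hg)] at h1
    have e1 : ∀ z : ℝ × E3, (∂_{((0 : ℝ), e k)} Φ : 𝓓(halfSpace, ℝ)) z
        = α z.1 * fderiv ℝ φ z.2 (e k) := fun z => by
      rw [lineDeriv_testFunction_apply]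
      have hα1 : HasFDerivAt (fun z : ℝ × E3 => α z.1)
          ((fderiv ℝ α z.1).comp (ContinuousLinearMap.fst ℝ ℝ E3)) z :=
        (hα.differentiable (by simp) z.1).hasFDerivAt.comp z hasFDerivAt_fst
      have hφ1 : HasFDerivAt (fun z : ℝ × E3 => φ z.2)
          ((fderiv ℝ φ z.2).comp (ContinuousLinearMap.snd ℝ ℝ E3)) z :=
        (hφ.differentiable (by simp) z.2).hasFDerivAt.comp z hasFDerivAt_snd
      have h : HasFDerivAt Φ _ z := hα1.mul hφ1
      rw [h.fderiv]
      simp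
    have e2 : ∀ z : ℝ × E3, Φ z = α z.1 * φ z.2 := fun z => rfl
    simp only [e1, e2] at h1
    rw [(hf R).integral_tensor_mul hα.continuous hαc hαT hdc hds,
      (hg R).integral_tensor_mul hα.continuous hαc hαT hφ.continuous hφc] at h1
    have hI : ∀ {w : ℝ → ℝ}, IntegrableOn w (Ioo 0 R) → Integrable fun t => α t * w t := by
      intro w hw
      obtain ⟨N, hN⟩ := hαc.exists_bound_of_continuous hα.continuous
      have : IntegrableOn (fun t => α t * w t) (Ioo 0 R) :=
        Integrable.bdd_mul hw hα.continuous.aestronglyMeasurable (ae_of_all _ hN)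
      refine integrableOn_univ.1 (this.of_forall_sdiff_eq_zero MeasurableSet.univ fun t ht => ?_)
      rw [Function.notMem_support.1 (mt (fun h => hαT h) ht.2), zero_mul]
    simp only [smul_eq_mul, mul_add]
    rw [integral_add (hI ((hf R).integrableOn_integral_mul hdc hds))
      (hI ((hg R).integrableOn_integral_mul hφ.continuous hφc)), ← h1]
    ring

end LocalIntegrability

/-! ### A local Sobolev inequality -/

section Sobolev

open scoped Convolution

/-- A sequence of bumps at the origin, with supports shrinking to a point. -/
noncomputable def mollifierBump (n : ℕ) : ContDiffBump (0 : E3) :=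
  ⟨1 / (2 * (n + 1)), 1 / (n + 1), by positivity, by
    rw [div_lt_div_iff_of_pos_left one_pos (by positivity) (by positivity)]
    have : (0 : ℝ) < n + 1 := by positivity
    linarith⟩

/-- The mollifiers `η_n`. -/
noncomputable def mollifier (n : ℕ) : E3 → ℝ := (mollifierBump n).normed volume

/-- The mollification `η_n * f`. -/
noncomputable def mollify (n : ℕ) (f : E3 → ℝ) : E3 → ℝ :=
  mollifier n ⋆[ContinuousLinearMap.lsmul ℝ ℝ, volume] f

theorem contDiff_mollifier (n : ℕ) : ContDiff ℝ (⊤ : ℕ∞) (mollifier n) :=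
  (mollifierBump n).contDiff_normed

theorem hasCompactSupport_mollifier (n : ℕ) : HasCompactSupport (mollifier n) :=
  (mollifierBump n).hasCompactSupport_normed

theorem mollifier_nonneg (n : ℕ) (x : E3) : 0 ≤ mollifier n x := (mollifierBump n).nonneg_normed x

theorem mollify_apply (n : ℕ) (f : E3 → ℝ) (x : E3) :
    mollify n f x = ∫ y, mollifier n (x - y) * f y := by
  rw [mollify, convolution_lsmul_swap]; rfl

theorem contDiff_mollify (n : ℕ) {f : E3 → ℝ} (hf : LocallyIntegrable f) :
    ContDiff ℝ (⊤ : ℕ∞) (mollify n f) :=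
  (hasCompactSupport_mollifier n).contDiff_convolution_left _ (contDiff_mollifier n) hf

theorem mollifier_sub_eq_zero {n : ℕ} {x y : E3} (h : 1 ≤ ‖x - y‖) : mollifier n (x - y) = 0 := by
  refine Function.notMem_support.1 fun hm => ?_
  rw [mollifier, ContDiffBump.support_normed_eq, mem_ball_zero_iff] at hm
  have h1 : (mollifierBump n).rOut ≤ 1 :=
    div_le_one_of_le₀ (by linarith [(n.cast_nonneg : (0 : ℝ) ≤ n)]) (by positivity)
  linarith

theorem lintegral_mollifier (n : ℕ) (x : E3) :
    ∫⁻ y, ENNReal.ofReal (mollifier n (x - y)) = 1 := by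
  rw [lintegral_sub_left_eq_self (fun y => ENNReal.ofReal (mollifier n y)) x,
    ← ofReal_integral_eq_lintegral_ofReal
      ((contDiff_mollifier n).continuous.integrable_of_hasCompactSupport
        (hasCompactSupport_mollifier n)) (ae_of_all _ (mollifier_nonneg n)), mollifier,
    (mollifierBump n).integral_normed, ENNReal.ofReal_one]

/-- Mollification does not increase the `L²` norm, up to an enlargement of the domain. -/
theorem eLpNorm_mollify_le (n : ℕ) {f : E3 → ℝ} (hf : LocallyIntegrable f) (R : ℝ) :
    eLpNorm (mollify n f) 2 (volume.restrict (Metric.closedBall 0 R))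
      ≤ eLpNorm f 2 (volume.restrict (Metric.ball 0 (R + 1))) := by
  have hmm : ∀ x : E3, Measurable fun y => ENNReal.ofReal (mollifier n (x - y)) := fun x =>
    ((contDiff_mollifier n).continuous.comp (by fun_prop)).measurable.ennreal_ofReal
  have hfm : AEMeasurable (fun y => ‖f y‖ₑ ^ (2 : ℝ)) volume :=
    hf.aestronglyMeasurable.enorm.pow_const _
  have h1 : ∀ x, ‖mollify n f x‖ₑ ^ (2 : ℝ)
      ≤ ∫⁻ y, ENNReal.ofReal (mollifier n (x - y)) * ‖f y‖ₑ ^ (2 : ℝ) := fun x => by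
    have h2 : ‖mollify n f x‖ₑ ≤ ∫⁻ y, ENNReal.ofReal (mollifier n (x - y)) * ‖f y‖ₑ := by
      rw [mollify_apply]
      refine (enorm_integral_le_lintegral_enorm _).trans (le_of_eq (lintegral_congr fun y => ?_))
      rw [enorm_mul, Real.enorm_of_nonneg (mollifier_nonneg n _)]
    have h3 := lintegral_mul_rpow_le (μ := (volume : Measure E3)) (p := 2) (by norm_num)
      (hmm x).aemeasurable hf.aestronglyMeasurable.enorm
    rw [lintegral_mollifier, ENNReal.one_rpow, one_mul] at h3
    exact (ENNReal.rpow_le_rpow h2 (by norm_num)).trans h3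
  rw [eLpNorm_eq_lintegral_rpow_enorm_toReal (by simp) (by simp),
    eLpNorm_eq_lintegral_rpow_enorm_toReal (by simp) (by simp), ENNReal.toReal_ofNat]
  gcongr ?_ ^ _
  have hprod : Measurable fun z : E3 × E3 => ENNReal.ofReal (mollifier n (z.1 - z.2)) :=
    ((contDiff_mollifier n).continuous.comp (by fun_prop)).measurable.ennreal_ofReal
  calc ∫⁻ x in Metric.closedBall 0 R, ‖mollify n f x‖ₑ ^ (2 : ℝ)
      ≤ ∫⁻ x in Metric.closedBall 0 R, ∫⁻ y,
          ENNReal.ofReal (mollifier n (x - y)) * ‖f y‖ₑ ^ (2 : ℝ) := lintegral_mono h1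
    _ = ∫⁻ y, ∫⁻ x in Metric.closedBall 0 R,
          ENNReal.ofReal (mollifier n (x - y)) * ‖f y‖ₑ ^ (2 : ℝ) := by
        refine lintegral_lintegral_swap (f := fun x y =>
          ENNReal.ofReal (mollifier n (x - y)) * ‖f y‖ₑ ^ (2 : ℝ)) ?_
        exact hprod.aemeasurable.mul hfm.comp_snd
    _ ≤ ∫⁻ y, (Metric.ball 0 (R + 1)).indicator (fun y => ‖f y‖ₑ ^ (2 : ℝ)) y := by
        refine lintegral_mono fun y => ?_
        by_cases hy : y ∈ Metric.ball 0 (R + 1)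
        · rw [indicator_of_mem hy, lintegral_mul_const']
          · refine mul_le_of_le_one_left zero_le ?_
            refine (lintegral_mono' Measure.restrict_le_self le_rfl).trans (le_of_eq ?_)
            rw [← lintegral_mollifier n 0, lintegral_sub_right_eq_self
              (fun x => ENNReal.ofReal (mollifier n x)) y]
            exact (lintegral_sub_left_eq_self (fun x => ENNReal.ofReal (mollifier n x)) 0).symm
          · exact ENNReal.rpow_ne_top_of_nonneg (by norm_num) enorm_ne_top
        · rw [indicator_of_notMem hy, nonpos_iff_eq_zero]
          refine (setLIntegral_congr_fun (g := fun _ => 0)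
            Metric.isClosed_closedBall.measurableSet fun x hx => ?_).trans lintegral_zero
          rw [mem_closedBall_zero_iff] at hx
          rw [mem_ball_zero_iff, not_lt] at hy
          have : 1 ≤ ‖x - y‖ := by
            have := norm_sub_norm_le y x
            rw [norm_sub_rev] at this; linarith
          simp only [mollifier_sub_eq_zero this, ENNReal.ofReal_zero, zero_mul]
    _ = _ := lintegral_indicator measurableSet_ball _

/-- The integration by parts formula for the translates of the mollifiers, in which `g` plays the
role of `∂_k f`. Only countably many test functions are used, with centers in a dense sequence, so
that for a distributional derivative in space-time the formula holds for all of them at almost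
every time. -/
def IsMollifierDeriv (k : Fin 3) (f g : E3 → ℝ) : Prop :=
  ∀ n m : ℕ, ∫ y, fderiv ℝ (fun y => mollifier n (denseSeq E3 m - y)) y (e k) * f y
    = -∫ y, mollifier n (denseSeq E3 m - y) * g y

/-- The formula extends from the dense sequence of centers to all points by continuity. -/
theorem IsMollifierDeriv.fderiv_mollify {k : Fin 3} {f g : E3 → ℝ} (hf : LocallyIntegrable f)
    (hg : LocallyIntegrable g) (h : IsMollifierDeriv k f g) (n : ℕ) (x : E3) :
    fderiv ℝ (mollify n f) x (e k) = mollify n g x := by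
  have hc := hasCompactSupport_mollifier n
  have hs := contDiff_mollifier n
  have hcont : Continuous fun x => fderiv ℝ (mollify n f) x (e k) :=
    ((contDiff_mollify n hf).continuous_fderiv (by simp)).clm_apply continuous_const
  refine congrFun (Continuous.ext_on (denseRange_denseSeq E3) hcont
    (contDiff_mollify n hg).continuous ?_) x
  rintro _ ⟨m, rfl⟩
  simp only
  set x := denseSeq E3 m with hx
  have h1 := hc.hasFDerivAt_convolution_left (ContinuousLinearMap.lsmul ℝ ℝ)
    (hs.of_le (by simp)) hf x
  have hci : ConvolutionExistsAt (fderiv ℝ (mollifier n)) f x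
      (ContinuousLinearMap.precompL E3 (ContinuousLinearMap.lsmul ℝ ℝ)) volume :=
    (hc.fderiv ℝ).convolutionExists_left _ (hs.continuous_fderiv (by simp)) hf x
  have h2 : fderiv ℝ (mollify n f) x (e k)
      = ∫ y, fderiv ℝ (mollifier n) (x - y) (e k) * f y := by
    have e0 : fderiv ℝ (mollify n f) x = _ := h1.fderiv
    rw [e0, convolution_eq_swap, ContinuousLinearMap.integral_apply]
    · rfl
    · exact hci.integrable_swap
  have h3 : ∀ y, fderiv ℝ (fun y => mollifier n (x - y)) y (e k)
      = -fderiv ℝ (mollifier n) (x - y) (e k) := fun y => by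
    have hd : HasFDerivAt (fun y => mollifier n (x - y))
        ((fderiv ℝ (mollifier n) (x - y)).comp (-ContinuousLinearMap.id ℝ E3)) y :=
      (hs.differentiable (by simp) (x - y)).hasFDerivAt.comp y ((hasFDerivAt_id y).const_sub x)
    rw [hd.fderiv]; simp
  have h4 := h n m
  rw [← hx] at h4
  simp only [h3, neg_mul, integral_neg, neg_inj] at h4
  rw [h2, h4, mollify_apply]

theorem norm_clm_le_sum (L : E3 →L[ℝ] ℝ) : ‖L‖ ≤ ∑ k, ‖L (e k)‖ := by
  refine L.opNorm_le_bound (by positivity) fun x => ?_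
  have hx : x = ∑ k, x k • e k := by
    ext i; simp [e, Fin.sum_univ_three]; fin_cases i <;> simp
  conv_lhs => rw [hx]
  rw [map_sum, Finset.sum_mul]
  refine (norm_sum_le _ _).trans (Finset.sum_le_sum fun k _ => ?_)
  rw [map_smul, norm_smul, mul_comm]
  gcongr
  exact PiLp.norm_apply_le x k

/-- The local Sobolev inequality, for functions whose weak gradient is only known through the
translates of the mollifiers. -/
theorem exists_eLpNorm_six_ball_le : ∃ C : ℝ≥0∞, C ≠ ∞ ∧ ∀ (f : E3 → ℝ) (g : Fin 3 → E3 → ℝ),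
    LocallyIntegrable f → (∀ k, LocallyIntegrable (g k)) → (∀ k, IsMollifierDeriv k f (g k)) →
      eLpNorm f 6 (volume.restrict (Metric.ball 0 1))
        ≤ C * (eLpNorm f 2 (volume.restrict (Metric.ball 0 3))
          + ∑ k, eLpNorm (g k) 2 (volume.restrict (Metric.ball 0 3))) := by
  -- the Sobolev inequality is applied to the mollifications, cut off between the balls of radii `1`
  -- and `2`; mollifying enlarges the domain once more, to the ball of radius `3`
  let χ : ContDiffBump (0 : E3) := ⟨1, 2, one_pos, one_lt_two⟩
  have hχs : ContDiff ℝ (⊤ : ℕ∞) χ := χ.contDiff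
  obtain ⟨M, hM⟩ := (χ.hasCompactSupport.fderiv ℝ).exists_bound_of_continuous
    (hχs.continuous_fderiv (by simp))
  have hM0 : 0 ≤ M := (norm_nonneg _).trans (hM 0)
  set C₀ : ℝ≥0∞ :=
    ((eLpNormLESNormFDerivOfEqInnerConst (volume : Measure E3) (2 : NNReal) : NNReal) : ℝ≥0∞)
    with hC₀
  refine ⟨C₀ * (ENNReal.ofReal M + 1), by finiteness, fun f g hf hg hfg => ?_⟩
  have hn : ∀ n, eLpNorm (mollify n f) 6 (volume.restrict (Metric.ball 0 1))
      ≤ C₀ * (ENNReal.ofReal M + 1) * (eLpNorm f 2 (volume.restrict (Metric.ball 0 3))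
          + ∑ k, eLpNorm (g k) 2 (volume.restrict (Metric.ball 0 3))) := fun n => by
    have hsm := contDiff_mollify n hf
    have hgm := fun k => contDiff_mollify n (hg k)
    have h1 := eLpNorm_le_eLpNorm_fderiv_of_eq_inner (volume : Measure E3)
      (u := fun x => χ x * mollify n f x) (p := 2) (p' := 6)
      ((hχs.mul hsm).of_le (by simp)) χ.hasCompactSupport.mul_right (by norm_num)
      (by rw [finrank_euclideanSpace]; simp)
      (by rw [finrank_euclideanSpace]; norm_num)
    have e6 : ((6 : NNReal) : ℝ≥0∞) = 6 := by norm_num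
    have e2 : ((2 : NNReal) : ℝ≥0∞) = 2 := by norm_num
    rw [e6, e2] at h1
    have hgrad : ∀ x, ‖fderiv ℝ (fun x => χ x * mollify n f x) x‖
        ≤ ‖(Metric.closedBall (0 : E3) 2).indicator
          (fun x => M * ‖mollify n f x‖ + ∑ k, ‖mollify n (g k) x‖) x‖ := fun x => by
      by_cases hx : x ∈ Metric.closedBall (0 : E3) 2
      · rw [indicator_of_mem hx, Real.norm_of_nonneg (by positivity),
          fderiv_fun_mul (hχs.differentiable (by simp) x) (hsm.differentiable (by simp) x)]
        refine (norm_add_le _ _).trans ?_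
        rw [norm_smul, norm_smul, add_comm, mul_comm]
        refine add_le_add (mul_le_mul_of_nonneg_right (hM x) (norm_nonneg _)) ?_
        refine (mul_le_of_le_one_left (norm_nonneg _) ?_).trans ((norm_clm_le_sum _).trans ?_)
        · rw [Real.norm_of_nonneg χ.nonneg]; exact χ.le_one
        · exact Finset.sum_le_sum fun k _ => by rw [(hfg k).fderiv_mollify hf (hg k)]
      · have : fderiv ℝ (fun x => χ x * mollify n f x) x = 0 := by
          refine image_eq_zero_of_notMem_tsupport (f := fderiv ℝ fun x => χ x * mollify n f x)
            fun h => hx ?_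
          have h2 := tsupport_mul_subset_left (tsupport_fderiv_subset ℝ h)
          rwa [χ.tsupport_eq] at h2
        rw [this, norm_zero]; positivity
    have hA : AEStronglyMeasurable (fun x => M * ‖mollify n f x‖)
        (volume.restrict (Metric.closedBall (0 : E3) 2)) :=
      (continuous_const.mul hsm.continuous.norm).aestronglyMeasurable
    have hB : ∀ k, AEStronglyMeasurable (fun x => ‖mollify n (g k) x‖)
        (volume.restrict (Metric.closedBall (0 : E3) 2)) := fun k =>
      (hgm k).continuous.norm.aestronglyMeasurable
    have e3 : (2 : ℝ) + 1 = 3 := by norm_num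
    have hmf := eLpNorm_mollify_le n hf 2
    have hmg := fun k => eLpNorm_mollify_le n (hg k) 2
    rw [e3] at hmf
    simp only [e3] at hmg
    calc eLpNorm (mollify n f) 6 (volume.restrict (Metric.ball 0 1))
        = eLpNorm (fun x => χ x * mollify n f x) 6 (volume.restrict (Metric.ball 0 1)) := by
          refine eLpNorm_congr_ae ?_
          filter_upwards [ae_restrict_mem measurableSet_ball] with x hx
          rw [χ.one_of_mem_closedBall (Metric.ball_subset_closedBall hx), one_mul]
      _ ≤ eLpNorm (fun x => χ x * mollify n f x) 6 volume :=
          eLpNorm_mono_measure _ Measure.restrict_le_self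
      _ ≤ C₀ * eLpNorm (fderiv ℝ fun x => χ x * mollify n f x) 2 volume := h1
      _ ≤ C₀ * eLpNorm (fun x => M * ‖mollify n f x‖ + ∑ k, ‖mollify n (g k) x‖) 2
            (volume.restrict (Metric.closedBall (0 : E3) 2)) := by
          gcongr
          rw [← eLpNorm_indicator_eq_eLpNorm_restrict Metric.isClosed_closedBall.measurableSet]
          exact eLpNorm_mono hgrad
      _ ≤ C₀ * (ENNReal.ofReal M * eLpNorm f 2 (volume.restrict (Metric.ball 0 3))
          + ∑ k, eLpNorm (g k) 2 (volume.restrict (Metric.ball 0 3))) := by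
          gcongr
          have hsum : (fun x => ∑ k, ‖mollify n (g k) x‖) = ∑ k, fun x => ‖mollify n (g k) x‖ := by
            funext x; simp
          refine (eLpNorm_add_le (f := fun x => M * ‖mollify n f x‖)
            (g := fun x => ∑ k, ‖mollify n (g k) x‖) hA ?_ (by norm_num)).trans
            (add_le_add ?_ ?_)
          · rw [hsum]; exact Finset.aestronglyMeasurable_sum _ fun k _ => hB k
          · refine (eLpNorm_const_smul_le (c := M) (f := fun x => ‖mollify n f x‖)).trans ?_
            rw [Real.enorm_of_nonneg hM0, eLpNorm_norm]
            gcongr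
          · rw [hsum]
            refine (eLpNorm_sum_le (fun k _ => hB k) (by norm_num)).trans
              (Finset.sum_le_sum fun k _ => ?_)
            rw [eLpNorm_norm]
            exact hmg k
      _ ≤ _ := by
          rw [mul_assoc]
          gcongr
          rw [mul_add]
          gcongr
          · exact le_self_add
          · exact le_mul_of_one_le_left zero_le le_add_self
  have hlim : ∀ᵐ x ∂(volume.restrict (Metric.ball (0 : E3) 1)),
      Tendsto (fun n => mollify n f x) atTop (𝓝 (f x)) := by
    refine ae_restrict_of_ae (ContDiffBump.ae_convolution_tendsto_right_of_locallyIntegrable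
      (K := 2) ?_ (Eventually.of_forall fun n => ?_) hf)
    · exact tendsto_one_div_add_atTop_nhds_zero_nat
    · simp only [mollifierBump]
      field_simp; rfl
  refine (Lp.eLpNorm_lim_le_liminf_eLpNorm (fun n =>
    (contDiff_mollify n hf).continuous.aestronglyMeasurable) f hlim).trans ?_
  exact liminf_le_of_frequently_le' (Frequently.of_forall hn)

end Sobolev

/-! ### The products `u_i u_j` near the unit ball -/

section LocalBound

/-- Interpolation between `L²` and `L⁶`. -/
theorem lintegral_twelve_fifths_rpow_le {μ : Measure E3} {f : E3 → ℝ}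
    (hf : AEStronglyMeasurable f μ) :
    (∫⁻ x, ‖f x‖ₑ ^ (12 / 5 : ℝ) ∂μ) ^ (10 / 3 : ℝ)
      ≤ eLpNorm f 2 μ ^ (6 : ℝ) * eLpNorm f 6 μ ^ (2 : ℝ) := by
  have hpq : (10 / 9 : ℝ).HolderConjugate 10 := by rw [Real.holderConjugate_iff]; norm_num
  have h := ENNReal.lintegral_mul_le_Lp_mul_Lq μ hpq (f := fun x => ‖f x‖ₑ ^ (9 / 5 : ℝ))
    (g := fun x => ‖f x‖ₑ ^ (3 / 5 : ℝ)) (hf.enorm.pow_const _) (hf.enorm.pow_const _)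
  have e1 : ∀ x, ‖f x‖ₑ ^ (9 / 5 : ℝ) * ‖f x‖ₑ ^ (3 / 5 : ℝ) = ‖f x‖ₑ ^ (12 / 5 : ℝ) := fun x => by
    rw [← ENNReal.rpow_add_of_nonneg _ _ (by norm_num) (by norm_num)]; norm_num
  simp only [Pi.mul_apply, e1, ← ENNReal.rpow_mul] at h
  rw [eLpNorm_eq_lintegral_rpow_enorm_toReal (by simp) (by simp),
    eLpNorm_eq_lintegral_rpow_enorm_toReal (by simp) (by simp), ENNReal.toReal_ofNat,
    ENNReal.toReal_ofNat, ← ENNReal.rpow_mul, ← ENNReal.rpow_mul]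
  refine (ENNReal.rpow_le_rpow h (by norm_num)).trans (le_of_eq ?_)
  rw [ENNReal.mul_rpow_of_nonneg _ _ (by norm_num), ← ENNReal.rpow_mul, ← ENNReal.rpow_mul]
  norm_num

/-- A consequence of `|f g| ^ (6 / 5) ≤ |f| ^ (12 / 5) + |g| ^ (12 / 5)`. -/
theorem lintegral_mul_six_fifths_rpow_le {μ : Measure E3} {f g : E3 → ℝ}
    (hf : AEStronglyMeasurable f μ) :
    (∫⁻ x, ‖f x * g x‖ₑ ^ (6 / 5 : ℝ) ∂μ) ^ (10 / 3 : ℝ)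
      ≤ 2 ^ (7 / 3 : ℝ) * ((∫⁻ x, ‖f x‖ₑ ^ (12 / 5 : ℝ) ∂μ) ^ (10 / 3 : ℝ)
        + (∫⁻ x, ‖g x‖ₑ ^ (12 / 5 : ℝ) ∂μ) ^ (10 / 3 : ℝ)) := by
  have h1 : ∀ x, ‖f x * g x‖ₑ ^ (6 / 5 : ℝ) ≤ ‖f x‖ₑ ^ (12 / 5 : ℝ) + ‖g x‖ₑ ^ (12 / 5 : ℝ) :=
    fun x => by
      have e : ∀ a : ℝ≥0∞, a ^ (12 / 5 : ℝ) = (a * a) ^ (6 / 5 : ℝ) := fun a => by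
        rw [ENNReal.mul_rpow_of_nonneg _ _ (by norm_num),
          ← ENNReal.rpow_add_of_nonneg _ _ (by norm_num) (by norm_num)]
        norm_num
      rw [enorm_mul, e, e]
      rcases le_total ‖f x‖ₑ ‖g x‖ₑ with h | h
      · exact le_add_left (by gcongr)
      · exact le_add_right (by gcongr)
  have h2 : ∫⁻ x, ‖f x * g x‖ₑ ^ (6 / 5 : ℝ) ∂μ
      ≤ ∫⁻ x, ‖f x‖ₑ ^ (12 / 5 : ℝ) ∂μ + ∫⁻ x, ‖g x‖ₑ ^ (12 / 5 : ℝ) ∂μ := by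
    refine (lintegral_mono h1).trans (le_of_eq ?_)
    exact lintegral_add_left' (hf.enorm.pow_const _) _
  refine (ENNReal.rpow_le_rpow h2 (by norm_num)).trans ?_
  have := ENNReal.rpow_add_le_mul_rpow_add_rpow (∫⁻ x, ‖f x‖ₑ ^ (12 / 5 : ℝ) ∂μ)
    (∫⁻ x, ‖g x‖ₑ ^ (12 / 5 : ℝ) ∂μ) (p := 10 / 3) (by norm_num)
  norm_num at this ⊢
  exact this

theorem MemMixedLoc.component {r : ℝ≥0∞} {u : ℝ → E3 → E3} (hu : MemMixedLoc r 2 u) (i : Fin 3) :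
    MemMixedLoc r 2 fun t x => u t x i := fun τ R hτ hR => by
  obtain ⟨h1, h2⟩ := hu τ R hτ hR
  refine ⟨(EuclideanSpace.proj (𝕜 := ℝ) i).continuous.comp_aestronglyMeasurable h1,
    lt_of_le_of_lt ?_ h2⟩
  refine eLpNorm_mono_enorm fun t => ?_
  rw [enorm_eq_self, enorm_eq_self]
  exact eLpNorm_mono fun x => PiLp.norm_apply_le (u t x) i

theorem measurable_eLpNorm_slice {V : Type*} [NormedAddCommGroup V] {p : ℝ≥0∞} {I : Set ℝ}
    {μ : Measure E3} [SFinite μ] {f : ℝ → E3 → V} (h0 : p ≠ 0) (hpt : p ≠ ∞)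
    (hf : AEStronglyMeasurable (Function.uncurry f) ((volume.restrict I).prod μ)) :
    AEMeasurable (fun t => eLpNorm (f t) p μ) (volume.restrict I) := by
  simp only [eLpNorm_eq_lintegral_rpow_enorm_toReal h0 hpt]
  exact (AEMeasurable.lintegral_prod_right' (hf.enorm.pow_const _)).pow_const _

/-- Functions of the local energy class are in `L⁸((0,T), L^{12/5}(B_1))`: this follows by
interpolation between `L^∞((0,T), L²)` and `L²((0,T), L⁶)`. -/
theorem lintegral_twelve_fifths_ball_lt_top {f : ℝ → E3 → ℝ} {g : Fin 3 → ℝ → E3 → ℝ}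
    (hf : MemMixedLoc ∞ 2 f) (hg : ∀ k, MemMixedLoc 2 2 (g k))
    (hfg : ∀ k, dx k (toDistr halfSpace f) = toDistr halfSpace (g k)) {T : ℝ} (hT : 0 < T) :
    ∫⁻ t in Ioo 0 T, (∫⁻ x in Metric.ball 0 1, ‖f t x‖ₑ ^ (12 / 5 : ℝ)) ^ (10 / 3 : ℝ) < ∞ := by
  obtain ⟨C, hC, hS⟩ := exists_eLpNorm_six_ball_le
  have hfS := hf.slabIntegrable le_top
  have hgS := fun k => (hg k).slabIntegrable (by norm_num)
  obtain ⟨hf1, hf2⟩ := hf T 3 hT (by norm_num)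
  set B : Measure E3 := volume.restrict (Metric.ball 0 3) with hB
  set K := eLpNorm (fun t => eLpNorm (f t) 2 B) ∞ (volume.restrict (Ioo 0 T)) with hK
  have hfK : ∀ᵐ t ∂(volume.restrict (Ioo 0 T)), eLpNorm (f t) 2 B ≤ K := by
    have := ae_le_eLpNormEssSup (f := fun t => eLpNorm (f t) 2 B) (μ := volume.restrict (Ioo 0 T))
    rw [hK, eLpNorm_exponent_top]
    simpa only [enorm_eq_self] using this
  have hder : ∀ᵐ t ∂(volume.restrict (Ioo 0 T)), ∀ k, IsMollifierDeriv k (f t) (g k t) := by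
    refine ae_restrict_of_ae_restrict_of_subset Ioo_subset_Ioi_self ?_
    refine ae_all_iff.2 fun k => ae_all_iff.2 fun n => ae_all_iff.2 fun m => ?_
    refine ae_integral_fderiv_mul_eq hfS (hgS k) (hfg k)
      (φ := fun y => mollifier n (denseSeq E3 m - y))
      ((contDiff_mollifier n).comp (contDiff_const.sub contDiff_id)) ?_
    exact (hasCompactSupport_mollifier n).comp_homeomorph (Homeomorph.subLeft (denseSeq E3 m))
  let h : ℝ → ℝ≥0∞ := fun t => K + ∑ k, eLpNorm (g k t) 2 B
  have hgm : ∀ k, AEMeasurable (fun t => eLpNorm (g k t) 2 B) (volume.restrict (Ioo 0 T)) :=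
    fun k => measurable_eLpNorm_slice (by simp) (by simp) (hg k T 3 hT (by norm_num)).1
  have hh : ∫⁻ t in Ioo 0 T, h t ^ (2 : ℝ) < ∞ := by
    have h1 : eLpNorm h 2 (volume.restrict (Ioo 0 T)) < ∞ := by
      have e : h = (fun _ => K) + ∑ k, fun t => eLpNorm (g k t) 2 B := by
        funext t; simp [h]
      rw [e]
      have hm : AEStronglyMeasurable (∑ k, fun t => eLpNorm (g k t) 2 B)
          (volume.restrict (Ioo 0 T)) :=
        Finset.aestronglyMeasurable_sum _ fun k _ => (hgm k).aestronglyMeasurable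
      refine (eLpNorm_add_le aestronglyMeasurable_const hm (by norm_num)).trans_lt
        (ENNReal.add_lt_top.2 ⟨?_, ?_⟩)
      · rw [eLpNorm_const' _ (by simp) (by simp), enorm_eq_self]
        refine ENNReal.mul_lt_top hf2 (ENNReal.rpow_lt_top_of_nonneg (by simp) ?_)
        simp
      · refine (eLpNorm_sum_le (fun k _ => (hgm k).aestronglyMeasurable) (by norm_num)).trans_lt
          (ENNReal.sum_lt_top.2 fun k _ => (hg k T 3 hT (by norm_num)).2)
    rw [eLpNorm_eq_lintegral_rpow_enorm_toReal (by simp) (by simp), ENNReal.toReal_ofNat,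
      ENNReal.rpow_lt_top_iff_of_pos (by norm_num)] at h1
    simpa only [enorm_eq_self] using h1
  refine lt_of_le_of_lt (b := ∫⁻ t in Ioo 0 T, K ^ (6 : ℝ) * C ^ (2 : ℝ) * h t ^ (2 : ℝ)) ?_ ?_
  · refine lintegral_mono_ae ?_
    filter_upwards [hfK, hder, (hfS T).ae_locallyIntegrable,
      ae_all_iff.2 fun k => (hgS k T).ae_locallyIntegrable] with t ht1 ht2 ht3 ht4
    refine (lintegral_twelve_fifths_rpow_le ht3.aestronglyMeasurable.restrict).trans ?_
    rw [mul_assoc, ← ENNReal.mul_rpow_of_nonneg _ _ (by norm_num)]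
    gcongr
    · refine (eLpNorm_mono_measure _ ?_).trans ht1
      exact Measure.restrict_mono (Metric.ball_subset_ball (by norm_num)) le_rfl
    · refine (hS _ _ ht3 ht4 ht2).trans ?_
      simp only [h]
      gcongr
  · rw [lintegral_const_mul' _ _ (by finiteness)]
    exact ENNReal.mul_lt_top (by finiteness) hh

/-- The products `u_i u_j` are in `L⁴((0,T), L^{6/5}(B_1))`. -/
theorem lintegral_mul_ball_lt_top {u : ℝ → E3 → E3} (hu : MemMixedLoc ∞ 2 u)
    (hDu : HasLocL2Gradient u) (i j : Fin 3) {T : ℝ} (hT : 0 < T) :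
    ∫⁻ t in Ioo 0 T, (∫⁻ x in Metric.ball 0 1, ‖u t x i * u t x j‖ₑ ^ (6 / 5 : ℝ)) ^ (10 / 3 : ℝ)
      < ∞ := by
  obtain ⟨G, hG, hGd⟩ := hDu
  have hl := fun i => (hu.component i).slabIntegrable le_top T
  have h := fun i => lintegral_twelve_fifths_ball_lt_top (hu.component i) (hG i) (hGd i) hT
  have hm : AEMeasurable (fun t => (∫⁻ x in Metric.ball 0 1, ‖u t x i‖ₑ ^ (12 / 5 : ℝ)) ^
      (10 / 3 : ℝ)) (volume.restrict (Ioo 0 T)) :=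
    (AEMeasurable.lintegral_prod_right' (((hu.component i T 1 hT one_pos).1).enorm.pow_const _)
      ).pow_const _
  refine lt_of_le_of_lt (lintegral_mono_ae (g := fun t => 2 ^ (7 / 3 : ℝ) *
    ((∫⁻ x in Metric.ball 0 1, ‖u t x i‖ₑ ^ (12 / 5 : ℝ)) ^ (10 / 3 : ℝ)
      + (∫⁻ x in Metric.ball 0 1, ‖u t x j‖ₑ ^ (12 / 5 : ℝ)) ^ (10 / 3 : ℝ))) ?_) ?_
  · filter_upwards [(hl i).ae_locallyIntegrable] with t ht
    exact lintegral_mul_six_fifths_rpow_le ht.aestronglyMeasurable.restrict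
  · rw [lintegral_const_mul' _ _ (by finiteness), lintegral_add_left' hm]
    exact ENNReal.mul_lt_top (by finiteness) (ENNReal.add_lt_top.2 ⟨h i, h j⟩)

end LocalBound

/-! ### From the unit ball to weighted spaces by self-similarity -/

section SelfSimilarity

/-- `a² W(a² t, a x) = W(t, x)` almost everywhere on `(0,∞) × ℝ³`. -/
def IsScaleInvariant (a : ℝ) (W : ℝ → E3 → ℝ) : Prop :=
  ∀ᵐ z : ℝ × E3 ∂(volume.restrict (halfSpace : Set (ℝ × E3))),
    a ^ 2 * W (a ^ 2 * z.1) (a • z.2) = W z.1 z.2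

/-- Parabolic scalings preserve null sets. -/
theorem quasiMeasurePreserving_parabolic {a : ℝ} (ha : 0 < a) :
    Measure.QuasiMeasurePreserving (fun z : ℝ × E3 => (a ^ 2 * z.1, a • z.2)) := by
  have h1 : Measure.QuasiMeasurePreserving (fun t : ℝ => a ^ 2 • t) :=
    Measure.quasiMeasurePreserving_smul volume (by positivity)
  have h2 : Measure.QuasiMeasurePreserving (fun x : E3 => a • x) :=
    Measure.quasiMeasurePreserving_smul volume ha.ne'
  refine ⟨by fun_prop, ?_⟩
  have e : Measure.map (fun z : ℝ × E3 => (a ^ 2 * z.1, a • z.2)) volume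
      = (Measure.map (fun t : ℝ => a ^ 2 • t) volume).prod
        (Measure.map (fun x : E3 => a • x) volume) := by
    rw [Measure.map_prod_map _ _ h1.measurable h2.measurable]; rfl
  rw [e, Measure.volume_eq_prod]
  exact h1.absolutelyContinuous.prod h2.absolutelyContinuous

theorem measurableSet_halfSpace : MeasurableSet (halfSpace : Set (ℝ × E3)) :=
  halfSpace.isOpen.measurableSet

theorem IsScaleInvariant.mul {a b : ℝ} (hb : 0 < b) {W : ℝ → E3 → ℝ}
    (hWa : IsScaleInvariant a W) (hWb : IsScaleInvariant b W) : IsScaleInvariant (a * b) W := by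
  unfold IsScaleInvariant at *
  rw [ae_restrict_iff' measurableSet_halfSpace] at *
  have h := (quasiMeasurePreserving_parabolic hb).ae hWa
  filter_upwards [h, hWb] with z h1 h2 hz
  have h0 : (0 : ℝ) < z.1 := hz.1
  have hz' : (b ^ 2 * z.1, b • z.2) ∈ (halfSpace : Set (ℝ × E3)) :=
    ⟨(by positivity : (0 : ℝ) < b ^ 2 * z.1), mem_univ _⟩
  have h3 := h1 hz'
  rw [← h2 hz, ← h3, mul_pow, mul_assoc (a ^ 2), ← mul_smul]; ring_nf

theorem IsScaleInvariant.pow {a : ℝ} (ha : 0 < a) {W : ℝ → E3 → ℝ} (hW : IsScaleInvariant a W)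
    (k : ℕ) : IsScaleInvariant (a ^ k) W := by
  induction k with
  | zero => exact ae_of_all _ fun z => by simp
  | succ k ih => rw [pow_succ]; exact ih.mul ha hW

theorem lintegral_comp_mul_left (f : ℝ → ℝ≥0∞) {r : ℝ} (hr : 0 < r) :
    ∫⁻ t, f t = ENNReal.ofReal r * ∫⁻ t, f (r * t) := by
  have h := Real.smul_map_volume_mul_left hr.ne'
  have e : ∫⁻ t, f (r * t) = ∫⁻ t, f t ∂(Measure.map (fun t : ℝ => r * t) volume) :=
    (lintegral_map_equiv f (Homeomorph.mulLeft₀ r hr.ne').toMeasurableEquiv).symm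
  rw [e]
  conv_lhs => rw [← h, lintegral_smul_measure, abs_of_pos hr, smul_eq_mul]

/-- The effect of a scaling on the norm in `L⁴((0,T), L^{6/5})`, to the fourth power: the ball
`B_a` is reduced to the unit ball. -/
theorem IsScaleInvariant.lintegral_ball_le {a : ℝ} (ha : 1 ≤ a) {W : ℝ → E3 → ℝ}
    (hW : IsScaleInvariant a W) (T : ℝ) :
    ∫⁻ t in Ioo 0 T, (∫⁻ x in Metric.ball 0 a, ‖W t x‖ₑ ^ (6 / 5 : ℝ)) ^ (10 / 3 : ℝ)
      ≤ ENNReal.ofReal (a ^ 4) *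
        ∫⁻ t in Ioo 0 T, (∫⁻ x in Metric.ball 0 1, ‖W t x‖ₑ ^ (6 / 5 : ℝ)) ^ (10 / 3 : ℝ) := by
  have ha0 : 0 < a := by linarith
  have hW' : ∀ᵐ t ∂(volume.restrict (Ioi (0 : ℝ))), ∀ᵐ x : E3,
      a ^ 2 * W (a ^ 2 * t) (a • x) = W t x := by
    have h : (volume.restrict (halfSpace : Set (ℝ × E3)))
        = (volume.restrict (Ioi (0 : ℝ))).prod volume := by
      conv_rhs => rw [← Measure.restrict_univ (μ := (volume : Measure E3))]
      rw [Measure.prod_restrict]; rfl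
    rw [IsScaleInvariant, h] at hW
    exact Measure.ae_ae_of_ae_prod hW
  -- the value of the space integral at the scaled time
  have hsl : ∀ᵐ t ∂(volume.restrict (Ioi (0 : ℝ))),
      ∫⁻ x in Metric.ball 0 a, ‖W (a ^ 2 * t) x‖ₑ ^ (6 / 5 : ℝ)
        = ENNReal.ofReal (a ^ (3 / 5 : ℝ)) * ∫⁻ x in Metric.ball 0 1, ‖W t x‖ₑ ^ (6 / 5 : ℝ) := by
    filter_upwards [hW'] with t ht
    have h1 := lintegral_comp_smul ((Metric.ball (0 : E3) a).indicator
      fun x => ‖W (a ^ 2 * t) x‖ₑ ^ (6 / 5 : ℝ)) ha0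
    rw [lintegral_indicator measurableSet_ball] at h1
    have h2 : ∫⁻ x : E3, (Metric.ball (0 : E3) a).indicator
        (fun x => ‖W (a ^ 2 * t) x‖ₑ ^ (6 / 5 : ℝ)) (a • x)
        = ENNReal.ofReal (a ^ (-(12 / 5) : ℝ)) *
          ∫⁻ x in Metric.ball 0 1, ‖W t x‖ₑ ^ (6 / 5 : ℝ) := by
      rw [← lintegral_indicator measurableSet_ball,
        ← lintegral_const_mul' _ _ ENNReal.ofReal_ne_top]
      refine lintegral_congr_ae ?_
      filter_upwards [ht] with x hx
      have hmem : a • x ∈ Metric.ball (0 : E3) a ↔ x ∈ Metric.ball (0 : E3) 1 := by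
        rw [mem_ball_zero_iff, mem_ball_zero_iff, norm_smul, Real.norm_of_nonneg ha0.le]
        constructor <;> intro h <;> nlinarith
      by_cases hx1 : x ∈ Metric.ball (0 : E3) 1
      · rw [indicator_of_mem (hmem.2 hx1), indicator_of_mem hx1, ← hx, enorm_mul,
          ENNReal.mul_rpow_of_nonneg _ _ (by norm_num), ← mul_assoc,
          Real.enorm_of_nonneg (sq_nonneg a), ENNReal.ofReal_rpow_of_pos (by positivity),
          ← ENNReal.ofReal_mul (by positivity), ← Real.rpow_natCast, ← Real.rpow_mul ha0.le,
          ← Real.rpow_add ha0]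
        norm_num
      · rw [indicator_of_notMem (mt hmem.1 hx1), indicator_of_notMem hx1, mul_zero]
    rw [h2] at h1
    have h3 : ENNReal.ofReal (a ^ 3) * (ENNReal.ofReal ((a ^ 3)⁻¹) *
        ∫⁻ x in Metric.ball 0 a, ‖W (a ^ 2 * t) x‖ₑ ^ (6 / 5 : ℝ))
        = ∫⁻ x in Metric.ball 0 a, ‖W (a ^ 2 * t) x‖ₑ ^ (6 / 5 : ℝ) := by
      rw [← mul_assoc, ← ENNReal.ofReal_mul (by positivity), mul_inv_cancel₀ (by positivity),
        ENNReal.ofReal_one, one_mul]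
    rw [← h3, ← h1, ← mul_assoc, ← ENNReal.ofReal_mul (by positivity), ← Real.rpow_natCast,
      ← Real.rpow_add ha0]
    norm_num
  let H : ℝ → ℝ≥0∞ := fun t =>
    (∫⁻ x in Metric.ball 0 a, ‖W t x‖ₑ ^ (6 / 5 : ℝ)) ^ (10 / 3 : ℝ)
  have h4 := lintegral_comp_mul_left ((Ioo 0 T).indicator H) (r := a ^ 2) (by positivity)
  rw [lintegral_indicator measurableSet_Ioo] at h4
  rw [h4]
  have h5 : ∫⁻ t, (Ioo 0 T).indicator H (a ^ 2 * t) ≤ ∫⁻ t in Ioo 0 T, ENNReal.ofReal (a ^ 2) *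
      (∫⁻ x in Metric.ball 0 1, ‖W t x‖ₑ ^ (6 / 5 : ℝ)) ^ (10 / 3 : ℝ) := by
    rw [← lintegral_indicator measurableSet_Ioo]
    refine lintegral_mono_ae ?_
    rw [ae_restrict_iff' measurableSet_Ioi] at hsl
    filter_upwards [hsl] with t ht
    by_cases hm : a ^ 2 * t ∈ Ioo 0 T
    · have ht0 : 0 < t := pos_of_mul_pos_right hm.1 (by positivity)
      have htT : t < T := lt_of_le_of_lt (le_mul_of_one_le_left ht0.le (one_le_pow₀ ha)) hm.2
      have hmt : t ∈ Ioo 0 T := ⟨ht0, htT⟩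
      rw [indicator_of_mem hm, indicator_of_mem hmt]
      simp only [H]
      rw [ht ht0, ENNReal.mul_rpow_of_nonneg _ _ (by norm_num),
        ENNReal.ofReal_rpow_of_pos (by positivity), ← Real.rpow_mul ha0.le]
      norm_num
    · rw [indicator_of_notMem hm]; exact zero_le
  refine (mul_le_mul_right h5 _).trans (le_of_eq ?_)
  rw [lintegral_const_mul' _ _ ENNReal.ofReal_ne_top, ← mul_assoc,
    ← ENNReal.ofReal_mul (by positivity)]
  congr 2; ring

/-- Cutting space into the shells `λ^{k-1} ≤ |x| < λ^k`. -/
theorem weight_le_tsum {lam δ : ℝ} (hlam : 1 < lam) (hδ : 0 ≤ δ) (x : E3) :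
    ENNReal.ofReal ((1 + ‖x‖) ^ (-δ)) ≤ ∑' k : ℕ, (Metric.ball (0 : E3) (lam ^ k)).indicator
      (fun _ => ENNReal.ofReal (lam ^ (δ - k * δ))) x := by
  have hl0 : 0 < lam := by linarith
  -- a single term of the sum is enough: that of the first ball containing `x`
  have hex : ∃ k : ℕ, ‖x‖ < lam ^ k := pow_unbounded_of_one_lt _ hlam
  classical
  set k := Nat.find hex with hk
  have h1 : ‖x‖ < lam ^ k := Nat.find_spec hex
  refine le_trans ?_ (ENNReal.le_tsum k)
  rw [indicator_of_mem (by rwa [mem_ball_zero_iff])]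
  refine ENNReal.ofReal_le_ofReal ?_
  have h2 : lam ^ ((k : ℝ) - 1) ≤ 1 + ‖x‖ := by
    rcases Nat.eq_zero_or_pos k with h0 | h0
    · rw [h0, Nat.cast_zero, zero_sub, Real.rpow_neg_one]
      have : lam⁻¹ ≤ 1 := inv_le_one_of_one_le₀ hlam.le
      linarith [norm_nonneg x]
    · have h3 := Nat.find_min hex (m := k - 1) (by omega)
      rw [not_lt] at h3
      have e : lam ^ ((k : ℝ) - 1) = lam ^ (k - 1) := by
        rw [← Real.rpow_natCast, Nat.cast_sub h0, Nat.cast_one]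
      rw [e]; linarith
  calc (1 + ‖x‖) ^ (-δ) ≤ (lam ^ ((k : ℝ) - 1)) ^ (-δ) :=
        Real.rpow_le_rpow_of_nonpos (by positivity) h2 (by linarith)
    _ = lam ^ (δ - k * δ) := by rw [← Real.rpow_mul hl0.le]; congr 1; ring

/-- A scale invariant function with a finite norm in `L⁴((0,T), L^{6/5}(B_1))` has a finite norm
in `L⁴((0,T), L^{6/5}_{w_{6γ/5}})` for `γ > 1`: the contribution of the shell of radius `λ^k` is
`O(λ^{(1-γ)k})`. -/
theorem IsScaleInvariant.memMixed {lam γ T : ℝ} (hlam : 1 < lam) (hγ : 1 < γ)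
    {W : ℝ → E3 → ℝ} (hW : IsScaleInvariant lam W)
    (hm : AEStronglyMeasurable (Function.uncurry W) ((volume.restrict (Ioo 0 T)).prod volume))
    (hfin : ∫⁻ t in Ioo 0 T, (∫⁻ x in Metric.ball 0 1, ‖W t x‖ₑ ^ (6 / 5 : ℝ)) ^ (10 / 3 : ℝ) < ∞) :
    MemMixed 4 (6 / 5) (Ioo 0 T) (weighted (6 * γ / 5)) W := by
  have hl0 : 0 < lam := by linarith
  have hδ0 : 0 ≤ 6 * γ / 5 := by linarith
  have hac : weighted (6 * γ / 5) ≪ volume := (weighted_le_volume hδ0).absolutelyContinuous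
  refine ⟨hm.mono_ac (Measure.AbsolutelyContinuous.rfl.prod hac), ?_⟩
  set δ := 6 * γ / 5 with hδ
  set ε := γ - 1 with hε
  set A := ∫⁻ t in Ioo 0 T, (∫⁻ x in Metric.ball 0 1, ‖W t x‖ₑ ^ (6 / 5 : ℝ)) ^ (10 / 3 : ℝ)
    with hA
  -- the sum over the shells is split by Jensen's inequality for the weights `ω k = λ ^ (-ε k)`; the
  -- loss `λ ^ (ε k)` in `a k` is small compared with the decay of the contributions of the shells
  let S : ℕ → ℝ → ℝ≥0∞ := fun k t => ∫⁻ x in Metric.ball 0 (lam ^ k), ‖W t x‖ₑ ^ (6 / 5 : ℝ)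
  let ω : ℕ → ℝ≥0∞ := fun k => ENNReal.ofReal (lam ^ (-(ε * k)))
  let a : ℕ → ℝ → ℝ≥0∞ := fun k t => ENNReal.ofReal (lam ^ (δ - k * δ + ε * k)) * S k t
  have hSm : ∀ k, AEMeasurable (S k) (volume.restrict (Ioo 0 T)) := fun k => by
    have h : AEMeasurable (fun z : ℝ × E3 => ‖Function.uncurry W z‖ₑ ^ (6 / 5 : ℝ))
        ((volume.restrict (Ioo 0 T)).prod (volume.restrict (Metric.ball 0 (lam ^ k)))) :=
      (hm.mono_ac (Measure.AbsolutelyContinuous.rfl.prod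
        Measure.restrict_le_self.absolutelyContinuous)).enorm.pow_const _
    exact h.lintegral_prod_right'
  have hsl : ∀ᵐ t ∂(volume.restrict (Ioo 0 T)),
      ∫⁻ x, ‖W t x‖ₑ ^ (6 / 5 : ℝ) ∂(weighted δ) ≤ ∑' k, ω k * a k t := by
    filter_upwards [hm.prodMk_left] with t ht
    have hme : AEMeasurable (fun x => ‖W t x‖ₑ ^ (6 / 5 : ℝ)) volume := ht.enorm.pow_const _
    rw [weighted, lintegral_withDensity_eq_lintegral_mul₀ (by fun_prop) hme]
    calc ∫⁻ x, ENNReal.ofReal ((1 + ‖x‖) ^ (-δ)) * ‖W t x‖ₑ ^ (6 / 5 : ℝ)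
        ≤ ∫⁻ x, ∑' k : ℕ, ENNReal.ofReal (lam ^ (δ - k * δ)) *
          (Metric.ball (0 : E3) (lam ^ k)).indicator (fun x => ‖W t x‖ₑ ^ (6 / 5 : ℝ)) x := by
          refine lintegral_mono fun x => ?_
          refine (mul_le_mul_left (weight_le_tsum hlam hδ0 x) _).trans (le_of_eq ?_)
          rw [← ENNReal.tsum_mul_right]
          refine tsum_congr fun k => ?_
          by_cases hx : x ∈ Metric.ball (0 : E3) (lam ^ k)
          · rw [indicator_of_mem hx, indicator_of_mem hx]
          · rw [indicator_of_notMem hx, indicator_of_notMem hx, zero_mul, mul_zero]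
      _ = ∑' k : ℕ, ω k * a k t := by
          rw [lintegral_tsum fun k => (hme.indicator measurableSet_ball).const_mul _]
          refine tsum_congr fun k => ?_
          rw [lintegral_const_mul' _ _ ENNReal.ofReal_ne_top,
            lintegral_indicator measurableSet_ball]
          simp only [ω, a, S]
          rw [← mul_assoc, ← ENNReal.ofReal_mul (by positivity), ← Real.rpow_add hl0]
          congr 3; ring
  have hJ : ∀ t, (∑' k, ω k * a k t) ^ (10 / 3 : ℝ)
      ≤ (∑' k, ω k) ^ (7 / 3 : ℝ) * ∑' k, ω k * a k t ^ (10 / 3 : ℝ) := fun t => by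
    have := lintegral_mul_rpow_le (μ := (Measure.count : Measure ℕ)) (p := 10 / 3) (by norm_num)
      (k := ω) (f := fun k => a k t) (by fun_prop) (by fun_prop)
    simp only [lintegral_count] at this
    norm_num at this ⊢
    exact this
  have hgeo : ∀ c : ℝ, 0 < c → ∑' k : ℕ, ENNReal.ofReal (lam ^ (-(c * k))) ≠ ∞ := fun c hc => by
    have e : ∀ k : ℕ, lam ^ (-(c * k)) = (lam ^ (-c)) ^ k := fun k => by
      rw [← Real.rpow_natCast, ← Real.rpow_mul hl0.le]; congr 1; ring
    simp only [e]
    exact (summable_geometric_of_lt_one (by positivity)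
      (Real.rpow_lt_one_of_one_lt_of_neg hlam (by linarith))).tsum_ofReal_ne_top
  have hbound : ∫⁻ t in Ioo 0 T, ∑' k, ω k * a k t ^ (10 / 3 : ℝ) ≠ ∞ := by
    have hmk : ∀ k, AEMeasurable (fun t => ω k * a k t ^ (10 / 3 : ℝ))
        (volume.restrict (Ioo 0 T)) := fun k => (((hSm k).const_mul _).pow_const _).const_mul _
    rw [lintegral_tsum hmk]
    have hk : ∀ k : ℕ, ∫⁻ t in Ioo 0 T, ω k * a k t ^ (10 / 3 : ℝ)
        ≤ ENNReal.ofReal (lam ^ (10 / 3 * δ)) * A *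
          ENNReal.ofReal (lam ^ (-((5 / 3 * ε) * k))) := fun k => by
      have e1 : ∀ t, ω k * a k t ^ (10 / 3 : ℝ) = ENNReal.ofReal
          (lam ^ (-(ε * k) + (δ - k * δ + ε * k) * (10 / 3))) * S k t ^ (10 / 3 : ℝ) := fun t => by
        simp only [ω, a]
        rw [ENNReal.mul_rpow_of_nonneg _ _ (by norm_num), ← mul_assoc,
          ENNReal.ofReal_rpow_of_pos (by positivity), ← Real.rpow_mul hl0.le,
          ← ENNReal.ofReal_mul (by positivity), ← Real.rpow_add hl0]
      simp only [e1]
      rw [lintegral_const_mul' _ _ ENNReal.ofReal_ne_top]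
      refine (mul_le_mul_right ((hW.pow hl0 k).lintegral_ball_le (one_le_pow₀ hlam.le) T) _).trans
        (le_of_eq ?_)
      rw [← hA, ← mul_assoc, ← ENNReal.ofReal_mul (by positivity), mul_right_comm,
        ← ENNReal.ofReal_mul (by positivity), ← pow_mul, ← Real.rpow_natCast,
        ← Real.rpow_add hl0, ← Real.rpow_add hl0]
      congr 3
      push_cast
      rw [hδ, hε]; ring
    refine ne_top_of_le_ne_top ?_ (ENNReal.tsum_le_tsum hk)
    rw [ENNReal.tsum_mul_left]
    exact ENNReal.mul_ne_top (ENNReal.mul_ne_top ENNReal.ofReal_ne_top hfin.ne)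
      (hgeo _ (by linarith))
  rw [eLpNorm_eq_lintegral_rpow_enorm_toReal (by simp) (by simp), ENNReal.toReal_ofNat]
  refine ENNReal.rpow_lt_top_of_nonneg (by norm_num) ?_
  refine ne_top_of_le_ne_top (b := (∑' k, ω k) ^ (7 / 3 : ℝ) *
    ∫⁻ t in Ioo 0 T, ∑' k, ω k * a k t ^ (10 / 3 : ℝ)) ?_ ?_
  · exact ENNReal.mul_ne_top (ENNReal.rpow_ne_top_of_nonneg (by norm_num)
      (hgeo ε (by linarith))) hbound
  · rw [← lintegral_const_mul' _ _ (ENNReal.rpow_ne_top_of_nonneg (by norm_num)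
      (hgeo ε (by linarith)))]
    refine lintegral_mono_ae ?_
    filter_upwards [hsl] with t ht
    refine le_trans ?_ (hJ t)
    rw [enorm_eq_self, eLpNorm_six_fifths_eq, ← ENNReal.rpow_mul]
    norm_num
    gcongr

end SelfSimilarity

/-! ### Mixed norms -/

section MixedNorms

variable {r p : ℝ≥0∞} {δ : ℝ}

theorem MemMixed.memLp_uncurry {I : Set ℝ} {μ : Measure E3} [SFinite μ] (h0 : p ≠ 0) (hpt : p ≠ ∞)
    (hpr : p ≤ r) (hI : volume I ≠ ∞) {f : ℝ → E3 → ℝ} (hf : MemMixed r p I μ f) :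
    MemLp (Function.uncurry f) p ((volume.restrict I).prod μ) := by
  have hpp : 0 < p.toReal := ENNReal.toReal_pos h0 hpt
  have : IsFiniteMeasure (volume.restrict I) :=
    ⟨by rwa [Measure.restrict_apply_univ, lt_top_iff_ne_top]⟩
  refine ⟨hf.1, ?_⟩
  have h1 : MemLp (fun t => eLpNorm (f t) p μ) r (volume.restrict I) :=
    ⟨(measurable_eLpNorm_slice h0 hpt hf.1).aestronglyMeasurable, hf.2⟩
  have h2 := (h1.mono_exponent hpr).2
  rw [eLpNorm_eq_lintegral_rpow_enorm_toReal h0 hpt] at h2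
  simp only [enorm_eq_self] at h2
  have h3 := eLpNorm_prod_rpow h0 hpt hf.1
  simp only [Function.uncurry_apply_pair] at h3
  rw [← h3, ← ENNReal.rpow_mul, mul_one_div_cancel hpp.ne', ENNReal.rpow_one] at h2
  exact h2

theorem MemMixed.of_ae_eLpNorm_le {I : Set ℝ} {μ : Measure E3} {f g : ℝ → E3 → ℝ} {C : ℝ≥0∞}
    (hC : C ≠ ∞) (hf : MemMixed r p I μ f)
    (hg : AEStronglyMeasurable (Function.uncurry g) ((volume.restrict I).prod μ))
    (h : ∀ᵐ t ∂(volume.restrict I), eLpNorm (g t) p μ ≤ C * eLpNorm (f t) p μ) :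
    MemMixed r p I μ g := by
  lift C to NNReal using hC
  refine ⟨hg, lt_of_le_of_lt (eLpNorm_le_nnreal_smul_eLpNorm_of_ae_le_mul' (c := C)
    (g := fun t => eLpNorm (f t) p μ) ?_ r) ?_⟩
  · filter_upwards [h] with t ht
    simpa only [enorm_eq_self] using ht
  · rw [ENNReal.smul_def, smul_eq_mul]
    exact ENNReal.mul_lt_top ENNReal.coe_lt_top hf.2

theorem MemMixed.add {I : Set ℝ} {μ : Measure E3} [SFinite μ] (hr : 1 ≤ r) (hp : 1 ≤ p)
    (hpt : p ≠ ∞) {f g : ℝ → E3 → ℝ} (hf : MemMixed r p I μ f) (hg : MemMixed r p I μ g) :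
    MemMixed r p I μ fun t x => f t x + g t x := by
  have h0 : p ≠ 0 := (one_pos.trans_le hp).ne'
  refine ⟨hf.1.add hg.1, ?_⟩
  refine lt_of_le_of_lt (eLpNorm_mono_enorm_ae
    (g := (fun t => eLpNorm (f t) p μ) + fun t => eLpNorm (g t) p μ) ?_)
    ((eLpNorm_add_le (measurable_eLpNorm_slice h0 hpt hf.1).aestronglyMeasurable
      (measurable_eLpNorm_slice h0 hpt hg.1).aestronglyMeasurable hr).trans_lt
      (ENNReal.add_lt_top.2 ⟨hf.2, hg.2⟩))
  filter_upwards [hf.1.prodMk_left, hg.1.prodMk_left] with t h1 h2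
  rw [enorm_eq_self, enorm_eq_self]
  exact eLpNorm_add_le h1 h2 hp

theorem MemMixed.sum {ι : Type*} {I : Set ℝ} {μ : Measure E3} [SFinite μ] (hr : 1 ≤ r) (hp : 1 ≤ p)
    (hpt : p ≠ ∞) (s : Finset ι) {f : ι → ℝ → E3 → ℝ} (hf : ∀ i ∈ s, MemMixed r p I μ (f i)) :
    MemMixed r p I μ fun t x => ∑ i ∈ s, f i t x := by
  classical
  induction s using Finset.induction_on with
  | empty =>
    refine ⟨aestronglyMeasurable_const, ?_⟩
    have e : (fun t : ℝ => eLpNorm (fun x : E3 => ∑ i ∈ (∅ : Finset ι), f i t x) p μ) = 0 := by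
      funext t; simp
    rw [e, eLpNorm_zero]; exact ENNReal.zero_lt_top
  | insert a s ha ih =>
    simp only [Finset.sum_insert ha]
    exact (hf a (Finset.mem_insert_self a s)).add hr hp hpt
      (ih fun i hi => hf i (Finset.mem_insert_of_mem hi))

/-- The iterated Riesz transforms of the time slices can be chosen measurably, with the same
integrability. -/
theorem RieszBounded.exists_isRieszRiesz_slice (hδ : 0 ≤ δ) (hp : 1 ≤ p) (hpt : p ≠ ∞)
    (hpr : p ≤ r) (h : RieszBounded p δ) (i j : Fin 3) {I : Set ℝ} (hI : volume I ≠ ∞)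
    {f : ℝ → E3 → ℝ} (hf : MemMixed r p I (weighted δ) f) :
    ∃ g : ℝ → E3 → ℝ, MemMixed r p I (weighted δ) g ∧
      ∀ᵐ t ∂(volume.restrict I), IsRieszRiesz p (weighted δ) i j (f t) (g t) := by
  obtain ⟨C, hC, hb⟩ := h.exists_eLpNorm_le hδ hp hpt
  obtain ⟨k, hk, hfk⟩ := h.exists_isRieszTransform_slice hδ hp hpt j
    (hf.memLp_uncurry (one_pos.trans_le hp).ne' hpt hpr hI)
  obtain ⟨g, hg, hkg⟩ := h.exists_isRieszTransform_slice hδ hp hpt i hk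
  refine ⟨g, hf.of_ae_eLpNorm_le (ENNReal.mul_ne_top hC hC) hg.1 ?_, ?_⟩
  · filter_upwards [hfk, hkg] with t h1 h2
    rw [mul_assoc]
    exact (hb i _ _ h2).trans (mul_le_mul_right (hb j _ _ h1) _)
  · filter_upwards [hfk, hkg] with t h1 h2 using ⟨_, h1, h2⟩

end MixedNorms

/-! ### Discretely self-similar velocity fields -/

section Velocity

theorem IsDSSVelocity.isScaleInvariant_mul {lam : ℝ} {u : ℝ → E3 → E3} (hu : IsDSSVelocity lam u)
    (i j : Fin 3) : IsScaleInvariant lam fun t x => u t x i * u t x j := by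
  filter_upwards [hu] with z hz
  rw [← hz]
  simp only [PiLp.smul_apply, smul_eq_mul]; ring

/-- `u_i u_j ∈ L⁴((0,T), L^{6/5}_{w_{6γ/5}})` for a discretely self-similar field `u` in the local
energy class. -/
theorem memMixed_mul {γ T lam : ℝ} (hγ : 1 < γ) (hT : 0 < T) (hlam : 1 < lam)
    {u : ℝ → E3 → E3} (hu : MemMixedLoc ∞ 2 u) (hDu : HasLocL2Gradient u)
    (hudss : IsDSSVelocity lam u) (i j : Fin 3) :
    MemMixed 4 (6 / 5) (Ioo 0 T) (weighted (6 * γ / 5)) fun t x => u t x i * u t x j := by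
  have hm : ∀ i, AEStronglyMeasurable (Function.uncurry fun t x => u t x i)
      ((volume.restrict (Ioo 0 T)).prod volume) := fun i => by
    have h := ((hu.component i).slabIntegrable le_top T).locallyIntegrableOn.aestronglyMeasurable
    rwa [slab, Opens.coe_mk, Measure.volume_eq_prod, ← Measure.prod_restrict,
      Measure.restrict_univ] at h
  exact (hudss.isScaleInvariant_mul i j).memMixed hlam hγ ((hm i).mul (hm j))
    (lintegral_mul_ball_lt_top hu hDu i j hT)

end Velocity

/-! ### A Liouville theorem -/

section Liouville

theorem sum_coord_mul_clm (L : E3 →L[ℝ] ℝ) (y : E3) : ∑ k, y k * L (e k) = L y := by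
  have hy : y = ∑ k, y k • e k := by
    ext i; simp [e, Fin.sum_univ_three]; fin_cases i <;> simp
  conv_rhs => rw [hy]
  simp

/-- A bump function on `ℝ`, used for radial averages. -/
noncomputable def radialBump : ContDiffBump (0 : ℝ) := ⟨1, 2, one_pos, one_lt_two⟩

/-- A compactly supported primitive of the radial weight: its gradient at `y` is
`radialBump (|y|²) y`. -/
noncomputable def radialPotential (y : E3) : ℝ := 2⁻¹ * ∫ s in (2 : ℝ)..‖y‖ ^ 2, radialBump s

theorem radialBump_eq_zero {y : E3} (h : 2 ≤ ‖y‖) : radialBump (‖y‖ ^ 2) = 0 := by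
  refine radialBump.zero_of_le_dist ?_
  rw [Real.dist_eq, sub_zero, abs_of_nonneg (by positivity)]
  change (2 : ℝ) ≤ _
  nlinarith

theorem hasFDerivAt_radialPotential (y : E3) :
    HasFDerivAt radialPotential (radialBump (‖y‖ ^ 2) • innerSL ℝ y) y := by
  have h1 : HasDerivAt (fun s : ℝ => ∫ s in (2 : ℝ)..s, radialBump s) (radialBump (‖y‖ ^ 2))
      (‖y‖ ^ 2) := intervalIntegral.integral_hasDerivAt_right
    (radialBump.continuous.intervalIntegrable _ _)
    (radialBump.continuous.stronglyMeasurableAtFilter _ _) radialBump.continuous.continuousAt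
  have h2 := (h1.comp_hasFDerivAt y (hasStrictFDerivAt_norm_sq y).hasFDerivAt).const_mul 2⁻¹
  refine h2.congr_fderiv ?_
  ext v
  simp; ring

theorem radialPotential_eq_zero {y : E3} (h : 2 ≤ ‖y‖) : radialPotential y = 0 := by
  rw [radialPotential, intervalIntegral.integral_zero_ae, mul_zero]
  refine ae_of_all _ fun s hs => radialBump.zero_of_le_dist ?_
  rw [uIoc_of_le (by nlinarith)] at hs
  rw [Real.dist_eq, sub_zero]
  exact hs.1.le.trans (le_abs_self s)

theorem hasCompactSupport_of_eq_zero {V : Type*} [NormedAddCommGroup V] {f : E3 → V} {R : ℝ}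
    (h : ∀ y, R ≤ ‖y‖ → f y = 0) : HasCompactSupport f :=
  HasCompactSupport.intro (isCompact_closedBall (0 : E3) R) fun y hy => h y (by
    rw [mem_closedBall_zero_iff, not_le] at hy; exact hy.le)

theorem integrable_of_eq_zero {f : E3 → ℝ} {R : ℝ} (hf : Continuous f)
    (h : ∀ y, R ≤ ‖y‖ → f y = 0) : Integrable f :=
  hf.integrable_of_hasCompactSupport (hasCompactSupport_of_eq_zero h)

theorem continuous_radialPotential : Continuous radialPotential :=
  continuous_iff_continuousAt.2 fun y => (hasFDerivAt_radialPotential y).continuousAt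

theorem fderiv_radialPotential (k : Fin 3) (y : E3) :
    fderiv ℝ radialPotential y (e k) = radialBump (‖y‖ ^ 2) * y k := by
  rw [(hasFDerivAt_radialPotential y).fderiv]
  simp [e, EuclideanSpace.inner_single_right]

/-- The radial averages of a harmonic function do not depend on the radius: their derivative is
`∫ ∇l(r y) · ∇Θ(y) dy = -r ∫ Δl(r y) Θ(y) dy`, where `Θ` is `radialPotential`. -/
theorem hasDerivAt_radial_average {l : E3 → ℝ} (hs : ContDiff ℝ 2 l)
    (hΔ : ∀ y, ∑ k, fderiv ℝ (fun y => fderiv ℝ l y (e k)) y (e k) = 0) (r : ℝ) :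
    HasDerivAt (fun r : ℝ => ∫ y : E3, radialBump (‖y‖ ^ 2) * l (r • y)) 0 r := by
  have hη : Continuous fun y : E3 => radialBump (‖y‖ ^ 2) :=
    radialBump.continuous.comp (by fun_prop)
  have hl1 : Continuous (fderiv ℝ l) := hs.continuous_fderiv (by simp)
  have hd : ∀ s : ℝ, ∀ y : E3, HasDerivAt (fun r : ℝ => radialBump (‖y‖ ^ 2) * l (r • y))
      (radialBump (‖y‖ ^ 2) * fderiv ℝ l (s • y) y) s := fun s y => by
    have h1 : HasDerivAt (fun r : ℝ => r • y) y s := by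
      simpa using (hasDerivAt_id s).smul_const y
    exact ((hs.differentiable (by simp) (s • y)).hasFDerivAt.comp_hasDerivAt s h1).const_mul _
  have hc' : ∀ s : ℝ, Continuous fun y : E3 => radialBump (‖y‖ ^ 2) * fderiv ℝ l (s • y) y :=
    fun s => hη.mul ((hl1.comp (by fun_prop)).clm_apply continuous_id)
  obtain ⟨M, hM⟩ := ((isCompact_closedBall r 1).prod
    (isCompact_closedBall (0 : E3) 2)).exists_bound_of_continuousOn
    (f := fun z : ℝ × E3 => radialBump (‖z.2‖ ^ 2) * fderiv ℝ l (z.1 • z.2) z.2)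
    (Continuous.continuousOn ((hη.comp continuous_snd).mul
      ((hl1.comp (by fun_prop)).clm_apply continuous_snd)))
  have key := (hasDerivAt_integral_of_dominated_loc_of_deriv_le (μ := (volume : Measure E3))
    (F := fun r y => radialBump (‖y‖ ^ 2) * l (r • y))
    (F' := fun s y => radialBump (‖y‖ ^ 2) * fderiv ℝ l (s • y) y) (x₀ := r)
    (bound := (Metric.closedBall (0 : E3) 2).indicator fun _ => M) (Metric.ball_mem_nhds r one_pos)
    (Eventually.of_forall fun s => (hη.mul (hs.continuous.comp (by fun_prop))).aestronglyMeasurable)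
    ?_ (hc' r).aestronglyMeasurable ?_ ?_ (ae_of_all _ fun y s _ => hd s y)).2
  · refine key.congr_deriv ?_
    have hk : ∀ k : Fin 3, ∫ y, fderiv ℝ l (r • y) (e k) * fderiv ℝ radialPotential y (e k)
        = -∫ y, r * fderiv ℝ (fun y => fderiv ℝ l y (e k)) (r • y) (e k) * radialPotential y := by
      intro k
      have hlk : ContDiff ℝ 1 fun y => fderiv ℝ l y (e k) :=
        (hs.fderiv_right (m := 1) (by norm_num)).clm_apply contDiff_const
      have hdk : ∀ y : E3, HasFDerivAt (fun y => fderiv ℝ l (r • y) (e k))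
          ((fderiv ℝ (fun y => fderiv ℝ l y (e k)) (r • y)).comp
            (r • ContinuousLinearMap.id ℝ E3)) y := fun y =>
        (hlk.differentiable (by simp) (r • y)).hasFDerivAt.comp y
          ((hasFDerivAt_id y).const_smul r)
      have hc1 : Continuous fun y : E3 => fderiv ℝ l (r • y) (e k) :=
        hlk.continuous.comp (by fun_prop)
      have hc2 : Continuous fun y : E3 => fderiv ℝ (fun y => fderiv ℝ l y (e k)) (r • y) (e k) :=
        ((hlk.continuous_fderiv (by simp)).comp (by fun_prop)).clm_apply continuous_const
      have h := integral_mul_fderiv_eq_neg_fderiv_mul_of_integrable (μ := (volume : Measure E3))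
        (f := fun y => fderiv ℝ l (r • y) (e k)) (g := radialPotential) (v := e k) ?_ ?_ ?_
        (fun y _ => (hdk y).differentiableAt)
        (fun y _ => (hasFDerivAt_radialPotential y).differentiableAt)
      · rw [h]
        congr 2
        funext y
        rw [(hdk y).fderiv]
        simp
      · have e1 : ∀ y : E3, fderiv ℝ (fun y => fderiv ℝ l (r • y) (e k)) y (e k)
            = r * fderiv ℝ (fun y => fderiv ℝ l y (e k)) (r • y) (e k) := fun y => by
          rw [(hdk y).fderiv]; simp
        simp only [e1]
        exact integrable_of_eq_zero (R := 2)
          ((continuous_const.mul hc2).mul continuous_radialPotential) fun y hy => by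
            rw [radialPotential_eq_zero hy, mul_zero]
      · simp only [fderiv_radialPotential]
        exact integrable_of_eq_zero (R := 2) (hc1.mul (hη.mul (by fun_prop))) fun y hy => by
            rw [radialBump_eq_zero hy, zero_mul, mul_zero]
      · exact integrable_of_eq_zero (R := 2) (hc1.mul continuous_radialPotential) fun y hy => by
            rw [radialPotential_eq_zero hy, mul_zero]
    have hlk : ∀ k, ContDiff ℝ 1 fun y => fderiv ℝ l y (e k) := fun k =>
      (hs.fderiv_right (m := 1) (by norm_num)).clm_apply contDiff_const
    have e2 : ∀ y : E3, radialBump (‖y‖ ^ 2) * fderiv ℝ l (r • y) y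
        = ∑ k, fderiv ℝ l (r • y) (e k) * fderiv ℝ radialPotential y (e k) := fun y => by
      rw [← sum_coord_mul_clm (fderiv ℝ l (r • y)) y, Finset.mul_sum]
      refine Finset.sum_congr rfl fun k _ => ?_
      rw [fderiv_radialPotential]; ring
    rw [funext e2]
    rw [integral_finsetSum, Finset.sum_congr rfl fun k _ => hk k, Finset.sum_neg_distrib,
      ← integral_finsetSum]
    · rw [neg_eq_zero]
      refine integral_eq_zero_of_ae (ae_of_all _ fun y => ?_)
      rw [Pi.zero_apply]
      beta_reduce
      rw [← Finset.sum_mul, ← Finset.mul_sum, hΔ, mul_zero, zero_mul]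
    · intro k _
      exact integrable_of_eq_zero (R := 2) ((continuous_const.mul ((((hlk k).continuous_fderiv
        (by simp)).comp (by fun_prop)).clm_apply continuous_const)).mul
          continuous_radialPotential) fun y hy => by rw [radialPotential_eq_zero hy, mul_zero]
    · intro k _
      simp only [fderiv_radialPotential]
      exact integrable_of_eq_zero (R := 2) (((hlk k).continuous.comp (by fun_prop)).mul
        (hη.mul (by fun_prop))) fun y hy => by rw [radialBump_eq_zero hy, zero_mul, mul_zero]
  · exact integrable_of_eq_zero (R := 2) (hη.mul (hs.continuous.comp (by fun_prop)))
      fun y hy => by rw [radialBump_eq_zero hy, zero_mul]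
  · refine ae_of_all _ fun y s hs' => ?_
    by_cases hy : y ∈ Metric.closedBall (0 : E3) 2
    · rw [indicator_of_mem hy]
      exact hM (s, y) ⟨Metric.ball_subset_closedBall hs', hy⟩
    · rw [indicator_of_notMem hy, radialBump_eq_zero, zero_mul, norm_zero]
      rw [mem_closedBall_zero_iff, not_le] at hy
      exact hy.le
  · exact (integrable_indicator_iff measurableSet_closedBall).2
      (integrableOn_const (measure_closedBall_lt_top.ne) (by simp))

/-- A Liouville theorem: a harmonic function whose mean values over large balls tend to zero
vanishes. -/
theorem eq_zero_of_harmonic_of_average {l : E3 → ℝ} (hs : ContDiff ℝ 2 l)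
    (hΔ : ∀ y, ∑ k, fderiv ℝ (fun y => fderiv ℝ l y (e k)) y (e k) = 0)
    (hl : ∀ ε > 0, ∀ᶠ ρ in atTop,
      ∫⁻ y in Metric.ball (0 : E3) ρ, ‖l y‖ₑ ≤ ENNReal.ofReal (ε * ρ ^ 3)) :
    l 0 = 0 := by
  have hη : Continuous fun y : E3 => radialBump (‖y‖ ^ 2) :=
    radialBump.continuous.comp (by fun_prop)
  let h : ℝ → ℝ := fun r => ∫ y : E3, radialBump (‖y‖ ^ 2) * l (r • y)
  have hd : ∀ r, HasDerivAt h 0 r := hasDerivAt_radial_average hs hΔ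
  have hconst : ∀ r, h r = h 0 := fun r =>
    is_const_of_deriv_eq_zero (fun r => (hd r).differentiableAt) (fun r => (hd r).deriv) r 0
  have h0 : h 0 = (∫ y : E3, radialBump (‖y‖ ^ 2)) * l 0 := by
    simp only [h, zero_smul]
    rw [integral_mul_const]
  have hpos : 0 < ∫ y : E3, radialBump (‖y‖ ^ 2) := by
    refine hη.integral_pos_of_hasCompactSupport_nonneg_nonzero
      (hasCompactSupport_of_eq_zero (R := 2) fun y hy => radialBump_eq_zero hy)
      (fun y => radialBump.nonneg) (x := 0) ?_
    rw [norm_zero, zero_pow two_ne_zero,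
      radialBump.one_of_mem_closedBall (Metric.mem_closedBall_self zero_le_one)]
    exact one_ne_zero
  -- the average at radius `ρ / 2` only involves the ball of radius `ρ`, as the weight is supported
  -- in the ball of radius `2`
  have hb : ∀ ε > 0, ‖h 0‖ₑ ≤ ENNReal.ofReal (8 * ε) := fun ε hε => by
    obtain ⟨ρ, hρ, hρ0⟩ := ((hl ε hε).and (eventually_gt_atTop 0)).exists
    have hr : 0 < ρ / 2 := by linarith
    rw [← hconst (ρ / 2)]
    calc ‖h (ρ / 2)‖ₑ ≤ ∫⁻ y : E3, ‖radialBump (‖y‖ ^ 2) * l ((ρ / 2) • y)‖ₑ :=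
          enorm_integral_le_lintegral_enorm _
      _ ≤ ∫⁻ y : E3, (Metric.ball (0 : E3) ρ).indicator (fun y => ‖l y‖ₑ) ((ρ / 2) • y) := by
          refine lintegral_mono fun y => ?_
          rcases le_or_gt 2 ‖y‖ with hy | hy
          · rw [radialBump_eq_zero hy, zero_mul, enorm_zero]; exact zero_le
          · have hm : (ρ / 2) • y ∈ Metric.ball (0 : E3) ρ := by
              rw [mem_ball_zero_iff, norm_smul, Real.norm_of_nonneg hr.le]; nlinarith
            rw [indicator_of_mem hm, enorm_mul]
            refine mul_le_of_le_one_left zero_le ?_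
            rw [Real.enorm_of_nonneg radialBump.nonneg, ENNReal.ofReal_le_one]
            exact radialBump.le_one
      _ = ENNReal.ofReal (((ρ / 2) ^ 3)⁻¹) * ∫⁻ y in Metric.ball (0 : E3) ρ, ‖l y‖ₑ := by
          rw [lintegral_comp_smul _ hr, lintegral_indicator measurableSet_ball]
      _ ≤ ENNReal.ofReal (((ρ / 2) ^ 3)⁻¹) * ENNReal.ofReal (ε * ρ ^ 3) := by gcongr
      _ = ENNReal.ofReal (8 * ε) := by
          rw [← ENNReal.ofReal_mul (by positivity)]
          congr 1; field_simp; ring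
  have hz : h 0 = 0 := by
    by_contra hne
    have := hb (‖h 0‖ / 16) (by positivity)
    rw [← ofReal_norm, ENNReal.ofReal_le_ofReal_iff (by positivity)] at this
    have h2 : 0 < ‖h 0‖ := norm_pos_iff.2 hne
    linarith
  rw [h0] at hz
  exact (mul_eq_zero.1 hz).resolve_left hpos.ne'

end Liouville

/-! ### Translations and derivatives of test functions -/

section Translation

variable {T : ℝ}

/-- The translate `(t, x) ↦ Φ(t, x - y)` of a test function. Only the space variable is moved, which
preserves the slab. -/
noncomputable def translate (y : E3) (Φ : 𝓓(slab T, ℝ)) : 𝓓(slab T, ℝ) where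
  toFun z := Φ (z - (0, y))
  contDiff' := Φ.contDiff.comp (contDiff_id.sub contDiff_const)
  hasCompactSupport' := Φ.hasCompactSupport.comp_homeomorph (Homeomorph.subRight ((0 : ℝ), y))
  tsupport_subset' := by
    have h : tsupport (fun z => Φ (z - (0, y)))
        = (Homeomorph.subRight ((0 : ℝ), y)) ⁻¹' tsupport Φ :=
      tsupport_comp_eq_preimage Φ (Homeomorph.subRight ((0 : ℝ), y))
    rw [h]
    intro z hz
    have h1 := Φ.tsupport_subset hz
    refine ⟨?_, mem_univ _⟩
    have h2 : z.1 - 0 ∈ Ioo 0 T := h1.1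
    rwa [sub_zero] at h2

theorem translate_apply (y : E3) (Φ : 𝓓(slab T, ℝ)) (z : ℝ × E3) :
    translate y Φ z = Φ (z - (0, y)) := rfl

theorem translate_zero (Φ : 𝓓(slab T, ℝ)) : translate 0 Φ = Φ := by
  ext z; rw [translate_apply, ← Prod.zero_eq_mk, sub_zero]

theorem lineDeriv_translate (v : ℝ × E3) (y : E3) (Φ : 𝓓(slab T, ℝ)) :
    ∂_{v} (translate y Φ) = translate y (∂_{v} Φ : 𝓓(slab T, ℝ)) := by
  ext z
  rw [translate_apply, lineDeriv_testFunction_apply, lineDeriv_testFunction_apply]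
  have : (translate y Φ : ℝ × E3 → ℝ) = fun z => Φ (z - (0, y)) := rfl
  rw [this, fderiv_comp_sub]

theorem lineDeriv_comm_testFunction {Ω : Opens (ℝ × E3)} (v w : ℝ × E3) (Φ : 𝓓(Ω, ℝ)) :
    ∂_{v} (∂_{w} Φ : 𝓓(Ω, ℝ)) = (∂_{w} (∂_{v} Φ : 𝓓(Ω, ℝ)) : 𝓓(Ω, ℝ)) := by
  have h : ∀ (v w : ℝ × E3) (z : ℝ × E3), (∂_{v} (∂_{w} Φ : 𝓓(Ω, ℝ)) : 𝓓(Ω, ℝ)) z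
      = fderiv ℝ (fderiv ℝ Φ) z v w := fun v w z => by
    rw [lineDeriv_testFunction_apply]
    have e1 : ((∂_{w} Φ : 𝓓(Ω, ℝ)) : ℝ × E3 → ℝ) = fun z => fderiv ℝ Φ z w := by
      funext z; rw [lineDeriv_testFunction_apply]
    have hd : DifferentiableAt ℝ (fderiv ℝ Φ) z :=
      ((contDiff_infty.1 Φ.contDiff 2).fderiv_right (m := 1)
        (by norm_num)).differentiable (by simp) z
    rw [e1, fderiv_clm_apply hd (differentiableAt_const w)]
    simp
  ext z
  rw [h, h]
  have hs : IsSymmSndFDerivAt ℝ Φ z :=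
    ((contDiff_infty.1 Φ.contDiff 2).contDiffAt (x := z)).isSymmSndFDerivAt (by simp)
  exact hs.eq v w

theorem lineDeriv_comm_distribution {Ω : Opens (ℝ × E3)} (v w : ℝ × E3) (S : 𝓓'(Ω, ℝ)) :
    ∂_{v} (∂_{w} S : 𝓓'(Ω, ℝ)) = (∂_{w} (∂_{v} S : 𝓓'(Ω, ℝ)) : 𝓓'(Ω, ℝ)) := by
  ext Φ
  simp only [Distribution.lineDerivOp_apply_apply, LineDeriv.lineDerivOp_neg, neg_neg]
  rw [lineDeriv_comm_testFunction]

end Translation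

/-! ### Functions with small averages -/

section SmallAverages

/-- The integral over `(0,T) × B(0,ρ)` is `o(ρ³)`. -/
def SmallAverages (T : ℝ) (G : ℝ × E3 → ℝ≥0∞) : Prop :=
  ∀ ε > 0, ∀ᶠ ρ in atTop,
    ∫⁻ z in Ioo 0 T ×ˢ Metric.ball (0 : E3) ρ, G z ≤ ENNReal.ofReal (ε * ρ ^ 3)

/-- Young's inequality in a weak form: `|a|` is at most `ε` or at most `ε ^ (1 - p) |a| ^ p`. -/
theorem enorm_le_add_rpow {p ε : ℝ} (hp : 1 ≤ p) (hε : 0 < ε) (a : ℝ) :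
    ‖a‖ₑ ≤ ENNReal.ofReal ε + ENNReal.ofReal (ε ^ (1 - p)) * ‖a‖ₑ ^ p := by
  rcases le_or_gt ‖a‖ ε with h | h
  · refine le_add_right ?_
    rw [← ofReal_norm]
    exact ENNReal.ofReal_le_ofReal h
  · refine le_add_left ?_
    have h0 : 0 < ‖a‖ := hε.trans h
    rw [← ofReal_norm, ENNReal.ofReal_rpow_of_pos h0, ← ENNReal.ofReal_mul (by positivity)]
    refine ENNReal.ofReal_le_ofReal ?_
    have h1 : ‖a‖ ^ (1 - p) ≤ ε ^ (1 - p) :=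
      Real.rpow_le_rpow_of_nonpos hε h.le (by linarith)
    calc ‖a‖ = ‖a‖ ^ (1 - p) * ‖a‖ ^ p := by rw [← Real.rpow_add h0]; simp
      _ ≤ _ := by gcongr

/-- As the volume of the cylinder is `O(ρ³)`, small averages of `|f| ^ p` imply small averages of
`|f|`. -/
theorem SmallAverages.of_rpow {T p : ℝ} (hp : 1 ≤ p) {f : ℝ → E3 → ℝ}
    (h : SmallAverages T fun z => ‖f z.1 z.2‖ₑ ^ p) : SmallAverages T fun z => ‖f z.1 z.2‖ₑ := by
  intro ε hε
  obtain ⟨V, hV0, hV⟩ : ∃ V : ℝ, 0 < V ∧ ∀ ρ > 0,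
      volume (Ioo 0 T ×ˢ Metric.ball (0 : E3) ρ) ≤ ENNReal.ofReal (V * ρ ^ 3) := by
    refine ⟨(|T| + 1) * (Real.pi * 4 / 3), by positivity, fun ρ hρ => ?_⟩
    rw [Measure.volume_eq_prod, Measure.prod_prod, Real.volume_Ioo, sub_zero,
      EuclideanSpace.volume_ball_fin_three, ← ENNReal.ofReal_pow hρ.le,
      ← ENNReal.ofReal_mul (by positivity), mul_assoc,
      ENNReal.ofReal_mul (p := |T| + 1) (by positivity)]
    gcongr ?_ * ?_
    · exact ENNReal.ofReal_le_ofReal (by linarith [le_abs_self T])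
    · exact le_of_eq (by ring_nf)
  set ε₁ := ε / (2 * V) with hε₁
  have hε₁0 : 0 < ε₁ := by positivity
  set c := ε₁ ^ (1 - p) with hc
  have hc0 : 0 < c := by positivity
  filter_upwards [h (ε / (2 * c)) (by positivity), eventually_gt_atTop 0] with ρ h1 hρ
  calc ∫⁻ z in Ioo 0 T ×ˢ Metric.ball (0 : E3) ρ, ‖f z.1 z.2‖ₑ
      ≤ ∫⁻ z in Ioo 0 T ×ˢ Metric.ball (0 : E3) ρ,
        (ENNReal.ofReal ε₁ + ENNReal.ofReal c * ‖f z.1 z.2‖ₑ ^ p) :=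
        lintegral_mono fun z => enorm_le_add_rpow hp hε₁0 _
    _ = ENNReal.ofReal ε₁ * volume (Ioo 0 T ×ˢ Metric.ball (0 : E3) ρ) + ENNReal.ofReal c *
        ∫⁻ z in Ioo 0 T ×ˢ Metric.ball (0 : E3) ρ, ‖f z.1 z.2‖ₑ ^ p := by
        rw [lintegral_add_left measurable_const, lintegral_const, Measure.restrict_apply_univ,
          lintegral_const_mul' _ _ ENNReal.ofReal_ne_top]
    _ ≤ ENNReal.ofReal ε₁ * ENNReal.ofReal (V * ρ ^ 3) +
        ENNReal.ofReal c * ENNReal.ofReal (ε / (2 * c) * ρ ^ 3) := by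
        gcongr; exact hV ρ hρ
    _ = ENNReal.ofReal (ε * ρ ^ 3) := by
        rw [← ENNReal.ofReal_mul hε₁0.le, ← ENNReal.ofReal_mul hc0.le,
          ← ENNReal.ofReal_add (by positivity) (by positivity)]
        congr 1; rw [hε₁]; field_simp; ring

/-- A function in a weighted Lebesgue space has small averages when the weight `w_δ` decays
slower than the reciprocal of the volume: the integral of `|f| ^ p` over the cylinder of radius `ρ`
is `O(ρ ^ δ)`. -/
theorem SmallAverages.of_memLp {T δ : ℝ} {p : ℝ≥0∞} (hδ : 0 ≤ δ) (hδ3 : δ < 3) (hp : 1 ≤ p)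
    (hpt : p ≠ ∞) {f : ℝ → E3 → ℝ}
    (hf : MemLp (Function.uncurry f) p ((volume.restrict (Ioo 0 T)).prod (weighted δ))) :
    SmallAverages T fun z => ‖f z.1 z.2‖ₑ := by
  have hp0 : p ≠ 0 := (one_pos.trans_le hp).ne'
  have hp1 : 1 ≤ p.toReal := by rw [← ENNReal.toReal_one]; exact ENNReal.toReal_mono hpt hp
  refine SmallAverages.of_rpow hp1 ?_
  set A := ∫⁻ z, ‖Function.uncurry f z‖ₑ ^ p.toReal ∂((volume.restrict (Ioo 0 T)).prod (weighted δ))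
    with hA
  have hAt : A ≠ ∞ := by
    have h1 := hf.2
    rw [eLpNorm_eq_lintegral_rpow_enorm_toReal hp0 hpt] at h1
    intro h
    rw [← hA, h, ENNReal.top_rpow_of_pos (by positivity)] at h1
    exact lt_irrefl _ h1
  have hAe : A = ∫⁻ t in Ioo 0 T, ∫⁻ x, ‖f t x‖ₑ ^ p.toReal ∂(weighted δ) :=
    lintegral_prod _ (hf.1.enorm.pow_const _)
  have hm : AEStronglyMeasurable (Function.uncurry f) ((volume.restrict (Ioo 0 T)).prod volume) :=
    hf.1.mono_ac (Measure.AbsolutelyContinuous.rfl.prod (volume_absolutelyContinuous_weighted δ))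
  have hb : ∀ ρ > 0, ∫⁻ z in Ioo 0 T ×ˢ Metric.ball (0 : E3) ρ, ‖f z.1 z.2‖ₑ ^ p.toReal
      ≤ ENNReal.ofReal ((1 + ρ) ^ δ) * A := fun ρ hρ => by
    have hm' : AEMeasurable (fun z : ℝ × E3 => ‖f z.1 z.2‖ₑ ^ p.toReal)
        ((volume.restrict (Ioo 0 T)).prod (volume.restrict (Metric.ball 0 ρ))) :=
      (hm.mono_ac (Measure.AbsolutelyContinuous.rfl.prod
        Measure.restrict_le_self.absolutelyContinuous)).enorm.pow_const _
    rw [Measure.volume_eq_prod, ← Measure.prod_restrict, lintegral_prod _ hm', hAe,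
      ← lintegral_const_mul' _ _ ENNReal.ofReal_ne_top]
    refine lintegral_mono_ae ?_
    filter_upwards [hm.prodMk_left] with t ht
    have hmt : AEMeasurable (fun x => ‖f t x‖ₑ ^ p.toReal) volume := ht.enorm.pow_const _
    rw [weighted, lintegral_withDensity_eq_lintegral_mul₀ (by fun_prop) hmt,
      ← lintegral_const_mul' _ _ ENNReal.ofReal_ne_top, ← lintegral_indicator measurableSet_ball]
    refine lintegral_mono fun x => ?_
    by_cases hx : x ∈ Metric.ball (0 : E3) ρ
    · rw [indicator_of_mem hx, Pi.mul_apply, ← mul_assoc, ← ENNReal.ofReal_mul (by positivity)]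
      refine le_mul_of_one_le_left zero_le ?_
      rw [ENNReal.one_le_ofReal, Real.rpow_neg (by positivity), ← div_eq_mul_inv,
        one_le_div (by positivity)]
      rw [mem_ball_zero_iff] at hx
      exact Real.rpow_le_rpow (by positivity) (by linarith) hδ
    · rw [indicator_of_notMem hx]; exact zero_le
  intro ε hε
  have ht : Tendsto (fun ρ : ℝ => 2 ^ δ * A.toReal * ρ ^ (-(3 - δ))) atTop (𝓝 0) := by
    simpa using (tendsto_rpow_neg_atTop (by linarith : 0 < 3 - δ)).const_mul (2 ^ δ * A.toReal)
  filter_upwards [ht.eventually_le_const hε, eventually_ge_atTop 1] with ρ h1 h2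
  have hρ : 0 < ρ := by linarith
  refine (hb ρ hρ).trans ?_
  rw [← ENNReal.ofReal_toReal hAt, ← ENNReal.ofReal_mul (by positivity)]
  refine ENNReal.ofReal_le_ofReal ?_
  calc (1 + ρ) ^ δ * A.toReal ≤ (2 * ρ) ^ δ * A.toReal := by
        gcongr; linarith
    _ = 2 ^ δ * A.toReal * ρ ^ (-(3 - δ)) * ρ ^ 3 := by
        rw [Real.mul_rpow (by norm_num) hρ.le, mul_assoc (2 ^ δ * A.toReal), ← Real.rpow_natCast,
          ← Real.rpow_add hρ]
        have : -(3 - δ) + ((3 : ℕ) : ℝ) = δ := by push_cast; ring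
        rw [this]; ring
    _ ≤ ε * ρ ^ 3 := by gcongr

theorem SmallAverages.of_mul_self {T : ℝ} {f : ℝ → E3 → ℝ}
    (h : SmallAverages T fun z => ‖f z.1 z.2 * f z.1 z.2‖ₑ) :
    SmallAverages T fun z => ‖f z.1 z.2‖ₑ := by
  refine SmallAverages.of_rpow (p := 2) (by norm_num) ?_
  convert h using 2 with z
  rw [enorm_mul, ENNReal.rpow_two, sq]

end SmallAverages

/-! ### Distributions that are null at infinity -/

section NullAtInfinity

open scoped Convolution

variable {T : ℝ}

/-- A distribution on `(0,T) × ℝ³` whose regularizations `y ↦ ⟨S, Φ(·, · - y)⟩` are smooth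
functions with mean values tending to zero over large balls. The class is stable under sums and
under derivatives of any order. The smoothness and the formula for the gradient are part of the
definition, since they are only needed for derivatives of functions, for which they are immediate
from the theory of convolutions. -/
structure IsNullAtInfinity (S : 𝓓'(slab T, ℝ)) : Prop where
  contDiff : ∀ Φ, ContDiff ℝ (⊤ : ℕ∞) fun y => S (translate y Φ)
  fderiv_eq : ∀ Φ k y, fderiv ℝ (fun y => S (translate y Φ)) y (e k)
    = -S (translate y (∂_{((0 : ℝ), e k)} Φ : 𝓓(slab T, ℝ)))
  average : ∀ Φ, ∀ ε > 0, ∀ᶠ ρ in atTop,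
    ∫⁻ y in Metric.ball (0 : E3) ρ, ‖S (translate y Φ)‖ₑ ≤ ENNReal.ofReal (ε * ρ ^ 3)

theorem IsNullAtInfinity.add {S S' : 𝓓'(slab T, ℝ)} (h : IsNullAtInfinity S)
    (h' : IsNullAtInfinity S') : IsNullAtInfinity (S + S') where
  contDiff Φ := (h.contDiff Φ).add (h'.contDiff Φ)
  fderiv_eq Φ k y := by
    have e1 : (fun y => (S + S') (translate y Φ))
        = (fun y => S (translate y Φ)) + fun y => S' (translate y Φ) := rfl
    rw [e1, fderiv_add ((h.contDiff Φ).differentiable (by simp) y)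
      ((h'.contDiff Φ).differentiable (by simp) y), _root_.add_apply, h.fderiv_eq, h'.fderiv_eq,
      ← neg_add]
    rfl
  average Φ ε hε := by
    filter_upwards [h.average Φ (ε / 2) (by positivity), h'.average Φ (ε / 2) (by positivity),
      eventually_ge_atTop 0] with ρ h1 h2 hρ
    calc ∫⁻ y in Metric.ball (0 : E3) ρ, ‖(S + S') (translate y Φ)‖ₑ
        ≤ ∫⁻ y in Metric.ball (0 : E3) ρ, (‖S (translate y Φ)‖ₑ + ‖S' (translate y Φ)‖ₑ) :=
          lintegral_mono fun y => enorm_add_le _ _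
      _ ≤ ENNReal.ofReal (ε / 2 * ρ ^ 3) + ENNReal.ofReal (ε / 2 * ρ ^ 3) := by
          rw [lintegral_add_left (h.contDiff Φ).continuous.enorm.measurable]
          exact add_le_add h1 h2
      _ = ENNReal.ofReal (ε * ρ ^ 3) := by
          rw [← ENNReal.ofReal_add (by positivity) (by positivity)]; congr 1; ring

theorem IsNullAtInfinity.neg {S : 𝓓'(slab T, ℝ)} (h : IsNullAtInfinity S) :
    IsNullAtInfinity (-S) where
  contDiff Φ := (h.contDiff Φ).neg
  fderiv_eq Φ k y := by
    have e1 : (fun y => (-S) (translate y Φ)) = -fun y => S (translate y Φ) := rfl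
    rw [e1, fderiv_neg, _root_.neg_apply, h.fderiv_eq]
    rfl
  average Φ ε hε := by
    filter_upwards [h.average Φ ε hε] with ρ h1
    refine le_trans (le_of_eq ?_) h1
    exact lintegral_congr fun y => enorm_neg _

theorem IsNullAtInfinity.sub {S S' : 𝓓'(slab T, ℝ)} (h : IsNullAtInfinity S)
    (h' : IsNullAtInfinity S') : IsNullAtInfinity (S - S') := by
  rw [sub_eq_add_neg]; exact h.add h'.neg

theorem isNullAtInfinity_zero : IsNullAtInfinity (0 : 𝓓'(slab T, ℝ)) where
  contDiff Φ := contDiff_const (c := (0 : ℝ))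
  fderiv_eq Φ k y := by
    have e1 : (fun y => (0 : 𝓓'(slab T, ℝ)) (translate y Φ)) = fun _ => (0 : ℝ) := rfl
    rw [e1, fderiv_fun_const]
    exact neg_zero.symm
  average Φ ε hε := by
    refine Eventually.of_forall fun ρ => ?_
    simp

theorem IsNullAtInfinity.sum {ι : Type*} (s : Finset ι) {S : ι → 𝓓'(slab T, ℝ)}
    (h : ∀ i ∈ s, IsNullAtInfinity (S i)) : IsNullAtInfinity (∑ i ∈ s, S i) :=
  Finset.sum_induction S IsNullAtInfinity (fun _ _ => IsNullAtInfinity.add)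
    isNullAtInfinity_zero h

/-- The derivative falls on the test function. -/
theorem IsNullAtInfinity.lineDeriv {S : 𝓓'(slab T, ℝ)} (h : IsNullAtInfinity S) (v : ℝ × E3) :
    IsNullAtInfinity (∂_{v} S : 𝓓'(slab T, ℝ)) := by
  have e1 : ∀ y Φ, (∂_{v} S : 𝓓'(slab T, ℝ)) (translate y Φ)
      = (-S) (translate y (∂_{v} Φ : 𝓓(slab T, ℝ))) := fun y Φ => by
    rw [Distribution.lineDerivOp_apply_apply, map_neg, lineDeriv_translate]; rfl
  refine ⟨fun Φ => ?_, fun Φ k y => ?_, fun Φ => ?_⟩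
  · simp only [e1]; exact h.neg.contDiff _
  · simp only [e1]
    rw [h.neg.fderiv_eq, lineDeriv_comm_testFunction]
  · simp only [e1]; exact h.neg.average _

theorem exists_testFunction_bound {Ω : Opens (ℝ × E3)} (Φ : 𝓓(Ω, ℝ)) :
    ∃ M K : ℝ, 0 < K ∧ 0 ≤ M ∧ ∀ z, ‖Φ z‖ₑ
      ≤ (Metric.ball (0 : E3) K).indicator (fun _ => ENNReal.ofReal M) z.2 := by
  obtain ⟨M, hM⟩ := Φ.hasCompactSupport.exists_bound_of_continuous Φ.contDiff.continuous
  obtain ⟨K, hK⟩ := Φ.hasCompactSupport.isCompact.isBounded.subset_ball (0 : ℝ × E3)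
  refine ⟨M, |K| + 1, by positivity, (norm_nonneg _).trans (hM 0), fun z => ?_⟩
  by_cases hz : z.2 ∈ Metric.ball (0 : E3) (|K| + 1)
  · rw [indicator_of_mem hz, ← ofReal_norm]
    exact ENNReal.ofReal_le_ofReal (hM z)
  · rw [image_eq_zero_of_notMem_tsupport (f := Φ), enorm_zero]
    · exact zero_le
    · intro h
      have h1 := hK h
      rw [mem_ball_zero_iff] at h1 hz
      have h2 : ‖z.2‖ ≤ ‖z‖ := norm_snd_le z
      linarith [le_abs_self K]

/-- Functions with small averages define distributions that are null at infinity. -/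
theorem isNullAtInfinity_toDistr {f : ℝ → E3 → ℝ} (hf : SlabIntegrable T f)
    (hs : SmallAverages T fun z => ‖f z.1 z.2‖ₑ) : IsNullAtInfinity (toDistr (slab T) f) := by
  set F : ℝ × E3 → ℝ := (Ioo 0 T ×ˢ univ).indicator (Function.uncurry f) with hF
  have hms : MeasurableSet (Ioo 0 T ×ˢ (univ : Set E3)) := measurableSet_Ioo.prod MeasurableSet.univ
  have hFl : LocallyIntegrable F := fun z => by
    refine ⟨univ ×ˢ Metric.ball (0 : E3) (‖z.2‖ + 1), (isOpen_univ.prod Metric.isOpen_ball).mem_nhds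
      ⟨mem_univ _, ?_⟩, ?_⟩
    · rw [mem_ball_zero_iff]; linarith
    · rw [hF, IntegrableOn, integrable_indicator_iff hms, IntegrableOn,
        Measure.restrict_restrict hms, prod_inter_prod, inter_univ, univ_inter]
      exact hf _
  let L := ContinuousLinearMap.mul ℝ ℝ
  have : (volume : Measure (ℝ × E3)).IsAddHaarMeasure :=
    inferInstanceAs ((volume : Measure ℝ).prod (volume : Measure E3)).IsAddHaarMeasure
  -- the regularization is a convolution on space-time, restricted to time zero
  have hconv : ∀ (Φ : 𝓓(slab T, ℝ)) (y : E3), toDistr (slab T) f (translate y Φ)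
      = (F ⋆[L, volume] fun w => Φ (-w)) (0, y) := fun Φ y => by
    rw [toDistr_apply hf.locallyIntegrableOn, convolution_def]
    refine integral_congr_ae (ae_of_all _ fun z => ?_)
    beta_reduce
    rw [translate_apply, neg_sub, ContinuousLinearMap.mul_apply', hF]
    by_cases hz : z ∈ Ioo 0 T ×ˢ (univ : Set E3)
    · rw [indicator_of_mem hz, mul_comm]; rfl
    · rw [indicator_of_notMem hz, zero_mul,
        image_eq_zero_of_notMem_tsupport (f := Φ), zero_mul]
      intro h
      have := Φ.tsupport_subset h
      refine hz ⟨?_, mem_univ _⟩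
      have h2 : z.1 - 0 ∈ Ioo 0 T := this.1
      rwa [sub_zero] at h2
  have hg : ∀ Φ : 𝓓(slab T, ℝ), ContDiff ℝ (⊤ : ℕ∞) fun w => Φ (-w) := fun Φ =>
    Φ.contDiff.comp contDiff_neg
  have hgc : ∀ Φ : 𝓓(slab T, ℝ), HasCompactSupport fun w => Φ (-w) := fun Φ =>
    Φ.hasCompactSupport.comp_homeomorph (Homeomorph.neg _)
  refine ⟨fun Φ => ?_, fun Φ k y => ?_, fun Φ ε hε => ?_⟩
  · simp only [hconv]
    exact ((hgc Φ).contDiff_convolution_right L hFl (hg Φ)).comp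
      (contDiff_const.prodMk contDiff_id)
  · simp only [hconv]
    have h1 := (hgc Φ).hasFDerivAt_convolution_right L hFl ((hg Φ).of_le (by simp)) ((0 : ℝ), y)
    have h2 := h1.comp y (hasFDerivAt_prodMk_right (0 : ℝ) y)
    have h3 : fderiv ℝ (fun y : E3 => (F ⋆[L, volume] fun w => Φ (-w)) (0, y)) y = _ := h2.fderiv
    rw [h3, ContinuousLinearMap.comp_apply, ContinuousLinearMap.inr_apply,
      convolution_precompR_apply L hFl ((hgc Φ).fderiv ℝ) ((hg Φ).continuous_fderiv (by simp)),
      convolution_def, convolution_def, ← integral_neg]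
    refine integral_congr_ae (ae_of_all _ fun z => ?_)
    beta_reduce
    have h4 : HasFDerivAt (fun w => Φ (-w)) ((fderiv ℝ Φ (-((0, y) - z))).comp
        (-ContinuousLinearMap.id ℝ (ℝ × E3))) ((0, y) - z) :=
      (Φ.contDiff.differentiable (by simp) _).hasFDerivAt.comp _ (hasFDerivAt_id _).neg
    rw [h4.fderiv, lineDeriv_testFunction_apply]
    simp [L]
  · obtain ⟨M, K, hK, hM, hb⟩ := exists_testFunction_bound Φ
    have hI : ∫⁻ y, (Metric.ball (0 : E3) K).indicator (fun _ => ENNReal.ofReal M) y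
        = ENNReal.ofReal (M * (volume (Metric.ball (0 : E3) K)).toReal) := by
      rw [lintegral_indicator_const measurableSet_ball, ENNReal.ofReal_mul hM,
        ENNReal.ofReal_toReal measure_ball_lt_top.ne]
    set c := M * (volume (Metric.ball (0 : E3) K)).toReal with hc
    have hc0 : 0 ≤ c := by positivity
    have hmain : ∀ ρ, ∫⁻ y in Metric.ball (0 : E3) ρ, ‖toDistr (slab T) f (translate y Φ)‖ₑ
        ≤ ENNReal.ofReal c * ∫⁻ z in Ioo 0 T ×ˢ Metric.ball (0 : E3) (ρ + K), ‖f z.1 z.2‖ₑ :=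
      fun ρ => by
      have hind : Measurable ((Metric.ball (0 : E3) K).indicator fun _ => ENNReal.ofReal M) :=
        measurable_const.indicator measurableSet_ball
      -- the regularization at `y` only sees `f` in the ball of radius `K` about `y`
      have h1 : ∀ y, ‖toDistr (slab T) f (translate y Φ)‖ₑ ≤ ∫⁻ z : ℝ × E3,
          (Metric.ball (0 : E3) K).indicator (fun _ => ENNReal.ofReal M) (z.2 - y) * ‖F z‖ₑ :=
        fun y => by
        rw [hconv, convolution_def]
        refine (enorm_integral_le_lintegral_enorm _).trans (lintegral_mono fun z => ?_)
        rw [ContinuousLinearMap.mul_apply', enorm_mul, mul_comm, neg_sub]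
        exact mul_le_mul_left (hb _) _
      refine (lintegral_mono h1).trans ?_
      rw [lintegral_lintegral_swap, ← lintegral_const_mul' _ _ ENNReal.ofReal_ne_top,
        ← lintegral_indicator (measurableSet_Ioo.prod measurableSet_ball)]
      · refine lintegral_mono fun z => ?_
        beta_reduce
        rw [lintegral_mul_const' _ _ enorm_ne_top]
        by_cases hz : z ∈ Ioo 0 T ×ˢ Metric.ball (0 : E3) (ρ + K)
        · rw [indicator_of_mem hz, hF, indicator_of_mem
            (show z ∈ Ioo 0 T ×ˢ (univ : Set E3) from ⟨hz.1, mem_univ _⟩), ← hI]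
          refine mul_le_mul_left ((setLIntegral_le_lintegral _ _).trans (le_of_eq ?_)) _
          exact lintegral_sub_left_eq_self _ z.2
        · rw [indicator_of_notMem hz]
          by_cases hz1 : z.1 ∈ Ioo 0 T
          · rw [setLIntegral_eq_zero measurableSet_ball, zero_mul]
            intro y hy
            refine indicator_of_notMem (fun h => hz ⟨hz1, ?_⟩) _
            rw [mem_ball_zero_iff] at h hy ⊢
            calc ‖z.2‖ = ‖y + (z.2 - y)‖ := by rw [add_sub_cancel]
              _ ≤ ‖y‖ + ‖z.2 - y‖ := norm_add_le _ _
              _ < ρ + K := add_lt_add hy h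
          · rw [hF, indicator_of_notMem (fun h => hz1 h.1), enorm_zero, mul_zero]
      · exact (hind.comp (by fun_prop)).aemeasurable.mul
          hFl.aestronglyMeasurable.enorm.comp_snd
    -- the radius `ρ + K` is at most `2 ρ`, which costs a factor `8` in the volume
    have hlim : Tendsto (fun ρ : ℝ => ρ + K) atTop atTop :=
      tendsto_atTop_add_const_right _ _ tendsto_id
    filter_upwards [hlim.eventually (hs (ε / (8 * (c + 1))) (by positivity)), eventually_ge_atTop K]
      with ρ h1 h2
    refine (hmain ρ).trans ((mul_le_mul_right h1 _).trans ?_)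
    rw [← ENNReal.ofReal_mul hc0]
    refine ENNReal.ofReal_le_ofReal ?_
    have hρ : 0 ≤ ρ := hK.le.trans h2
    have h3 : (ρ + K) ^ 3 ≤ 8 * ρ ^ 3 := by
      calc (ρ + K) ^ 3 ≤ (2 * ρ) ^ 3 := pow_le_pow_left₀ (by linarith) (by linarith) 3
        _ = 8 * ρ ^ 3 := by ring
    calc c * (ε / (8 * (c + 1)) * (ρ + K) ^ 3)
        ≤ (c + 1) * (ε / (8 * (c + 1)) * (8 * ρ ^ 3)) := by
          gcongr
          linarith
      _ = ε * ρ ^ 3 := by field_simp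

/-- A harmonic distribution that is null at infinity vanishes: its regularizations are harmonic, so
the Liouville theorem applies to each of them. -/
theorem IsNullAtInfinity.eq_zero {S : 𝓓'(slab T, ℝ)} (h : IsNullAtInfinity S)
    (hΔ : ∑ k, dx k (dx k S) = 0) : S = 0 := by
  ext Φ
  have h0 := eq_zero_of_harmonic_of_average (l := fun y => S (translate y Φ))
    (contDiff_infty.1 (h.contDiff Φ) 2) (fun y => ?_) (h.average Φ)
  · rw [translate_zero] at h0; exact h0
  · have e1 : ∀ k, fderiv ℝ (fun y => fderiv ℝ (fun y => S (translate y Φ)) y (e k)) y (e k)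
        = dx k (dx k S) (translate y Φ) := fun k => by
      simp only [h.fderiv_eq]
      have := h.neg.fderiv_eq (∂_{((0 : ℝ), e k)} Φ : 𝓓(slab T, ℝ)) k y
      refine this.trans ?_
      simp only [dx, Distribution.lineDerivOp_apply_apply, LineDeriv.lineDerivOp_neg,
        lineDeriv_translate, neg_neg]
      exact neg_neg _
    simp only [e1]
    have := congrArg (fun S : 𝓓'(slab T, ℝ) => S (translate y Φ)) hΔ
    simpa [Fin.sum_univ_three] using this

end NullAtInfinity

/-! ### The Laplacian of the pressure -/

section PressureEquation

variable {T : ℝ} {Ω : Opens (ℝ × E3)}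

theorem dx_sub (k : Fin 3) (S S' : 𝓓'(Ω, ℝ)) : dx k (S - S') = dx k S - dx k S' := by
  simp only [dx, sub_eq_add_neg, LineDeriv.lineDerivOp_add, LineDeriv.lineDerivOp_neg]

theorem dx_add (k : Fin 3) (S S' : 𝓓'(Ω, ℝ)) : dx k (S + S') = dx k S + dx k S' :=
  LineDeriv.lineDerivOp_add _ _ _

theorem dx_zero (k : Fin 3) : dx k (0 : 𝓓'(Ω, ℝ)) = 0 := LineDeriv.lineDerivOp_zero _

theorem dx_sum {ι : Type*} (k : Fin 3) (s : Finset ι) (S : ι → 𝓓'(Ω, ℝ)) :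
    dx k (∑ i ∈ s, S i) = ∑ i ∈ s, dx k (S i) :=
  LineDeriv.lineDerivOp_sum _ _ _

theorem dx_comm (j k : Fin 3) (S : 𝓓'(Ω, ℝ)) : dx j (dx k S) = dx k (dx j S) :=
  lineDeriv_comm_distribution _ _ _

theorem dx_dt (k : Fin 3) (S : 𝓓'(Ω, ℝ)) : dx k (dt S) = dt (dx k S) :=
  lineDeriv_comm_distribution _ _ _

theorem SlabIntegrable.sub {f g : ℝ → E3 → ℝ} (hf : SlabIntegrable T f) (hg : SlabIntegrable T g) :
    SlabIntegrable T fun t x => f t x - g t x := fun R => (hf R).sub (hg R)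

theorem SlabIntegrable.sum {ι : Type*} (s : Finset ι) {f : ι → ℝ → E3 → ℝ}
    (hf : ∀ i ∈ s, SlabIntegrable T (f i)) : SlabIntegrable T fun t x => ∑ i ∈ s, f i t x :=
  fun R => integrable_finsetSum s fun i hi => hf i hi R

theorem SlabIntegrable.integrable_test_mul {f : ℝ → E3 → ℝ} (hf : SlabIntegrable T f)
    (Φ : 𝓓(slab T, ℝ)) :
    IntegrableOn (fun z : ℝ × E3 => Φ z * f z.1 z.2) (Ioo 0 T ×ˢ univ) := by
  obtain ⟨M, hM⟩ := Φ.hasCompactSupport.exists_bound_of_continuous Φ.contDiff.continuous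
  obtain ⟨K, hK⟩ := Φ.hasCompactSupport.isCompact.isBounded.subset_ball (0 : ℝ × E3)
  refine hf.integrable_mul Φ.contDiff.continuous hM (R := K) fun z hz =>
    image_eq_zero_of_notMem_tsupport fun h => ?_
  have h1 := hK h
  rw [mem_ball_zero_iff] at h1
  linarith [norm_snd_le z]

theorem toDistr_apply_setIntegral {f : ℝ → E3 → ℝ} (hf : SlabIntegrable T f) (Φ : 𝓓(slab T, ℝ)) :
    toDistr (slab T) f Φ = ∫ z in Ioo 0 T ×ˢ univ, Φ z * f z.1 z.2 := by
  rw [toDistr_apply hf.locallyIntegrableOn, setIntegral_eq_integral_of_forall_compl_eq_zero]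
  intro z hz
  rw [image_eq_zero_of_notMem_tsupport (f := Φ) (mt (fun h => Φ.tsupport_subset h) hz), zero_mul]

theorem toDistr_sub {f g : ℝ → E3 → ℝ} (hf : SlabIntegrable T f) (hg : SlabIntegrable T g) :
    toDistr (slab T) (fun t x => f t x - g t x) = toDistr (slab T) f - toDistr (slab T) g := by
  ext Φ
  change _ = toDistr (slab T) f Φ - toDistr (slab T) g Φ
  rw [toDistr_apply_setIntegral (hf.sub hg), toDistr_apply_setIntegral hf,
    toDistr_apply_setIntegral hg, ← integral_sub (hf.integrable_test_mul Φ)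
    (hg.integrable_test_mul Φ)]
  simp only [mul_sub]

theorem sum_distribution_apply {ι : Type*} (s : Finset ι) (S : ι → 𝓓'(Ω, ℝ)) (Φ : 𝓓(Ω, ℝ)) :
    (∑ i ∈ s, S i) Φ = ∑ i ∈ s, S i Φ := by
  classical
  induction s using Finset.induction_on with
  | empty => rfl
  | insert a s ha ih => rw [Finset.sum_insert ha, Finset.sum_insert ha, ← ih]; rfl

theorem toDistr_sum {ι : Type*} (s : Finset ι) {f : ι → ℝ → E3 → ℝ}
    (hf : ∀ i ∈ s, SlabIntegrable T (f i)) :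
    toDistr (slab T) (fun t x => ∑ i ∈ s, f i t x) = ∑ i ∈ s, toDistr (slab T) (f i) := by
  ext Φ
  rw [sum_distribution_apply, toDistr_apply_setIntegral (SlabIntegrable.sum s hf),
    Finset.sum_congr rfl fun i hi => toDistr_apply_setIntegral (hf i hi) Φ,
    ← integral_finsetSum s fun i hi => (hf i hi).integrable_test_mul Φ]
  simp only [Finset.mul_sum]

/-- The restriction of a test function to a time slice. -/
noncomputable def timeSlice (Φ : 𝓓(slab T, ℝ)) (t : ℝ) : 𝓢(E3, ℝ) :=
  slice Φ.hasCompactSupport Φ.contDiff t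

theorem timeSlice_apply (Φ : 𝓓(slab T, ℝ)) (t : ℝ) (x : E3) : timeSlice Φ t x = Φ (t, x) := rfl

theorem lineDeriv_timeSlice (k : Fin 3) (Φ : 𝓓(slab T, ℝ)) (t : ℝ) :
    ∂_{e k} (timeSlice Φ t) = timeSlice (∂_{((0 : ℝ), e k)} Φ : 𝓓(slab T, ℝ)) t := by
  ext x
  rw [SchwartzMap.lineDerivOp_apply_eq_fderiv, timeSlice_apply, lineDeriv_testFunction_apply]
  have h : HasFDerivAt (timeSlice Φ t) _ x :=
    (Φ.contDiff.differentiable (by simp) (t, x)).hasFDerivAt.comp x (hasFDerivAt_prodMk_right t x)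
  rw [h.fderiv, ContinuousLinearMap.comp_apply, ContinuousLinearMap.inr_apply]

/-- The equation `-Δ R_i R_j f = ∂_i ∂_j f` in space-time, from its version on time slices. -/
theorem sum_dx_dx_toDistr_of_isRieszRiesz {p : ℝ≥0∞} {δ : ℝ} (hδ : 0 ≤ δ) (hp : 1 ≤ p)
    (hpt : p ≠ ∞) (hb : RieszBounded p δ)
    (h2 : ∃ K : ℝ≥0∞, K ≠ ∞ ∧ ∀ f : E3 → ℝ, AEStronglyMeasurable f volume →
      eLpNorm f p (weighted δ) ≤ K * eLpNorm f 2 volume)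
    {i j : Fin 3} {f g : ℝ → E3 → ℝ} (hf : SlabIntegrable T f) (hg : SlabIntegrable T g)
    (hfg : ∀ᵐ t ∂(volume.restrict (Ioo 0 T)), IsRieszRiesz p (weighted δ) i j (f t) (g t)) :
    ∑ k, dx k (dx k (toDistr (slab T) g)) = -dx i (dx j (toDistr (slab T) f)) := by
  ext Φ
  have e1 : ∀ (k l : Fin 3) (S : 𝓓'(slab T, ℝ)), dx k (dx l S) Φ
      = S (∂_{((0 : ℝ), e k)} (∂_{((0 : ℝ), e l)} Φ : 𝓓(slab T, ℝ)) : 𝓓(slab T, ℝ)) :=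
    fun k l S => by
      rw [dx_comm]
      simp only [dx, Distribution.lineDerivOp_apply_apply, LineDeriv.lineDerivOp_neg, neg_neg]
  have e2 : (-dx i (dx j (toDistr (slab T) f))) Φ = -(dx i (dx j (toDistr (slab T) f)) Φ) := rfl
  rw [sum_distribution_apply, e2]
  simp only [e1]
  simp only [toDistr_apply_setIntegral hf, toDistr_apply_setIntegral hg]
  rw [← integral_finsetSum _ fun k _ => hg.integrable_test_mul _, setIntegral_slab
    (integrable_finsetSum _ fun k _ => hg.integrable_test_mul _),
    setIntegral_slab (hf.integrable_test_mul _), ← integral_neg]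
  refine integral_congr_ae ?_
  filter_upwards [hfg] with t ht
  have hcs : HasCompactSupport (timeSlice Φ t) :=
    Φ.hasCompactSupport.comp_isClosedEmbedding (isClosedEmbedding_prodMk t)
  have key := ht.integral_mul_lap hδ hp hpt hb h2 hcs
  have e3 : ∀ x, lap (timeSlice Φ t) x = ∑ k,
      (∂_{((0 : ℝ), e k)} (∂_{((0 : ℝ), e k)} Φ : 𝓓(slab T, ℝ)) : 𝓓(slab T, ℝ)) (t, x) :=
    fun x => by
    simp only [lap, Fin.sum_univ_three, _root_.add_apply, lineDeriv_timeSlice, timeSlice_apply]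
  simp only [e3, lineDeriv_timeSlice, timeSlice_apply] at key
  simp only [← Finset.sum_mul]
  simp only [mul_comm (∑ k : Fin 3, _), key, mul_comm (f t _)]

/-- The Laplacian of the pressure, obtained by taking the divergence of the equations. -/
theorem IsNSSolution.sum_dx_dx_pressure {u : ℝ → E3 → E3} {q : 𝓓'(slab T, ℝ)}
    {F : Fin 3 → Fin 3 → ℝ → E3 → ℝ} (h : IsNSSolution T u q F) :
    ∑ k, dx k (dx k q) = -(∑ i, ∑ j, dx i (dx j (toDistr (slab T) fun t x => u t x i * u t x j)))
      + ∑ i, ∑ j, dx i (dx j (toDistr (slab T) (F i j))) := by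
  set U : Fin 3 → 𝓓'(slab T, ℝ) := fun j => toDistr (slab T) fun t x => u t x j with hU
  have hdiv : ∑ j, dx j (U j) = 0 := h.divFree
  have hq : ∀ j, dx j q = (∑ i, dx i (dx i (U j))) - dt (U j)
      - (∑ i, dx i (toDistr (slab T) fun t x => u t x i * u t x j))
      + ∑ i, dx i (toDistr (slab T) (F i j)) := fun j => by
    have := h.momentum j
    simp only [hU]
    rw [this]; abel
  -- the linear terms in `u` disappear because `u` is divergence free
  have e1 : ∑ j, dx j (dt (U j)) = 0 := by
    simp only [dx_dt]
    exact (LineDeriv.lineDerivOp_sum _ _ _).symm.trans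
      ((congrArg dt hdiv).trans (LineDeriv.lineDerivOp_zero _))
  have e2 : ∑ j, dx j (∑ i, dx i (dx i (U j))) = 0 := by
    have : ∀ j, dx j (∑ i, dx i (dx i (U j))) = ∑ i, dx i (dx i (dx j (U j))) := fun j => by
      rw [dx_sum]
      refine Finset.sum_congr rfl fun i _ => ?_
      rw [dx_comm j i, dx_comm j i]
    simp only [this]
    rw [Finset.sum_comm]
    simp only [← dx_sum, hdiv, dx_zero, Finset.sum_const_zero]
  have e3 : ∀ W : Fin 3 → Fin 3 → 𝓓'(slab T, ℝ),
      ∑ j, dx j (∑ i, dx i (W i j)) = ∑ i, ∑ j, dx i (dx j (W i j)) := fun W => by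
    simp only [dx_sum]
    rw [Finset.sum_comm]
    exact Finset.sum_congr rfl fun i _ => Finset.sum_congr rfl fun j _ => dx_comm _ _ _
  simp only [hq, dx_add, dx_sub, Finset.sum_add_distrib, Finset.sum_sub_distrib, e1, e2]
  rw [e3 fun i j => toDistr (slab T) fun t x => u t x i * u t x j,
    e3 fun i j => toDistr (slab T) (F i j), sub_zero, zero_sub]

end PressureEquation

/-! ### The gradient of the pressure -/

section PressureFormula

/-- The formula for the pressure gradient, when the Riesz transforms are given by functions with
small averages. Let `D` be the candidate for the pressure. Both `q` and `D` have the same Laplacian,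
and `∂_k (q - D)` is null at infinity: the momentum equation writes `∂_k q` as a sum of derivatives
of functions with small averages. -/
theorem IsNSSolution.dx_pressure_eq {T : ℝ} {u : ℝ → E3 → E3} {q : 𝓓'(slab T, ℝ)}
    {F P Q : Fin 3 → Fin 3 → ℝ → E3 → ℝ} (h : IsNSSolution T u q F)
    (hu : ∀ i, SlabIntegrable T fun t x => u t x i)
    (hu' : ∀ i, SmallAverages T fun z => ‖u z.1 z.2 i‖ₑ)
    (hW : ∀ i j, SlabIntegrable T fun t x => u t x i * u t x j)
    (hW' : ∀ i j, SmallAverages T fun z => ‖u z.1 z.2 i * u z.1 z.2 j‖ₑ)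
    (hF : ∀ i j, SlabIntegrable T (F i j)) (hF' : ∀ i j, SmallAverages T fun z => ‖F i j z.1 z.2‖ₑ)
    (hP : ∀ i j, SlabIntegrable T (P i j)) (hP' : ∀ i j, SmallAverages T fun z => ‖P i j z.1 z.2‖ₑ)
    (hQ : ∀ i j, SlabIntegrable T (Q i j)) (hQ' : ∀ i j, SmallAverages T fun z => ‖Q i j z.1 z.2‖ₑ)
    (hΔP : ∀ i j, ∑ k, dx k (dx k (toDistr (slab T) (P i j)))
      = -dx i (dx j (toDistr (slab T) fun t x => u t x i * u t x j)))
    (hΔQ : ∀ i j, ∑ k, dx k (dx k (toDistr (slab T) (Q i j)))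
      = -dx i (dx j (toDistr (slab T) (F i j)))) (k : Fin 3) :
    dx k q = dx k (toDistr (slab T)
      fun t x => (∑ i, ∑ j, P i j t x) - ∑ i, ∑ j, Q i j t x) := by
  have hPs : ∀ i, SlabIntegrable T fun t x => ∑ j, P i j t x :=
    fun i => SlabIntegrable.sum _ fun j _ => hP i j
  have hQs : ∀ i, SlabIntegrable T fun t x => ∑ j, Q i j t x :=
    fun i => SlabIntegrable.sum _ fun j _ => hQ i j
  have hD : toDistr (slab T) (fun t x => (∑ i, ∑ j, P i j t x) - ∑ i, ∑ j, Q i j t x)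
      = (∑ i, ∑ j, toDistr (slab T) (P i j)) - ∑ i, ∑ j, toDistr (slab T) (Q i j) := by
    rw [toDistr_sub (SlabIntegrable.sum _ fun i _ => hPs i) (SlabIntegrable.sum _ fun i _ => hQs i),
      toDistr_sum _ fun i _ => hPs i, toDistr_sum _ fun i _ => hQs i]
    congr 1
    · exact Finset.sum_congr rfl fun i _ => toDistr_sum _ fun j _ => hP i j
    · exact Finset.sum_congr rfl fun i _ => toDistr_sum _ fun j _ => hQ i j
  rw [← sub_eq_zero, ← dx_sub, hD]
  set D := (∑ i, ∑ j, toDistr (slab T) (P i j)) - ∑ i, ∑ j, toDistr (slab T) (Q i j) with hDdef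
  have hlap : ∑ m, dx m (dx m (q - D)) = 0 := by
    have e1 : ∀ R : Fin 3 → Fin 3 → 𝓓'(slab T, ℝ), ∑ m, dx m (dx m (∑ i, ∑ j, R i j))
        = ∑ i, ∑ j, ∑ m, dx m (dx m (R i j)) := fun R => by
      simp only [dx_sum]
      rw [Finset.sum_comm]
      exact Finset.sum_congr rfl fun i _ => Finset.sum_comm
    simp only [dx_sub, Finset.sum_sub_distrib, hDdef, e1, hΔP, hΔQ, Finset.sum_neg_distrib]
    rw [h.sum_dx_dx_pressure]
    abel
  have hnull : IsNullAtInfinity (dx k (q - D)) := by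
    have hq : dx k q = (∑ i, dx i (dx i (toDistr (slab T) fun t x => u t x k)))
        - dt (toDistr (slab T) fun t x => u t x k)
        - (∑ i, dx i (toDistr (slab T) fun t x => u t x i * u t x k))
        + ∑ i, dx i (toDistr (slab T) (F i k)) := by
      rw [h.momentum k]; abel
    have hU := isNullAtInfinity_toDistr (hu k) (hu' k)
    have hD : IsNullAtInfinity D :=
      (IsNullAtInfinity.sum _ fun i _ => IsNullAtInfinity.sum _ fun j _ =>
        isNullAtInfinity_toDistr (hP i j) (hP' i j)).sub
      (IsNullAtInfinity.sum _ fun i _ => IsNullAtInfinity.sum _ fun j _ =>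
        isNullAtInfinity_toDistr (hQ i j) (hQ' i j))
    rw [dx_sub, hq]
    refine IsNullAtInfinity.sub (.add (.sub (.sub ?_ (hU.lineDeriv _)) ?_) ?_) (hD.lineDeriv _)
    · exact IsNullAtInfinity.sum _ fun i _ => (hU.lineDeriv _).lineDeriv _
    · exact IsNullAtInfinity.sum _ fun i _ =>
        (isNullAtInfinity_toDistr (hW i k) (hW' i k)).lineDeriv _
    · exact IsNullAtInfinity.sum _ fun i _ =>
        (isNullAtInfinity_toDistr (hF i k) (hF' i k)).lineDeriv _
  refine hnull.eq_zero ?_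
  have : ∀ m, dx m (dx m (dx k (q - D))) = dx k (dx m (dx m (q - D))) := fun m => by
    rw [dx_comm m k, dx_comm m k]
  simp only [this]
  rw [← dx_sum, hlap, dx_zero]

end PressureFormula

end NSPressure

theorem mainTheorem6 (γ T lam : ℝ) (hγ₁ : 1 < γ) (hγ₂ : γ < 5 / 2) (hT : 0 < T) (hlam : 1 < lam)
    (u : ℝ → NSPressure.E3 → NSPressure.E3)
    (F : Fin 3 → Fin 3 → ℝ → NSPressure.E3 → ℝ)
    (q : 𝓓'(NSPressure.slab T, ℝ))
    (hF : ∀ i j, NSPressure.MemMixed 2 2 (Ioo 0 T) (NSPressure.weighted γ) (F i j))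
    (hu : NSPressure.MemMixedLoc ∞ 2 u)
    (hDu : NSPressure.HasLocL2Gradient u)
    (hNS : NSPressure.IsNSSolution T u q F)
    (hFdss : NSPressure.IsDSSForcing lam F)
    (hudss : NSPressure.IsDSSVelocity lam u) :
    ∃ P Q : Fin 3 → Fin 3 → ℝ → NSPressure.E3 → ℝ,
      (∀ i j, ∀ᵐ t ∂(volume.restrict (Ioo 0 T)),
        NSPressure.IsRieszRiesz (6 / 5) (NSPressure.weighted (6 * γ / 5)) i j
          (fun x => u t x i * u t x j) (P i j t)) ∧
      (∀ i j, ∀ᵐ t ∂(volume.restrict (Ioo 0 T)),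
        NSPressure.IsRieszRiesz 2 (NSPressure.weighted γ) i j (F i j t) (Q i j t)) ∧
      NSPressure.MemMixed 4 (6 / 5) (Ioo 0 T) (NSPressure.weighted (6 * γ / 5))
        (fun t x => ∑ i, ∑ j, P i j t x) ∧
      NSPressure.MemMixed 2 2 (Ioo 0 T) (NSPressure.weighted γ)
        (fun t x => ∑ i, ∑ j, Q i j t x) ∧
      ∀ k, NSPressure.dx k q =
        NSPressure.dx k (NSPressure.toDistr (NSPressure.slab T)
          fun t x => (∑ i, ∑ j, P i j t x) - ∑ i, ∑ j, Q i j t x) := by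
  open NSPressure in
  have hγ0 : 0 ≤ γ := by linarith
  have hδ0 : 0 ≤ 6 * γ / 5 := by linarith
  have hδ3 : 6 * γ / 5 < 3 := by linarith
  have hI : volume (Ioo (0 : ℝ) T) ≠ ∞ := by simp
  have hp1 : (1 : ℝ≥0∞) ≤ 6 / 5 := by
    rw [ENNReal.le_div_iff_mul_le (by simp) (by simp)]; norm_num
  have hpt : (6 / 5 : ℝ≥0∞) ≠ ∞ := ENNReal.div_ne_top (by simp) (by simp)
  have hp4 : (6 / 5 : ℝ≥0∞) ≤ 4 := by
    rw [ENNReal.div_le_iff (by simp) (by simp)]; norm_num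
  have hp0 : (6 / 5 : ℝ≥0∞) ≠ 0 := (one_pos.trans_le hp1).ne'
  -- self-similarity gives the integrability of the nonlinear term
  have hW : ∀ i j, MemMixed 4 (6 / 5) (Ioo 0 T) (weighted (6 * γ / 5))
      fun t x => u t x i * u t x j := memMixed_mul hγ₁ hT hlam hu hDu hudss
  have hB := rieszBounded_six_fifths hγ0 hγ₂
  have hB2 := rieszBounded_two hγ0 (by linarith)
  -- the Riesz transforms, taken at each time and jointly measurable
  choose P hP hPR using fun i j => hB.exists_isRieszRiesz_slice hδ0 hp1 hpt hp4 i j hI (hW i j)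
  choose Q hQ hQR using fun i j => hB2.exists_isRieszRiesz_slice hγ0 one_le_two (by simp) le_rfl
    i j hI (hF i j)
  have hWs := fun i j => (hW i j).slabIntegrable hδ0 (hp1.trans hp4) hp1 hpt
  have hPs := fun i j => (hP i j).slabIntegrable hδ0 (hp1.trans hp4) hp1 hpt
  have hFs := fun i j => (hF i j).slabIntegrable hγ0 one_le_two one_le_two (by simp)
  have hQs := fun i j => (hQ i j).slabIntegrable hγ0 one_le_two one_le_two (by simp)
  -- both weights have exponents less than `3`, so all the functions have small averages
  have hWa := fun i j => SmallAverages.of_memLp hδ0 hδ3 hp1 hpt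
    ((hW i j).memLp_uncurry hp0 hpt hp4 hI)
  have hPa := fun i j => SmallAverages.of_memLp hδ0 hδ3 hp1 hpt
    ((hP i j).memLp_uncurry hp0 hpt hp4 hI)
  have hFa := fun i j => SmallAverages.of_memLp hγ0 (by linarith) one_le_two (by simp)
    ((hF i j).memLp_uncurry (by simp) (by simp) le_rfl hI)
  have hQa := fun i j => SmallAverages.of_memLp hγ0 (by linarith) one_le_two (by simp)
    ((hQ i j).memLp_uncurry (by simp) (by simp) le_rfl hI)
  refine ⟨P, Q, hPR, hQR,
    MemMixed.sum (hp1.trans hp4) hp1 hpt _ fun i _ =>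
      MemMixed.sum (hp1.trans hp4) hp1 hpt _ fun j _ => hP i j,
    MemMixed.sum one_le_two one_le_two (by simp) _ fun i _ =>
      MemMixed.sum one_le_two one_le_two (by simp) _ fun j _ => hQ i j, ?_⟩
  -- the velocity itself has small averages, because its square has
  refine hNS.dx_pressure_eq (fun i => (hu.component i).slabIntegrable le_top T)
    (fun i => SmallAverages.of_mul_self (f := fun t x => u t x i) (hWa i i)) hWs hWa hFs hFa hPs hPa
    hQs hQa (fun i j => ?_) fun i j => ?_
  · exact sum_dx_dx_toDistr_of_isRieszRiesz hδ0 hp1 hpt hB (exists_eLpNorm_six_fifths_le hγ₁)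
      (hWs i j) (hPs i j) (hPR i j)
  · exact sum_dx_dx_toDistr_of_isRieszRiesz hγ0 one_le_two (by simp) hB2
      ⟨1, ENNReal.one_ne_top, fun f _ => by
        rw [one_mul]; exact eLpNorm_mono_measure f (weighted_le_volume hγ0)⟩
      (hFs i j) (hQs i j) (hQR i j)
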